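/- Let $(M,g)$ be a smooth Lorentzian manifold (finite-dimensional, Hausdorff, without boundary, signature $(-,+,\dots,+)$), with Levi-Civita connection $\nabla$ and curvature $R(X,Y)Z=\nabla_X\nabla_YZ-\nabla_Y\nabla_XZ-\nabla_{[X,Y]}Z$. For $(x,p)\in TM$ and $v\in T_xM$ let $\mathrm{Ver}_{(x,p)}(v)$ be the velocity at $s=0$ of $s\mapsto(x,p+sv)$, and $\mathrm{Hor}_{(x,p)}(v)$ the velocity at $s=0$ of $s\mapsto(c(s),P(s))$, where $c(0)=x$, $c'(0)=v$, $P(0)=p$ and $P$ is parallel along $c$. The Sasaki metric $\overline g$ on $TM$ is defined by $$\overline g(\mathrm{Hor}(X),\mathrm{Hor}(Y))=\overline g(\mathrm{Ver}(X),\mathrm{Ver}(Y))=g(X,Y),\qquad \overline g(\mathrm{Hor}(X),\mathrm{Ver}(Y))=0;$$ $\overline\nabla$ and $\overline R$ are its Levi-Civita connection and curvature. Let $\exp_s(x,p)=(\gamma(s),\dot\gamma(s))$ be the geodesic flow, where $\gamma$ is the maximal geodesic of $(M,g)$ with $\gamma(0)=x$, $\dot\gamma(0)=p$; it is defined for $s$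 in an open interval $I_{x,p}\ni 0$, and $\exp_s$ is differentiable at $(x,p)$ for $s\in I_{x,p}$. Let $X$ denote the tangent vector of $s\mapsto\exp_s(x,p)$. A Jacobi field along this curve is a smooth vector field $J$ along it with $\overline\nabla_X\overline\nabla_XJ=\overline R(X,J)X$. **(a)** For every $(x,p)\in TM$ the curve $s\mapsto\exp_s(x,p)$, $s\in I_{x,p}$, is a geodesic of $(TM,\overline g)$. **(b)** For every $(x,p)\in TM$ and $v\in T_xM$, $J_H(s)=d\exp_s|_{(x,p)}(\mathrm{Hor}_{(x,p)}(v))$ and $J_V(s)=d\exp_s|_{(x,p)}(\mathrm{Ver}_{(x,p)}(v))$ are Jacobi fields along $s\mapsto\exp_s(x,p)$, and $$J_H(0)=\mathrm{Hor}_{(x,p)}(v),\qquad (\overline\nabla_XJ_H)(0)=\tfrac12\mathrm{Ver}_{(x,p)}(R(p,v)p),$$ $$J_V(0)=\mathrm{Ver}_{(x,p)}(v),\qquad (\overline\nabla_XJ_V)(0)=\mathrm{Hor}_{(x,p)}(v)+\tfrac12\mathrm{Hor}_{(x,p)}(R(p,v)p).$$ **(c)** The same holds in the mass shell. Let $M$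 be time oriented by a smooth timelike vector field $T$, let $P\subset TM$ be the set of all $(x,p)$ with $p$ null and future directed (that is, $g(p,p)=0$ and $g(p,T)<0$), let $e$ be a smooth vector field on $M$, and put $V=\mathrm{Ver}(e)$, which is transverse to $P$ at $(x,p)$ exactly if $g(p,e)\neq0$. At such points let $$\hat\nabla_AB=\overline\nabla_AB-\frac{\overline g(\overline\nabla_AB,\mathrm{Ver}_{(x,p)}(p))}{g(p,e)}\,V$$ be the induced connection on $P$ (the projection of $\overline\nabla_AB$ to $TP$ along $V$), and $\hat R$ its curvature. If $(x,p)\in P$, then $\exp_s(x,p)\in P$ for all $s\in I_{x,p}$. The vector field $J_H$ for any $v\in T_xM$, and $J_V$ for any $v\in T_xM$ with $g(p,v)=0$ (that is, with $\mathrm{Ver}_{(x,p)}(v)$ tangent to $P$), are tangent to $P$. For those $s$ for which $g(\dot\gamma(s),e)\ne0$, $s\mapsto\exp_s(x,p)$ is a geodesic of $\hat\nabla$, and $J_H$, $J_V$ satisfy $\hat\nabla_X\hat\nabla_XJ=\hat R(X,J)X$. If $g(p,e)\neq0$ at $x$, then $$(\hat\nabla_XJ_H)(0)=\tfrac12\mathrm{Ver}_{(x,p)}(R(p,v)p),\qquad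 (\hat\nabla_XJ_V)(0)=\mathrm{Hor}_{(x,p)}(v)+\tfrac12\mathrm{Hor}_{(x,p)}(R(p,v)p).$$ -/

import Mathlib

open Set
open scoped Manifold ContDiff Topology

noncomputable section

namespace Sasaki

/-- `w ↦ ½ (D(u)(v, w) + D(v)(u, w) - D(w)(u, v))`. -/
def koszul {F : Type*} [NormedAddCommGroup F] [NormedSpace ℝ F]
    (D : F →L[ℝ] F →L[ℝ] F →L[ℝ] ℝ) (u v : F) : F →L[ℝ] ℝ :=
  (1 / 2 : ℝ) • (D u v + D v u - (D.flip u).flip v)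

theorem koszul_add {F : Type*} [NormedAddCommGroup F] [NormedSpace ℝ F]
    (D : F →L[ℝ] F →L[ℝ] F →L[ℝ] ℝ) (u u' v : F) :
    koszul D (u + u') v = koszul D u v + koszul D u' v := by
  ext w
  simp [koszul]
  ring

theorem koszul_smul {F : Type*} [NormedAddCommGroup F] [NormedSpace ℝ F]
    (D : F →L[ℝ] F →L[ℝ] F →L[ℝ] ℝ) (a : ℝ) (u v : F) :
    koszul D (a • u) v = a • koszul D u v := by
  ext w
  simp [koszul]
  ring

/-! ### Metrics, connections and curvature on a manifold `N` modelled on `F` -/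

section General

variable {F : Type*} [NormedAddCommGroup F] [NormedSpace ℝ F]
  {K : Type*} [TopologicalSpace K] (J : ModelWithCorners ℝ F K)
  {N : Type*} [TopologicalSpace N] [ChartedSpace K N]

/-- The differential `dφ_x : T_x N → F` of the chart `φ` of `N` centred at `x₀`. -/
abbrev toChart (x₀ x : N) : TangentSpace J x →L[ℝ] F :=
  mfderiv J 𝓘(ℝ, F) (extChartAt J x₀) x

/-- The differential `d(φ⁻¹)_y : F → T_{φ⁻¹ y} N` of the inverse of the chart `φ` centred
at `x₀`; it sends the `i`-th vector of a basis of `F` to the `i`-th coordinate vector field. -/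
abbrev ofChart (x₀ : N) (y : F) : F →L[ℝ] TangentSpace J ((extChartAt J x₀).symm y) :=
  mfderivWithin 𝓘(ℝ, F) J (extChartAt J x₀).symm (range J) y

/-- A field of bilinear forms `h_x : T_x N × T_x N → ℝ` on the tangent spaces of `N`. -/
abbrev BilinField (N : Type*) [TopologicalSpace N] [ChartedSpace K N] : Type _ :=
  ∀ x : N, TangentSpace J x →L[ℝ] TangentSpace J x →L[ℝ] ℝ

variable {J}

/-- The components `h_ij(y)` of `h` in the chart centred at `x₀`, as a bilinear form on `F`. -/
def gram (h : BilinField J N) (x₀ : N) (y : F) : F →L[ℝ] F →L[ℝ] ℝ :=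
  let A : F →L[ℝ] F := ofChart J x₀ y
  let b : F →L[ℝ] F →L[ℝ] ℝ := h ((extChartAt J x₀).symm y)
  b.bilinearComp A A

/-- Connection coefficients on `N`: `C x₀ y u v = Γ(y)(u, v)`, i.e. `Γ^k_ij(y) u^i v^j`, in the
chart centred at `x₀`. -/
abbrev ConnCoeff (F N : Type*) : Type _ := N → F → F → F → F

/-- The coefficients of the Levi-Civita connection of `h` (the Christoffel symbols of the second
kind): `h(Γ(u, v), w) = ½ (∂_u h(v, w) + ∂_v h(u, w) - ∂_w h(u, v))`. Here
`ContinuousLinearMap.inverse` is the inverse of `v ↦ h(v, ·)`, which exists when `h` is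
nondegenerate. -/
def leviCivita (h : BilinField J N) : ConnCoeff F N :=
  fun x₀ y u v => (gram h x₀ y).inverse (koszul (fderiv ℝ (gram h x₀) y) u v)

theorem leviCivita_add (h : BilinField J N) (x₀ : N) (y u u' v : F) :
    leviCivita h x₀ y (u + u') v = leviCivita h x₀ y u v + leviCivita h x₀ y u' v := by
  simp only [leviCivita, koszul_add, map_add]

theorem leviCivita_smul (h : BilinField J N) (x₀ : N) (y : F) (a : ℝ) (u v : F) :
    leviCivita h x₀ y (a • u) v = a • leviCivita h x₀ y u v := by
  simp only [leviCivita, koszul_smul, map_smul]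

variable (J) in
/-- The velocity `c'(t)` of a curve. -/
def velocity (c : ℝ → N) (t : ℝ) : TangentSpace J (c t) :=
  mfderiv 𝓘(ℝ, ℝ) J c t (1 : ℝ)

/-- The covariant derivative `DW/dt` of a vector field `W` along a curve `c`, for the connection
with coefficients `C`, computed in the chart centred at `c t`:
`(DW/dt)^k = dW^k/dt + Γ^k_ij (dc^i/dt) W^j`. -/
def covDerivAlong (C : ConnCoeff F N) (c : ℝ → N) (W : ∀ t, TangentSpace J (c t)) (t : ℝ) :
    TangentSpace J (c t) :=
  toChart J (c t) (c t) |>.inverse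
    (deriv (fun r => toChart J (c t) (c r) (W r)) t
      + C (c t) (extChartAt J (c t) (c t)) (deriv (fun r => extChartAt J (c t) (c r)) t)
          (toChart J (c t) (c t) (W t)))

/-- The curvature `R(u, v)w = ∇_u ∇_v w - ∇_v ∇_u w - ∇_[u,v] w` in the chart centred at `x₀`:
`R(u, v)w = ∂_u Γ(v, w) - ∂_v Γ(u, w) + Γ(u, Γ(v, w)) - Γ(v, Γ(u, w))`. -/
def curvatureChart (C : ConnCoeff F N) (x₀ : N) (y u v w : F) : F :=
  fderiv ℝ (fun y' => C x₀ y' v w) y u - fderiv ℝ (fun y' => C x₀ y' u w) y v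
    + C x₀ y u (C x₀ y v w) - C x₀ y v (C x₀ y u w)

/-- The curvature tensor `R_x(u, v)w` of the connection with coefficients `C`. -/
def curvature (C : ConnCoeff F N) (x : N) (u v w : TangentSpace J x) : TangentSpace J x :=
  (toChart J x x).inverse
    (curvatureChart C x (extChartAt J x x) (toChart J x x u) (toChart J x x v) (toChart J x x w))

variable (J N) in
/-- An operator `D/dt` on vector fields along curves. -/
abbrev AlongOp : Type _ :=
  ∀ (c : ℝ → N), (∀ t, TangentSpace J (c t)) → ∀ t, TangentSpace J (c t)

/-- On the (open) set of times `S`, the curve `c` is smooth and satisfies `D c'/dt = 0`. -/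
def IsGeodesicOn (D : AlongOp J N) (c : ℝ → N) (S : Set ℝ) : Prop :=
  ContMDiffOn 𝓘(ℝ, ℝ) J ∞ c S ∧ ∀ t ∈ S, D c (velocity J c) t = 0

/-- On the (open) set of times `S`, the vector field `W` along `c` is smooth and satisfies the
Jacobi equation `D²W/dt² = R(c', W)c'`. -/
def IsJacobiFieldOn [IsManifold J 1 N] (D : AlongOp J N)
    (R : ∀ x : N, TangentSpace J x → TangentSpace J x → TangentSpace J x → TangentSpace J x)
    (c : ℝ → N) (W : ∀ t, TangentSpace J (c t)) (S : Set ℝ) : Prop :=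
  ContMDiffOn 𝓘(ℝ, ℝ) J.tangent ∞ (fun t => (⟨c t, W t⟩ : TangentBundle J N)) S ∧
    ∀ t ∈ S, D c (D c W) t = R (c t) (velocity J c t) (W t) (velocity J c t)

/-- `h` is a smooth Lorentzian metric: symmetric, with smooth components in the charts, and of
signature `(-, +, …, +)`, i.e. there is a timelike vector whose orthogonal complement is
positive definite. -/
structure IsLorentzian (h : BilinField J N) : Prop where
  smooth : ∀ x₀ : N, ContDiffOn ℝ ∞ (gram h x₀) (extChartAt J x₀).target
  symm : ∀ (x : N) (u v : TangentSpace J x), h x u v = h x v u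
  signature : ∀ x : N, ∃ u : TangentSpace J x, h x u u < 0 ∧
    ∀ w : TangentSpace J x, h x u w = 0 → w ≠ 0 → 0 < h x w w

end General

/-! ### The tangent bundle of `(M, g)` -/

variable {E : Type*} [NormedAddCommGroup E] [NormedSpace ℝ E] [FiniteDimensional ℝ E]
  {M : Type*} [TopologicalSpace M] [ChartedSpace E M] [IsManifold 𝓘(ℝ, E) ∞ M]

/-- The tangent bundle `TM`. The chart of `TM` centred at `z = (x, p)` is the natural one,
`(y, q) ↦ (φ y, dφ_y q)`, where `φ` is the chart of `M` centred at `x`; accordingly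
`T_z TM = E × E`, with `A.1 = dπ(A)`. -/
abbrev TM (E : Type*) [NormedAddCommGroup E] [NormedSpace ℝ E]
    (M : Type*) [TopologicalSpace M] [ChartedSpace E M] [IsManifold 𝓘(ℝ, E) ∞ M] : Type _ :=
  TangentBundle 𝓘(ℝ, E) M

/-- The model with corners of `TM`, modelled on `E × E`. -/
abbrev modelTM (E : Type*) [NormedAddCommGroup E] [NormedSpace ℝ E] :
    ModelWithCorners ℝ (E × E) (ModelProd E E) :=
  (𝓘(ℝ, E)).tangent

/-- A point of `TM`. -/
abbrev TM.mk (x : M) (p : TangentSpace 𝓘(ℝ, E) x) : TM E M := ⟨x, p⟩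

/-- A tangent vector `A` of `TM` at `z`, as a point of the tangent bundle of `TM`. -/
abbrev vecAt (z : TM E M) (A : TangentSpace (modelTM E) z) : TangentBundle (modelTM E) (TM E M) :=
  ⟨z, A⟩

variable (g : BilinField 𝓘(ℝ, E) M)

/-- The linear map `v ↦ Γ(v, p)` on `T_x M`, in the chart centred at `x`, for `z = (x, p)`. -/
def christoffelAt (z : TM E M) : E →L[ℝ] E :=
  LinearMap.toContinuousLinearMap
    { toFun := fun v => leviCivita g z.1 (extChartAt 𝓘(ℝ, E) z.1 z.1) v z.2
      map_add' := fun _ _ => leviCivita_add g _ _ _ _ _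
      map_smul' := fun _ _ => leviCivita_smul g _ _ _ _ _ }

/-- The vertical lift `Ver_(x,p)(v)`: the velocity at `s = 0` of `s ↦ (x, p + s v)`. -/
def Ver (z : TM E M) (v : TangentSpace 𝓘(ℝ, E) z.1) : TangentSpace (modelTM E) z :=
  ((0 : E), (v : E))

/-- The horizontal lift `Hor_(x,p)(v) = v^μ ∂_(x^μ) - v^μ p^ν Γ^λ_μν ∂_(p^λ)`: the velocity at
`s = 0` of any curve `s ↦ (c s, P s)` with `c 0 = x`, `c' 0 = v`, `P 0 = p` and `P` parallel
along `c`. -/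
def Hor (z : TM E M) (v : TangentSpace 𝓘(ℝ, E) z.1) : TangentSpace (modelTM E) z :=
  ((v : E), - christoffelAt g z v)

/-- The horizontal part of a tangent vector of `TM`, as a vector on `M`: `dπ(A)`. -/
def horPart (z : TM E M) : TangentSpace (modelTM E) z →L[ℝ] TangentSpace 𝓘(ℝ, E) z.1 :=
  ContinuousLinearMap.fst ℝ E E

/-- The vertical part of a tangent vector of `TM`, as a vector on `M`. -/
def verPart (z : TM E M) : TangentSpace (modelTM E) z →L[ℝ] TangentSpace 𝓘(ℝ, E) z.1 :=
  ContinuousLinearMap.snd ℝ E E + (christoffelAt g z).comp (ContinuousLinearMap.fst ℝ E E)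

theorem Hor_add_Ver (z : TM E M) (A : TangentSpace (modelTM E) z) :
    Hor g z (horPart z A) + Ver z (verPart g z A) = A := by
  refine Prod.ext ?_ ?_
  · exact add_zero _
  · exact neg_add_cancel_comm_assoc _ _

/-- The Sasaki metric on `TM`: with respect to `A = Hor a + Ver a'`, `B = Hor b + Ver b'`,
it is `(A, B) ↦ g(a, b) + g(a', b')`. -/
def sasaki : BilinField (modelTM E) (TM E M) := fun z =>
  let b : E →L[ℝ] E →L[ℝ] ℝ := g z.1
  let H : E × E →L[ℝ] E := horPart z
  let V : E × E →L[ℝ] E := verPart g z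
  b.bilinearComp H H + b.bilinearComp V V

theorem horPart_Hor (z : TM E M) (v : TangentSpace 𝓘(ℝ, E) z.1) : horPart z (Hor g z v) = v := rfl

theorem verPart_Hor (z : TM E M) (v : TangentSpace 𝓘(ℝ, E) z.1) : verPart g z (Hor g z v) = 0 :=
  neg_add_cancel (christoffelAt g z v)

set_option linter.unusedSectionVars false in
theorem horPart_Ver (z : TM E M) (v : TangentSpace 𝓘(ℝ, E) z.1) : horPart z (Ver z v) = 0 := rfl

theorem verPart_Ver (z : TM E M) (v : TangentSpace 𝓘(ℝ, E) z.1) : verPart g z (Ver z v) = v :=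
  have h (w : E) : w + christoffelAt g z 0 = w := by rw [map_zero, add_zero]
  h v

theorem sasaki_apply (z : TM E M) (A B : TangentSpace (modelTM E) z) :
    sasaki g z A B
      = g z.1 (horPart z A) (horPart z B) + g z.1 (verPart g z A) (verPart g z B) := rfl

theorem sasaki_Hor_Hor (z : TM E M) (v w : TangentSpace 𝓘(ℝ, E) z.1) :
    sasaki g z (Hor g z v) (Hor g z w) = g z.1 v w := by
  rw [sasaki_apply, horPart_Hor, horPart_Hor, verPart_Hor, verPart_Hor, map_zero, add_zero]

theorem sasaki_Hor_Ver (z : TM E M) (v w : TangentSpace 𝓘(ℝ, E) z.1) :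
    sasaki g z (Hor g z v) (Ver z w) = 0 := by
  rw [sasaki_apply, horPart_Hor, horPart_Ver, verPart_Hor, map_zero, map_zero, zero_add]
  rfl

theorem sasaki_Ver_Ver (z : TM E M) (v w : TangentSpace 𝓘(ℝ, E) z.1) :
    sasaki g z (Ver z v) (Ver z w) = g z.1 v w := by
  rw [sasaki_apply, horPart_Ver, horPart_Ver, verPart_Ver, verPart_Ver, map_zero, zero_add]

/-- The covariant derivative along curves in `M`, for the Levi-Civita connection of `g`. -/
def baseD : AlongOp 𝓘(ℝ, E) M := covDerivAlong (leviCivita g)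

/-- The lifts are the ones described above: a curve `r ↦ (c r, P r)` in `TM` has the velocity
`Hor(c') + Ver(DP/dr)`, so `Hor(c')` if `P` is parallel along `c`, and `Ver(P')` if `c` is
constant. -/
theorem velocity_TM (c : ℝ → M) (P : ∀ t, TangentSpace 𝓘(ℝ, E) (c t)) (t : ℝ)
    (h : MDifferentiableAt 𝓘(ℝ, ℝ) (modelTM E) (fun r => TM.mk (c r) (P r)) t) :
  velocity (modelTM E) (fun r => TM.mk (c r) (P r)) t =
    Hor g (TM.mk (c t) (P t)) (velocity 𝓘(ℝ, E) c t) + Ver (TM.mk (c t) (P t)) (baseD g c P t) := by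
  have hc : MDifferentiableAt 𝓘(ℝ, ℝ) 𝓘(ℝ, E) c t :=
    ((Bundle.mdifferentiable_proj (TangentSpace 𝓘(ℝ,E) : M → Type _)).mdifferentiableAt).comp t h
  have hr : ∀ᶠ r in 𝓝 t, c r ∈ (chartAt E (c t)).source :=
    hc.continuousAt.eventually ((chartAt E (c t)).open_source.mem_nhds (mem_chart_source E (c t)))
  have e1 : (fun r => extChartAt (modelTM E) (TM.mk (c t) (P t)) (TM.mk (c r) (P r))) =ᶠ[𝓝 t]
      fun r => ((extChartAt 𝓘(ℝ, E) (c t) (c r), toChart 𝓘(ℝ, E) (c t) (c r) (P r)) : E × E) := by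
    filter_upwards [hr] with r hr
    unfold toChart
    rw [← TangentBundle.continuousLinearMapAt_trivializationAt hr,
      TangentBundle.continuousLinearMapAt_trivializationAt_eq_core hr]
    rfl
  have hv : (velocity (modelTM E) (fun r => TM.mk (c r) (P r)) t : E × E) =
      deriv (fun r => ((extChartAt 𝓘(ℝ, E) (c t) (c r), toChart 𝓘(ℝ, E) (c t) (c r) (P r)) : E × E)) t := by
    rw [← e1.deriv_eq]
    simp only [velocity, mfderiv, h, writtenInExtChartAt, mfld_simps, fderivWithin_univ]
    rfl
  have hd : DifferentiableAt ℝ (fun r => ((extChartAt 𝓘(ℝ, E) (c t) (c r), toChart 𝓘(ℝ, E) (c t) (c r) (P r)) : E × E)) t := by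
    have h2 : DifferentiableAt ℝ (fun r => extChartAt (modelTM E) (TM.mk (c t) (P t)) (TM.mk (c r) (P r))) t :=
      differentiableWithinAt_univ.1 (by simpa [DifferentiableWithinAtProp, Function.comp_def] using! h.2)
    exact h2.congr_of_eventuallyEq e1.symm
  have hvc : (velocity 𝓘(ℝ, E) c t : E) = deriv (fun r => extChartAt 𝓘(ℝ, E) (c t) (c r)) t := by
    simp only [velocity, mfderiv, hc, writtenInExtChartAt, mfld_simps, fderivWithin_univ]
    rfl
  have hp : deriv (fun r => ((extChartAt 𝓘(ℝ, E) (c t) (c r), toChart 𝓘(ℝ, E) (c t) (c r) (P r)) : E × E)) t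
      = (deriv (fun r => extChartAt 𝓘(ℝ, E) (c t) (c r)) t,
        deriv (fun r => toChart 𝓘(ℝ, E) (c t) (c r) (P r)) t) :=
    (HasDerivAt.prodMk hd.fst.hasDerivAt hd.snd.hasDerivAt).deriv
  have hid : toChart 𝓘(ℝ, E) (c t) (c t) = ContinuousLinearMap.id ℝ _ := mfderiv_extChartAt_self
  have hb : (baseD g c P t : E) = deriv (fun r => toChart 𝓘(ℝ, E) (c t) (c r) (P r)) t
      + christoffelAt g (TM.mk (c t) (P t)) (velocity 𝓘(ℝ, E) c t) := by
    simp only [baseD, covDerivAlong, hid]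
    rw [← hvc]
    erw [ContinuousLinearMap.inverse_id]
    rfl
  refine hv.trans (hp.trans ?_)
  refine Prod.ext ?_ ?_
  · exact (hvc.symm.trans (add_zero _).symm)
  · have (a b d : E) (h : b = a + d) : a = -d + b := by rw [h]; abel
    exact this _ _ _ hb

/-- The covariant derivative along curves in `TM`, for the Levi-Civita connection of the Sasaki
metric. -/
def sasakiD : AlongOp (modelTM E) (TM E M) := covDerivAlong (leviCivita (sasaki g))

/-! ### The geodesic flow -/

/-- The curve `s ↦ (c s, c' s)` in `TM`. -/
def tangentLift (c : ℝ → M) (s : ℝ) : TM E M := TM.mk (c s) (velocity 𝓘(ℝ, E) c s)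

/-- `γ` restricts to a geodesic of `(M, g)` on the open interval `(a, b) ∋ 0`, with
`(γ 0, γ' 0) = z`. -/
def IsGeodesicFrom (z : TM E M) (γ : ℝ → M) (a b : ℝ) : Prop :=
  (0 : ℝ) ∈ Ioo a b ∧ IsGeodesicOn (baseD g) γ (Ioo a b) ∧
    tangentLift γ 0 = z

/-- The domain of the maximal geodesic `γ_(x,p)` with initial data `z = (x, p)`: all times reached
by a geodesic with these data. -/
def geodesicDomain (z : TM E M) : Set ℝ :=
  {s | ∃ (γ : ℝ → M) (a b : ℝ), IsGeodesicFrom g z γ a b ∧ s ∈ Ioo a b}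

open Classical in
/-- The geodesic flow `exp_s(x, p) = (γ_(x,p)(s), γ_(x,p)'(s))`, for `s` in the domain of
`γ_(x,p)`; for other `s` the value is irrelevant. -/
def geodesicFlow (s : ℝ) (z : TM E M) : TM E M :=
  if h : s ∈ geodesicDomain g z then tangentLift h.choose s else z

/-- The vector field `s ↦ d exp_s|_z (V)` along `s ↦ exp_s(z)`. -/
def dFlow (z : TM E M) (V : TangentSpace (modelTM E) z) (s : ℝ) :
    TangentSpace (modelTM E) (geodesicFlow g s z) :=
  mfderiv (modelTM E) (modelTM E) (geodesicFlow g s) z V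

/-! ### The mass shell and its induced connection -/

/-- The mass shell `P`: all `(x, p)` with `p` null and future directed, for the time orientation
given by a timelike vector field `T`. -/
def massShell (T : ∀ x : M, TangentSpace 𝓘(ℝ, E) x) : Set (TM E M) :=
  {z | g z.1 z.2 z.2 = 0 ∧ g z.1 z.2 (T z.1) < 0}

/-- A smooth vector field on `M`. -/
def IsSmoothField (e : ∀ x : M, TangentSpace 𝓘(ℝ, E) x) : Prop :=
  ContMDiff 𝓘(ℝ, E) (modelTM E) ∞ (fun x => TM.mk x (e x))

/-- The vector `Ver_(x,p)(p)` at `z = (x, p)`, which is normal to `P`: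
`T_z P = {A | ḡ(A, Ver_(x,p)(p)) = 0}`, as `ḡ(·, Ver_(x,p)(p))` is the differential of
`(x, p) ↦ ½ g(p, p)`. -/
def normalVec (z : TM E M) : TangentSpace (modelTM E) z := Ver z z.2

/-- The covariant derivative `∇̂` along curves in `P` that is induced by the Levi-Civita connection
of the Sasaki metric and the transversal vector `V = Ver(e)`, i.e. the projection along `V` to the
tangent spaces of `P`: with `N` the multiple of `Ver_(x,p)(p)` such that `ḡ(N, V) = -2`, it is
`∇̂_A B = ∇̄_A B + ½ ḡ(∇̄_A B, N) V`. It makes sense where `V` is transverse to `P`,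
that is, where `g(p, e) ≠ 0`. -/
def inducedD (e : ∀ x : M, TangentSpace 𝓘(ℝ, E) x) : AlongOp (modelTM E) (TM E M) :=
  fun c W t =>
    sasakiD g c W t
      - (sasaki g (c t) (sasakiD g c W t) (normalVec (c t))
          / sasaki g (c t) (Ver (c t) (e (c t).1)) (normalVec (c t))) • Ver (c t) (e (c t).1)

/-- The function `(x, p) ↦ ½ g(p, p)` in the chart of `TM` centred at `z₀`. -/
def energyChart (z₀ : TM E M) (y : E × E) : ℝ :=
  let z : TM E M := (extChartAt (modelTM E) z₀).symm y
  (1 / 2 : ℝ) * g z.1 z.2 z.2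

/-- The coefficients of the connection
`∇̃_A B = ∇̄_A B + (Hess q(A, B) / dq(V)) V`, `V = Ver(e)`, `q = ½ g(p, p)`, on the open set
`dq(V) = g(p, e) ≠ 0` of `TM`, where `Hess q(A, B) = A(B q) - (∇̄_A B) q`.
If `B` is tangent to the level sets of `q`, in particular along `P`, then `A(B q) = 0` for `A`
tangent to them, and so `∇̃_A B = ∇̄_A B - (dq(∇̄_A B) / dq(V)) V = ∇̂_A B`. Thus `∇̂` is the
restriction of `∇̃` to `P`, and the curvature of `∇̂` is the restriction of that of `∇̃`. -/
def inducedCoeff (e : ∀ x : M, TangentSpace 𝓘(ℝ, E) x) : ConnCoeff (E × E) (TM E M) :=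
  fun z₀ y A B =>
    let Γ : E × E := leviCivita (sasaki g) z₀ y A B
    let z : TM E M := (extChartAt (modelTM E) z₀).symm y
    let V : E × E := toChart (modelTM E) z₀ z (Ver z (e z.1))
    Γ + ((fderiv ℝ (fun y' => fderiv ℝ (energyChart g z₀) y' B) y A
            - fderiv ℝ (energyChart g z₀) y Γ)
          / fderiv ℝ (energyChart g z₀) y V) • V

end Sasaki

end

open Sasaki

noncomputable section

namespace Sasaki

set_option maxSynthPendingDepth 3
set_option linter.unusedSectionVars false

/-! ### Ordinary differential equations: smoothness and dependence on initial values -/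

section ODE

variable {F : Type*} [NormedAddCommGroup F] [NormedSpace ℝ F]

/-! The geodesic flow is the maximal flow of the spray `X = Hor(p)` on `TM`
(`isMaximalFlow_geodesicFlow`). In a natural chart of `TM` the Sasaki metric is an explicit
expression in the components of `g` (`gram_sasaki`). The Koszul formula and the pair symmetry of `R`
then give, for a vector `A` with horizontal part `a` and vertical part `α`, `∇̄_A X = Hor(α + ½ R(p,
α)p) + ½ Ver(R(p, a)p)` (`IsLocalMetric.nabla_localSpray`, `nablaSpray_eq`). Everything else follows
from this identity.

(a) For `A = X` one has `a = p` and `α = 0`, so `∇̄_X X = 0` because `R(p, p) = 0`.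

(b) A field `J = d exp_s(V)` solves the linearized equation of the spray, i.e. `[X, J] = 0`. As `∇̄`
is torsion-free, `∇̄_X J = ∇̄_J X`; the identity above at `s = 0`, for `V` horizontal or vertical,
gives the initial values (`sasakiD_dFlow`). Differentiating `∇̄_X X = 0` in the direction `J` gives
`∇̄_X ∇̄_X J = R̄(X, J)X`. This last step works for every torsion-free connection whose geodesics
include the integral curves of a vector field (`exists_hasDerivAt_jacobi`).

(c) Let `q = ½ g(p, p)`, so that `dq = ḡ(·, Ver(p))`. Since `Xq = 0`, both `q` and `dq(J)` are
constant along the flow, which keeps the orbits null and the fields tangent. Future direction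
persists because a nonzero null vector is never orthogonal to a timelike one and the flow does not
reach the zero section (`geodesicFlow_mem_massShell`). The induced connection extends to the
torsion-free connection `∇̄ + (Hess q / dq(V)) V` on the open set where `V` is transverse to the
level sets of `q`. From `Xq = 0` and `∇̄_X X = 0` follows `Hess q(X, X) = 0`, so the flow lines are
geodesics of it too, and the general principle of (b) applies again. The first derivatives of `J` do
not change, since the vertical part `½ R(p, a)p` of `∇̄_X J` is orthogonal to `p`
(`inducedD_dFlow`).

Analytically, differentiability of the flow in its initial value comes from Picard–Lindelöf for the
equation coupled with its linearization and a Grönwall estimate (`exists_flow_hasFDerivAt`),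
extended to all times by an open-closed argument. Covariant derivatives are defined in a chart that
moves with the curve; `toChartEnd_covDerivAlong` transfers them to a fixed chart, where they can be
differentiated again. -/

theorem contDiffAt_of_eventually_hasDerivAt [CompleteSpace F] {f : F → F} {Ω : Set F}
    (hΩ : IsOpen Ω) (hf : ContDiffOn ℝ ∞ f Ω) {c : ℝ → F} {t : ℝ} (ht : c t ∈ Ω)
    (hc : ∀ᶠ s in 𝓝 t, HasDerivAt c (f (c s)) s) : ContDiffAt ℝ ∞ c t := by
  have h1 : ∀ᶠ s in 𝓝 t, HasDerivAt c (f (c s)) s ∧ c s ∈ Ω :=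
    hc.and (hc.self_of_nhds.continuousAt.eventually (hΩ.mem_nhds ht))
  obtain ⟨ε, hε, h⟩ := Metric.eventually_nhds_iff_ball.1 h1
  have hsub : Icc (t - ε / 2) (t + ε / 2) ⊆ Metric.ball t ε := by
    intro s hs
    rw [Real.ball_eq_Ioo]
    exact ⟨by linarith [hs.1], by linarith [hs.2]⟩
  -- A solution has one derivative more than the right-hand side allows it a priori, so regularity
  -- bootstraps; `n := ⊤` collects all orders. The halved radius keeps the closed interval inside
  -- the open ball.
  have := ODE.contDiffOn_enat_Icc_of_hasDerivWithinAt (n := ⊤) (f := fun _ => f) (α := c)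
    (u := Ω) (tmin := t - ε / 2) (tmax := t + ε / 2)
    (hf.comp contDiffOn_snd fun x hx => hx.2)
    (fun s hs => (h s (hsub hs)).1.hasDerivWithinAt) (fun s hs => (h s (hsub hs)).2)
  exact this.contDiffAt (Icc_mem_nhds (by linarith) (by linarith))

/-- A two-sided Grönwall estimate for a curve that vanishes at `0`. -/
theorem norm_le_of_hasDerivAt_of_norm_le {δ δ' : ℝ → F} {K η ε : ℝ}
    (h0 : δ 0 = 0) (hd : ∀ t ∈ Ioo (-ε) ε, HasDerivAt δ (δ' t) t)
    (hb : ∀ t ∈ Ioo (-ε) ε, ‖δ' t‖ ≤ K * ‖δ t‖ + η) {t : ℝ} (ht : t ∈ Ioo (-ε) ε) :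
    ‖δ t‖ ≤ η * gronwallBound 0 K 1 |t| := by
  have hscale : ∀ x, gronwallBound 0 K η x = η * gronwallBound 0 K 1 x := by
    intro x
    unfold gronwallBound
    split_ifs <;> ring
  rcases le_total 0 t with h | h
  · have := norm_le_gronwallBound_of_norm_deriv_right_le (f := δ) (f' := δ') (δ := 0) (K := K)
      (ε := η) (a := 0) (b := t)
      (fun s hs => (hd s ⟨by linarith [hs.1, ht.2], by linarith [hs.2, ht.2]⟩).continuousAt.continuousWithinAt)
      (fun s hs => (hd s ⟨by linarith [hs.1, ht.2], by linarith [hs.2, ht.2]⟩).hasDerivWithinAt)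
      (by simp [h0]) (fun s hs => hb s ⟨by linarith [hs.1, ht.2], by linarith [hs.2, ht.2]⟩)
      t ⟨h, le_rfl⟩
    rw [abs_of_nonneg h]
    rwa [sub_zero, hscale] at this
  -- Negative times reduce to positive ones by the reflection `s ↦ -s`, which only flips the sign of
  -- the derivative.
  · have hmem : ∀ s ∈ Icc 0 (-t), -s ∈ Ioo (-ε) ε := fun s hs =>
      ⟨by linarith [hs.2, ht.1], by linarith [hs.1, ht.1]⟩
    have hd' : ∀ s ∈ Icc 0 (-t), HasDerivAt (fun s => δ (-s)) (-δ' (-s)) s := fun s hs => by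
      simpa [Function.comp_def] using (hd (-s) (hmem s hs)).scomp s (hasDerivAt_neg s)
    have := norm_le_gronwallBound_of_norm_deriv_right_le (f := fun s => δ (-s))
      (f' := fun s => -δ' (-s)) (δ := 0) (K := K) (ε := η) (a := 0) (b := -t)
      (fun s hs => (hd' s hs).continuousAt.continuousWithinAt)
      (fun s hs => (hd' s (Ico_subset_Icc_self hs)).hasDerivWithinAt)
      (by simp [h0])
      (fun s hs => by simpa using hb (-s) (hmem s (Ico_subset_Icc_self hs)))
      (-t) ⟨by linarith, le_rfl⟩
    rw [abs_of_nonpos h]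
    rwa [sub_zero, hscale, neg_neg] at this

/-- The first order Taylor estimate for a function with Lipschitz derivative. -/
theorem norm_sub_fderiv_le {f : F → F} {s : Set F} (hs : Convex ℝ s) {K : NNReal}
    (hd : ∀ y ∈ s, DifferentiableAt ℝ f y) (hf : LipschitzOnWith K (fderiv ℝ f) s)
    {a b : F} (ha : a ∈ s) (hb : b ∈ s) :
    ‖f b - f a - fderiv ℝ f a (b - a)‖ ≤ K * ‖b - a‖ * ‖b - a‖ := by
  have hseg : segment ℝ a b ⊆ s := hs.segment_subset ha hb
  refine (convex_segment a b).norm_image_sub_le_of_norm_hasFDerivWithin_le' (f' := fderiv ℝ f)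
    (fun y hy => (hd y (hseg hy)).hasFDerivAt.hasFDerivWithinAt) (fun y hy => ?_)
    (left_mem_segment ℝ a b) (right_mem_segment ℝ a b)
  refine (hf.norm_sub_le (hseg hy) ha).trans ?_
  gcongr
  rw [segment_eq_image'] at hy
  obtain ⟨θ, hθ, rfl⟩ := hy
  simp only
  rw [add_sub_cancel_left, norm_smul, Real.norm_of_nonneg hθ.1]
  exact mul_le_of_le_one_left (norm_nonneg _) hθ.2

/-- The solutions of `y' = f y` depend differentiably on the initial value, and the derivative
solves the linearized equation. -/
theorem exists_flow_hasFDerivAt [CompleteSpace F] {f : F → F} {Ω : Set F}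
    (hΩ : IsOpen Ω) (hf : ContDiffOn ℝ 2 f Ω) {y₀ : F} (hy₀ : y₀ ∈ Ω) :
    ∃ ε > 0, ∃ U : Set F, IsOpen U ∧ y₀ ∈ U ∧ ∃ (ψ : F → ℝ → F) (A : F → ℝ → F →L[ℝ] F),
      ∀ y ∈ U, ψ y 0 = y ∧ A y 0 = ContinuousLinearMap.id ℝ F ∧ ∀ t ∈ Ioo (-ε) ε,
        ψ y t ∈ Ω ∧ HasDerivAt (ψ y) (f (ψ y t)) t ∧
        HasDerivAt (A y) ((fderiv ℝ f (ψ y t)).comp (A y t)) t ∧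
        HasFDerivAt (fun y' => ψ y' t) (A y t) y := by
  have hf0 : ContDiffAt ℝ 2 f y₀ := hf.contDiffAt (hΩ.mem_nhds hy₀)
  have hf1 : ContDiffAt ℝ 1 (fderiv ℝ f) y₀ := hf0.fderiv_right (by norm_num)
  obtain ⟨K₂, s₂, hs₂, hK₂⟩ := hf1.exists_lipschitzOnWith
  -- the system for the flow and its derivative
  let G : F × (F →L[ℝ] F) → F × (F →L[ℝ] F) := fun x => (f x.1, (fderiv ℝ f x.1).comp x.2)
  let x₀ : F × (F →L[ℝ] F) := (y₀, ContinuousLinearMap.id ℝ F)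
  have hG : ContDiffAt ℝ 1 G x₀ := by
    refine ContDiffAt.prodMk ((hf0.of_le (by norm_num)).comp x₀ contDiffAt_fst) ?_
    exact ContDiffAt.clm_comp (hf1.comp x₀ contDiffAt_fst) contDiffAt_snd
  obtain ⟨ε₀, hε₀, a, r, L, K, hr, hpl⟩ := IsPicardLindelof.of_contDiffAt_one hG
  -- The coupled system is `C¹` because `f` is `C²`, so its solutions exist for a common time and
  -- are Lipschitz in the initial value.
  obtain ⟨α, hα, L', hL'⟩ :=
    (hpl 0).exists_forall_mem_closedBall_eq_hasDerivWithinAt_lipschitzOnWith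
  have hb2 : ∀ᶠ y in 𝓝 y₀, ‖fderiv ℝ f y‖ < ‖fderiv ℝ f y₀‖ + 1 :=
    hf1.continuousAt.norm.eventually (gt_mem_nhds (lt_add_one _))
  obtain ⟨ρ, hρ, hball⟩ := Metric.eventually_nhds_iff_ball.1
    ((Filter.eventually_mem_set.2 hs₂).and (hb2.and (hΩ.eventually_mem hy₀)))
  have hx₀ : x₀ ∈ Metric.closedBall x₀ (r : ℝ) := Metric.mem_closedBall_self r.2
  have hcont : ContinuousAt (α x₀) 0 :=
    ((hα x₀ hx₀).2 0 ⟨by linarith, by linarith⟩).continuousWithinAt.continuousAt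
      (Icc_mem_nhds (by linarith) (by linarith))
  have hclose : ∀ᶠ t in 𝓝 (0 : ℝ), dist (α x₀ t) x₀ < ρ / 2 := by
    have := hcont.eventually (Metric.ball_mem_nhds (α x₀ 0) (half_pos hρ))
    simpa [(hα x₀ hx₀).1] using! this
  obtain ⟨ε₁, hε₁, hclose⟩ := Metric.eventually_nhds_iff_ball.1 hclose
  have hLp : (0 : ℝ) < L' + 1 := by positivity
  set ε := min ε₀ ε₁ with hε
  have hε' : 0 < ε := lt_min hε₀ hε₁
  -- Within this radius the Lipschitz bound keeps solutions `ρ / 2`-close to the one starting at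
  -- `x₀`, which itself stays `ρ / 2`-close to `x₀` for `|t| < ε₁`. The `+ 1` avoids a zero
  -- denominator.
  set r' : ℝ := min r (ρ / 2 / (L' + 1)) with hr'
  have hr'0 : 0 < r' := lt_min hr (by positivity)
  have hIcc : ∀ t ∈ Ioo (-ε) ε, t ∈ Ioo (0 - ε₀) (0 + ε₀) := fun t ht =>
    ⟨by linarith [ht.1, min_le_left ε₀ ε₁], by linarith [ht.2, min_le_left ε₀ ε₁]⟩
  let ι : F → F × (F →L[ℝ] F) := fun y => (y, ContinuousLinearMap.id ℝ F)
  have hι : ∀ y y', dist (ι y) (ι y') = dist y y' := fun y y' => by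
    simp [ι, Prod.dist_eq]
  have hιr : ∀ y ∈ Metric.ball y₀ r', ι y ∈ Metric.closedBall x₀ (r : ℝ) := fun y hy => by
    have : dist (ι y) (ι y₀) ≤ r := (hι y y₀).trans_le (hy.le.trans (min_le_left _ _))
    exact this
  have hLip : ∀ y ∈ Metric.ball y₀ r', ∀ y' ∈ Metric.ball y₀ r', ∀ t ∈ Ioo (-ε) ε,
      dist (α (ι y) t) (α (ι y') t) ≤ L' * dist y y' := fun y hy y' hy' t ht => by
    rw [← hι y y']
    exact (hL' t (Ioo_subset_Icc_self (hIcc t ht))).dist_le_mul _ (hιr y hy) _ (hιr y' hy')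
  have hder : ∀ y ∈ Metric.ball y₀ r', ∀ t ∈ Ioo (-ε) ε,
      HasDerivAt (α (ι y)) (G (α (ι y) t)) t := fun y hy t ht =>
    ((hα _ (hιr y hy)).2 t (Ioo_subset_Icc_self (hIcc t ht))).hasDerivAt
      (Icc_mem_nhds (hIcc t ht).1 (hIcc t ht).2)
  have hmem : ∀ y ∈ Metric.ball y₀ r', ∀ t ∈ Ioo (-ε) ε,
      (α (ι y) t).1 ∈ Metric.ball y₀ ρ := fun y hy t ht => by
    have h1 := hLip y hy y₀ (Metric.mem_ball_self hr'0) t ht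
    have h2 : dist (α x₀ t) x₀ < ρ / 2 := by
      refine hclose t ?_
      rw [Real.ball_eq_Ioo]
      exact ⟨by linarith [ht.1, min_le_right ε₀ ε₁], by linarith [ht.2, min_le_right ε₀ ε₁]⟩
    have h3 : L' * dist y y₀ ≤ ρ / 2 := by
      have h4 : dist y y₀ ≤ ρ / 2 / (L' + 1) := hy.le.trans (min_le_right _ _)
      calc (L' : ℝ) * dist y y₀ ≤ (L' + 1) * (ρ / 2 / (L' + 1)) := by gcongr; linarith
        _ = ρ / 2 := by field_simp
    have h5 : dist (α (ι y) t) x₀ < ρ := by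
      linarith [dist_triangle (α (ι y) t) (α x₀ t) x₀]
    rw [Prod.dist_eq] at h5
    exact (le_max_left _ _).trans_lt h5
  have hd1 : ∀ y ∈ Metric.ball y₀ r', ∀ t ∈ Ioo (-ε) ε,
      HasDerivAt (fun t => (α (ι y) t).1) (f (α (ι y) t).1) t := fun y hy t ht => by
    simpa [G] using (hder y hy t ht).hasFDerivAt.fst.hasDerivAt
  have hd2 : ∀ y ∈ Metric.ball y₀ r', ∀ t ∈ Ioo (-ε) ε, HasDerivAt (fun t => (α (ι y) t).2)
      ((fderiv ℝ f (α (ι y) t).1).comp (α (ι y) t).2) t := fun y hy t ht => by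
    simpa [G] using (hder y hy t ht).hasFDerivAt.snd.hasDerivAt
  refine ⟨ε, hε', Metric.ball y₀ r', Metric.isOpen_ball, Metric.mem_ball_self hr'0,
    fun y t => (α (ι y) t).1, fun y t => (α (ι y) t).2, fun y hy => ⟨?_, ?_, fun t ht =>
      ⟨(hball _ (hmem y hy t ht)).2.2, hd1 y hy t ht, hd2 y hy t ht, ?_⟩⟩⟩
  · simp only [(hα _ (hιr y hy)).1, ι]
  · simp only [(hα _ (hιr y hy)).1, ι]
  -- Grönwall's estimate for the remainder
  set B : ℝ := gronwallBound 0 (‖fderiv ℝ f y₀‖ + 1) 1 |t|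
  have hquad : ∀ y' ∈ Metric.ball y₀ r', ‖(α (ι y') t).1 - (α (ι y) t).1
      - (α (ι y) t).2 (y' - y)‖ ≤ (K₂ * (L' : ℝ) ^ 2 * B) * ‖y' - y‖ ^ 2 := by
    intro y' hy'
    have := norm_le_of_hasDerivAt_of_norm_le (K := ‖fderiv ℝ f y₀‖ + 1)
      (η := K₂ * (L' : ℝ) ^ 2 * ‖y' - y‖ ^ 2) (ε := ε)
      (δ := fun t => (α (ι y') t).1 - (α (ι y) t).1 - (α (ι y) t).2 (y' - y))
      (δ' := fun t => f (α (ι y') t).1 - f (α (ι y) t).1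
        - ((fderiv ℝ f (α (ι y) t).1).comp (α (ι y) t).2) (y' - y))

      (by simp [(hα _ (hιr y hy)).1, (hα _ (hιr y' hy')).1, ι])
      (fun t ht => ((hd1 y' hy' t ht).sub (hd1 y hy t ht)).sub
        (((hd2 y hy t ht).clm_apply (hasDerivAt_const t (y' - y))).congr_deriv (by simp)))
      (fun t ht => ?_) ht
    · refine this.trans (le_of_eq ?_)
      ring
    · set u := (α (ι y) t).1
      set w := (α (ι y') t).1
      have hu := hmem y hy t ht
      have hw := hmem y' hy' t ht
      have hT := norm_sub_fderiv_le (convex_ball y₀ ρ)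
        (fun z hz => (hf.contDiffAt (hΩ.mem_nhds (hball z hz).2.2)).differentiableAt (by norm_num))
        (hK₂.mono fun z hz => (hball z hz).1) hu hw
      have hwu : ‖w - u‖ ≤ L' * ‖y' - y‖ := by
        have h1 := hLip y' hy' y hy t ht
        rw [Prod.dist_eq, dist_eq_norm y' y] at h1
        rw [← dist_eq_norm]
        exact (le_max_left _ _).trans h1
      -- The remainder satisfies the linearized equation up to the Taylor error of `f`, and that
      -- error is quadratic in `y' - y`.
      have hsplit : f w - f u - ((fderiv ℝ f u).comp (α (ι y) t).2) (y' - y)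
          = (fderiv ℝ f u) (w - u - (α (ι y) t).2 (y' - y))
            + (f w - f u - fderiv ℝ f u (w - u)) := by
        simp only [map_sub, ContinuousLinearMap.comp_apply]
        abel
      calc ‖f w - f u - ((fderiv ℝ f u).comp (α (ι y) t).2) (y' - y)‖
          ≤ ‖fderiv ℝ f u‖ * ‖w - u - (α (ι y) t).2 (y' - y)‖ + K₂ * ‖w - u‖ * ‖w - u‖ := by
            rw [hsplit]
            exact (norm_add_le _ _).trans (add_le_add (ContinuousLinearMap.le_opNorm _ _) hT)
        _ ≤ (‖fderiv ℝ f y₀‖ + 1) * ‖w - u - (α (ι y) t).2 (y' - y)‖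
            + K₂ * (L' * ‖y' - y‖) * (L' * ‖y' - y‖) := by
            gcongr
            exact (hball u hu).2.1.le
        _ = _ := by ring
  rw [hasFDerivAt_iff_isLittleO]
  have hO : (fun y' => (α (ι y') t).1 - (α (ι y) t).1 - (α (ι y) t).2 (y' - y))
      =O[𝓝 y] fun y' => ‖y' - y‖ ^ 2 := by
    refine Asymptotics.IsBigO.of_bound (K₂ * (L' : ℝ) ^ 2 * B) ?_
    filter_upwards [Metric.isOpen_ball.mem_nhds hy] with y' hy'
    simpa using hquad y' hy'
  refine hO.trans_isLittleO ?_
  have hlim : Filter.Tendsto (fun y' => y' - y) (𝓝 y) (𝓝 0) := by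
    exact (continuous_id.sub continuous_const).tendsto' y 0 (sub_self y)
  exact (Asymptotics.isLittleO_norm_pow_id one_lt_two).comp_tendsto hlim

end ODE

/-! ### Calculus in charts -/

section Charts

variable {F : Type*} [NormedAddCommGroup F] [NormedSpace ℝ F]
  {K : Type*} [TopologicalSpace K] (J : ModelWithCorners ℝ F K)
  {N : Type*} [TopologicalSpace N] [ChartedSpace K N]

/-- The transition map from the chart at `x₀` to the chart at `x₁`. -/
def transition (x₀ x₁ : N) (y : F) : F := extChartAt J x₁ ((extChartAt J x₀).symm y)

/-- `toChart` as an endomorphism of the model space. -/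
def toChartEnd (x₀ x : N) : F →L[ℝ] F := toChart J x₀ x

/-- `ofChart` as an endomorphism of the model space. -/
def ofChartEnd (x₀ : N) (y : F) : F →L[ℝ] F := ofChart J x₀ y

variable {J}

theorem transition_apply {x₀ x : N} (x₁ : N) (h₀ : x ∈ (extChartAt J x₀).source) :
    transition J x₀ x₁ (extChartAt J x₀ x) = extChartAt J x₁ x := by
  rw [transition, (extChartAt J x₀).left_inv h₀]

variable [J.Boundaryless]

theorem isOpen_transition_domain (x₀ x₁ : N) :
    IsOpen ((extChartAt J x₀).target ∩ (extChartAt J x₀).symm ⁻¹' (extChartAt J x₁).source) :=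
  (continuousOn_extChartAt_symm x₀).isOpen_inter_preimage (isOpen_extChartAt_target x₀)
    (isOpen_extChartAt_source x₁)

theorem eventually_mem_source_of_mem {x₀ x₁ x : N} (h₀ : x ∈ (extChartAt J x₀).source)
    (h₁ : x ∈ (extChartAt J x₁).source) :
    ∀ᶠ y in 𝓝 (extChartAt J x₀ x), y ∈ (extChartAt J x₀).target ∧
      (extChartAt J x₀).symm y ∈ (extChartAt J x₁).source :=
  (isOpen_transition_domain x₀ x₁).mem_nhds
    ⟨(extChartAt J x₀).map_source h₀, by rwa [mem_preimage, (extChartAt J x₀).left_inv h₀]⟩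

theorem fderiv_transition_self {x₀ x : N} (h₀ : x ∈ (extChartAt J x₀).source) :
    fderiv ℝ (transition J x₀ x₀) (extChartAt J x₀ x) = ContinuousLinearMap.id ℝ F := by
  have e : transition J x₀ x₀ =ᶠ[𝓝 (extChartAt J x₀ x)] id := by
    filter_upwards [eventually_mem_source_of_mem h₀ h₀] with y hy
    exact (extChartAt J x₀).right_inv hy.1
  rw [e.fderiv_eq, fderiv_id]

variable [IsManifold J ∞ N]

theorem contDiffOn_transition (x₀ x₁ : N) : ContDiffOn ℝ ∞ (transition J x₀ x₁)
    ((extChartAt J x₀).target ∩ (extChartAt J x₀).symm ⁻¹' (extChartAt J x₁).source) := by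
  have h := contDiffOn_ext_coord_change (I := J) (n := ∞) x₁ x₀
  have : ((extChartAt J x₀).symm.trans (extChartAt J x₁)).source =
    ((extChartAt J x₀).target ∩ (extChartAt J x₀).symm ⁻¹' (extChartAt J x₁).source) := by
    rw [PartialEquiv.trans_source, PartialEquiv.symm_source]
  exact this ▸ h

theorem contDiffAt_transition {x₀ x₁ x : N} (h₀ : x ∈ (extChartAt J x₀).source)
    (h₁ : x ∈ (extChartAt J x₁).source) :
    ContDiffAt ℝ ∞ (transition J x₀ x₁) (extChartAt J x₀ x) :=
  (contDiffOn_transition x₀ x₁).contDiffAt ((isOpen_transition_domain x₀ x₁).mem_nhds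
    ⟨(extChartAt J x₀).map_source h₀, by rwa [mem_preimage, (extChartAt J x₀).left_inv h₀]⟩)

/-- The tangent space at `x` is the model space as seen through the preferred chart at `x`; so the
differential of another chart is the derivative of a transition map. This reduces manifold
derivatives to ordinary ones. -/
theorem toChartEnd_eq {x₀ x : N} (h : x ∈ (extChartAt J x₀).source) :
    toChartEnd J x₀ x = fderiv ℝ (transition J x x₀) (extChartAt J x x) := by
  have : IsManifold J 1 N := IsManifold.of_le (n := ∞) (by norm_num)
  have hd : MDifferentiableAt J 𝓘(ℝ, F) (extChartAt J x₀) x :=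
    mdifferentiableAt_extChartAt (by simpa using h)
  simp only [toChartEnd, toChart, mfderiv, hd, writtenInExtChartAt, J.range_eq_univ,
    fderivWithin_univ, extChartAt_model_space_eq_id]
  rfl

theorem ofChartEnd_eq {x₀ : N} {y : F} (h : y ∈ (extChartAt J x₀).target) :
    ofChartEnd J x₀ y = fderiv ℝ (transition J x₀ ((extChartAt J x₀).symm y)) y := by
  have : IsManifold J 1 N := IsManifold.of_le (n := ∞) (by norm_num)
  have hd : MDifferentiableWithinAt 𝓘(ℝ, F) J (extChartAt J x₀).symm (range J) y :=
    mdifferentiableWithinAt_extChartAt_symm h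
  refine hd.mfderivWithin.trans ?_
  simp only [J.range_eq_univ,
    modelWithCornersSelf_coe, range_id]
  simp only [writtenInExtChartAt, extChartAt_model_space_eq_id, PartialEquiv.refl_coe,
    PartialEquiv.refl_symm, id, preimage_univ, univ_inter, fderivWithin_univ]
  rfl

theorem fderiv_transition_comp {x₀ x₁ x₂ x : N} (h₀ : x ∈ (extChartAt J x₀).source)
    (h₁ : x ∈ (extChartAt J x₁).source) (h₂ : x ∈ (extChartAt J x₂).source) :
    (fderiv ℝ (transition J x₁ x₂) (extChartAt J x₁ x)).comp
      (fderiv ℝ (transition J x₀ x₁) (extChartAt J x₀ x))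
      = fderiv ℝ (transition J x₀ x₂) (extChartAt J x₀ x) := by
  have e : transition J x₁ x₂ ∘ transition J x₀ x₁ =ᶠ[𝓝 (extChartAt J x₀ x)]
      transition J x₀ x₂ := by
    filter_upwards [eventually_mem_source_of_mem h₀ h₁] with y hy
    simp only [Function.comp, transition, (extChartAt J x₁).left_inv hy.2]
  rw [← e.fderiv_eq, fderiv_comp, transition_apply x₁ h₀]
  · rw [transition_apply x₁ h₀]
    exact (contDiffAt_transition h₁ h₂).differentiableAt (by norm_num)
  · exact (contDiffAt_transition h₀ h₁).differentiableAt (by norm_num)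

theorem toChartEnd_self (x : N) : toChartEnd J x x = ContinuousLinearMap.id ℝ F := by
  rw [toChartEnd_eq (mem_extChartAt_source x), fderiv_transition_self (mem_extChartAt_source x)]

theorem fderiv_transition_comp_toChartEnd {x₀ x₁ x : N} (h₀ : x ∈ (extChartAt J x₀).source)
    (h₁ : x ∈ (extChartAt J x₁).source) :
    (fderiv ℝ (transition J x₀ x₁) (extChartAt J x₀ x)).comp (toChartEnd J x₀ x)
      = toChartEnd J x₁ x := by
  rw [toChartEnd_eq h₀, toChartEnd_eq h₁, ← transition_apply x₀ (mem_extChartAt_source x),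
    transition_apply x₀ (mem_extChartAt_source x),
    fderiv_transition_comp (mem_extChartAt_source x) h₀ h₁]

theorem ofChartEnd_extChartAt {x₀ x : N} (h₀ : x ∈ (extChartAt J x₀).source) :
    ofChartEnd J x₀ (extChartAt J x₀ x) = fderiv ℝ (transition J x₀ x) (extChartAt J x₀ x) := by
  rw [ofChartEnd_eq ((extChartAt J x₀).map_source h₀), (extChartAt J x₀).left_inv h₀]

theorem toChartEnd_comp_ofChartEnd {x₀ x : N} (h₀ : x ∈ (extChartAt J x₀).source) :
    (toChartEnd J x₀ x).comp (ofChartEnd J x₀ (extChartAt J x₀ x))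
      = ContinuousLinearMap.id ℝ F := by
  rw [ofChartEnd_extChartAt h₀, toChartEnd_eq h₀,
    fderiv_transition_comp h₀ (mem_extChartAt_source x) h₀, fderiv_transition_self h₀]

theorem ofChartEnd_comp_toChartEnd {x₀ x : N} (h₀ : x ∈ (extChartAt J x₀).source) :
    (ofChartEnd J x₀ (extChartAt J x₀ x)).comp (toChartEnd J x₀ x)
      = ContinuousLinearMap.id ℝ F := by
  rw [ofChartEnd_extChartAt h₀, toChartEnd_eq h₀,
    fderiv_transition_comp (mem_extChartAt_source x) h₀ (mem_extChartAt_source x),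
    fderiv_transition_self (mem_extChartAt_source x)]

theorem ofChartEnd_comp_fderiv_transition {x₀ x₁ x : N} (h₀ : x ∈ (extChartAt J x₀).source)
    (h₁ : x ∈ (extChartAt J x₁).source) :
    (ofChartEnd J x₁ (extChartAt J x₁ x)).comp (fderiv ℝ (transition J x₀ x₁) (extChartAt J x₀ x))
      = ofChartEnd J x₀ (extChartAt J x₀ x) := by
  rw [ofChartEnd_extChartAt h₀, ofChartEnd_extChartAt h₁,
    fderiv_transition_comp h₀ h₁ (mem_extChartAt_source x)]

theorem ofChartEnd_toChartEnd {x₀ x : N} (h₀ : x ∈ (extChartAt J x₀).source) (w : F) :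
    ofChartEnd J x₀ (extChartAt J x₀ x) (toChartEnd J x₀ x w) = w :=
  DFunLike.congr_fun (ofChartEnd_comp_toChartEnd h₀) w

theorem toChartEnd_ofChartEnd {x₀ x : N} (h₀ : x ∈ (extChartAt J x₀).source) (w : F) :
    toChartEnd J x₀ x (ofChartEnd J x₀ (extChartAt J x₀ x) w) = w :=
  DFunLike.congr_fun (toChartEnd_comp_ofChartEnd h₀) w

theorem inverse_toChart_self (x : N) (w : F) :
    ((toChart J x x).inverse w : F) = w := by
  have h : (toChart J x x).inverse = (toChartEnd J x x).inverse := rfl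
  have h2 : (toChartEnd J x x).inverse w = w := by
    rw [toChartEnd_self, ContinuousLinearMap.inverse_id]; rfl
  exact h2

end Charts

theorem two_le_infty : (2 : ℕ∞ω) ≤ ∞ := WithTop.coe_le_coe.2 (le_top : (2 : ℕ∞) ≤ ⊤)

theorem one_add_one_le_infty : (1 + 1 : ℕ∞ω) ≤ ∞ := by
  rw [one_add_one_eq_two]; exact two_le_infty

/-! ### Change of coordinates for connections -/

section Pullback

variable {F : Type*} [NormedAddCommGroup F] [NormedSpace ℝ F]

theorem hasFDerivAt_bilin_apply {X : Type*} [NormedAddCommGroup X] [NormedSpace ℝ X]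
    {h : X → F →L[ℝ] F →L[ℝ] ℝ} {a b : X → F} {h' : X →L[ℝ] F →L[ℝ] F →L[ℝ] ℝ}
    {a' b' : X →L[ℝ] F} {y : X} (hh : HasFDerivAt h h' y) (ha : HasFDerivAt a a' y)
    (hb : HasFDerivAt b b' y) :
    ∃ L : X →L[ℝ] ℝ, HasFDerivAt (fun x => h x (a x) (b x)) L y ∧
      ∀ w, L w = h' w (a y) (b y) + h y (a' w) (b y) + h y (a y) (b' w) :=
  ⟨_, (hh.clm_apply ha).clm_apply hb, fun w => by simp; ring⟩

theorem fderiv_bilin_apply {X : Type*} [NormedAddCommGroup X] [NormedSpace ℝ X]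
    {h : X → F →L[ℝ] F →L[ℝ] ℝ} {a b : X → F} {y : X} (hh : DifferentiableAt ℝ h y)
    (ha : DifferentiableAt ℝ a y) (hb : DifferentiableAt ℝ b y) (w : X) :
    fderiv ℝ (fun x => h x (a x) (b x)) y w = fderiv ℝ h y w (a y) (b y)
      + h y (fderiv ℝ a y w) (b y) + h y (a y) (fderiv ℝ b y w) := by
  obtain ⟨L, hL, h⟩ := hasFDerivAt_bilin_apply hh.hasFDerivAt ha.hasFDerivAt hb.hasFDerivAt
  rw [hL.fderiv, h]

/-- Differentiating `g₀ = τ^* g₁` adds two second-derivative terms of `τ` to each of the three terms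
of the Koszul expression. By symmetry of `D²τ` and of `g₁`, all of them cancel except one, which is
the inhomogeneous term in the transformation law of Christoffel symbols. -/
theorem koszul_pullback {g₀ g₁ : F → F →L[ℝ] F →L[ℝ] ℝ} {τ : F → F} {y : F}
    (hg : ∀ᶠ z in 𝓝 y, ∀ u v, g₀ z u v = g₁ (τ z) (fderiv ℝ τ z u) (fderiv ℝ τ z v))
    (hg₀ : DifferentiableAt ℝ g₀ y) (hg₁ : DifferentiableAt ℝ g₁ (τ y))
    (hτ : ContDiffAt ℝ 2 τ y) (hsymm : ∀ u v, g₁ (τ y) u v = g₁ (τ y) v u) (u v w : F) :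
    koszul (fderiv ℝ g₀ y) u v w
      = koszul (fderiv ℝ g₁ (τ y)) (fderiv ℝ τ y u) (fderiv ℝ τ y v) (fderiv ℝ τ y w)
        + g₁ (τ y) (fderiv ℝ (fderiv ℝ τ) y u v) (fderiv ℝ τ y w) := by
  have hτ1 : DifferentiableAt ℝ τ y := hτ.differentiableAt (by norm_num)
  have hτ2 : DifferentiableAt ℝ (fderiv ℝ τ) y :=
    (hτ.fderiv_right (m := 1) (by norm_num)).differentiableAt (by norm_num)
  have hs : ∀ u v, fderiv ℝ (fderiv ℝ τ) y u v = fderiv ℝ (fderiv ℝ τ) y v u :=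
    hτ.isSymmSndFDerivAt (by simp)
  have key : ∀ w u v, fderiv ℝ g₀ y w u v
      = fderiv ℝ g₁ (τ y) (fderiv ℝ τ y w) (fderiv ℝ τ y u) (fderiv ℝ τ y v)
        + g₁ (τ y) (fderiv ℝ (fderiv ℝ τ) y w u) (fderiv ℝ τ y v)
        + g₁ (τ y) (fderiv ℝ τ y u) (fderiv ℝ (fderiv ℝ τ) y w v) := by
    intro w u v
    have e : (fun z => g₀ z u v) =ᶠ[𝓝 y]
        fun z => (g₁ ∘ τ) z (fderiv ℝ τ z u) (fderiv ℝ τ z v) := hg.mono fun z hz => hz u v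
    have h1 := fderiv_bilin_apply hg₀ (differentiableAt_const u) (differentiableAt_const v) w
    have hc : DifferentiableAt ℝ (g₁ ∘ τ) y :=
      DifferentiableAt.comp y hg₁ hτ1
    have h2 := fderiv_bilin_apply hc
      (hτ2.clm_apply (differentiableAt_const u)) (hτ2.clm_apply (differentiableAt_const v)) w
    rw [← e.fderiv_eq, h1, fderiv_comp y hg₁ hτ1] at h2
    simpa [fderiv_clm_apply hτ2 (differentiableAt_const _)] using h2
  simp only [koszul, smul_apply, sub_apply,
    add_apply, ContinuousLinearMap.flip_apply, key, smul_eq_mul]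
  rw [hs v u, hs w u, hs w v, hsymm _ (fderiv ℝ (fderiv ℝ τ) y u w),
    hsymm _ (fderiv ℝ (fderiv ℝ τ) y v w)]
  ring

/-- In finite dimension an injective map into the dual is bijective. Hence the `inverse` in the
Christoffel symbols is a true inverse and not the default value `0`. -/
theorem isInvertible_of_nondegenerate [FiniteDimensional ℝ F] {b : F →L[ℝ] F →L[ℝ] ℝ}
    (hb : ∀ u, (∀ v, b u v = 0) → u = 0) : b.IsInvertible := by
  have hinj : Function.Injective (b : F →ₗ[ℝ] F →L[ℝ] ℝ) := by
    rw [injective_iff_map_eq_zero]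
    intro u hu
    refine hb u fun v => ?_
    have hu' : b u = 0 := hu
    rw [hu']; rfl
  have hdim : Module.finrank ℝ F = Module.finrank ℝ (F →L[ℝ] ℝ) := by
    rw [← Subspace.dual_finrank_eq (K := ℝ) (V := F)]
    exact LinearEquiv.finrank_eq LinearMap.toContinuousLinearMap
  let e := LinearEquiv.ofInjectiveOfFinrankEq (b : F →ₗ[ℝ] F →L[ℝ] ℝ) hinj hdim
  exact ⟨e.toContinuousLinearEquiv, by ext; rfl⟩

end Pullback

section Connections

variable {F : Type*} [NormedAddCommGroup F] [NormedSpace ℝ F]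
  {K : Type*} [TopologicalSpace K] {J : ModelWithCorners ℝ F K}
  {N : Type*} [TopologicalSpace N] [ChartedSpace K N]

variable (J) in
/-- The transformation law of connection coefficients under a change of charts. -/
def IsConnection (C : ConnCoeff F N) : Prop :=
  ∀ x₀ x₁ x : N, x ∈ (extChartAt J x₀).source → x ∈ (extChartAt J x₁).source → ∀ u v : F,
    C x₁ (extChartAt J x₁ x) (fderiv ℝ (transition J x₀ x₁) (extChartAt J x₀ x) u)
        (fderiv ℝ (transition J x₀ x₁) (extChartAt J x₀ x) v)
      + fderiv ℝ (fderiv ℝ (transition J x₀ x₁)) (extChartAt J x₀ x) u v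
    = fderiv ℝ (transition J x₀ x₁) (extChartAt J x₀ x) (C x₀ (extChartAt J x₀ x) u v)

/-- A smooth symmetric nondegenerate bilinear form on the tangent spaces. -/
structure IsPseudoRiemannian (h : BilinField J N) : Prop where
  smooth : ∀ x₀ : N, ContDiffOn ℝ ∞ (gram h x₀) (extChartAt J x₀).target
  symm : ∀ (x : N) (u v : TangentSpace J x), h x u v = h x v u
  nondegenerate : ∀ (x : N) (u : TangentSpace J x), (∀ v, h x u v = 0) → u = 0

/-- `h` at `x` as a form on the model space. -/
def formAt (h : BilinField J N) (x : N) : F →L[ℝ] F →L[ℝ] ℝ := h x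

theorem gram_apply (h : BilinField J N) (x₀ : N) (y u v : F) :
    gram h x₀ y u v
      = formAt h ((extChartAt J x₀).symm y) (ofChartEnd J x₀ y u) (ofChartEnd J x₀ y v) := rfl

/-- A vector in the kernel would lie in the positive definite complement of a timelike vector while
having square zero. -/
theorem IsLorentzian.isPseudoRiemannian {h : BilinField J N} (hh : IsLorentzian h) :
    IsPseudoRiemannian h := by
  refine ⟨hh.smooth, hh.symm, fun x u hu => ?_⟩
  obtain ⟨t, ht, hpos⟩ := hh.signature x
  by_contra hne
  exact (hpos u (by rw [hh.symm]; exact hu t) hne).ne' (hu u)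

namespace IsPseudoRiemannian

theorem formAt_symm {h : BilinField J N} (hh : IsPseudoRiemannian h) (x : N) (u v : F) :
    formAt h x u v = formAt h x v u := hh.symm x u v

theorem formAt_nondegenerate {h : BilinField J N} (hh : IsPseudoRiemannian h) {x : N} {u : F}
    (hu : ∀ v, formAt h x u v = 0) : u = 0 := hh.nondegenerate x u hu

theorem gram_symm {h : BilinField J N} (hh : IsPseudoRiemannian h) (x₀ : N) (y u v : F) :
    gram h x₀ y u v = gram h x₀ y v u := by
  rw [gram_apply, gram_apply, hh.formAt_symm]

theorem contDiffAt_gram [J.Boundaryless] {h : BilinField J N} (hh : IsPseudoRiemannian h)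
    {x₀ : N} {y : F} (hy : y ∈ (extChartAt J x₀).target) : ContDiffAt ℝ ∞ (gram h x₀) y :=
  (hh.smooth x₀).contDiffAt ((isOpen_extChartAt_target x₀).mem_nhds hy)

end IsPseudoRiemannian

variable [J.Boundaryless] [IsManifold J ∞ N]

theorem gram_extChartAt (h : BilinField J N) {x₀ x : N} (hx : x ∈ (extChartAt J x₀).source)
    (u v : F) : gram h x₀ (extChartAt J x₀ x) (toChartEnd J x₀ x u) (toChartEnd J x₀ x v)
      = formAt h x u v := by
  rw [gram_apply, ofChartEnd_toChartEnd hx, ofChartEnd_toChartEnd hx, (extChartAt J x₀).left_inv hx]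

theorem gram_transition (h : BilinField J N) {x₀ x₁ x : N} (h₀ : x ∈ (extChartAt J x₀).source)
    (h₁ : x ∈ (extChartAt J x₁).source) (u v : F) :
    gram h x₀ (extChartAt J x₀ x) u v = gram h x₁ (extChartAt J x₁ x)
      (fderiv ℝ (transition J x₀ x₁) (extChartAt J x₀ x) u)
      (fderiv ℝ (transition J x₀ x₁) (extChartAt J x₀ x) v) := by
  rw [gram_apply, gram_apply, (extChartAt J x₀).left_inv h₀, (extChartAt J x₁).left_inv h₁,
    ← ofChartEnd_comp_fderiv_transition h₀ h₁]
  rfl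

namespace IsPseudoRiemannian

variable {h : BilinField J N}

theorem gram_nondegenerate (hh : IsPseudoRiemannian h) {x₀ : N} {y : F}
    (hy : y ∈ (extChartAt J x₀).target) {u : F}
    (hu : ∀ v, gram h x₀ y u v = 0) : u = 0 := by
  have hs := (extChartAt J x₀).map_target hy
  have h1 : ofChartEnd J x₀ y u = 0 := hh.formAt_nondegenerate fun v => by
    have h2 := hu (toChartEnd J x₀ ((extChartAt J x₀).symm y) v)
    have h3 := ofChartEnd_toChartEnd hs v
    rw [(extChartAt J x₀).right_inv hy] at h3
    rwa [gram_apply, h3] at h2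
  have := toChartEnd_ofChartEnd (x₀ := x₀) hs u
  rw [(extChartAt J x₀).right_inv hy, h1, map_zero] at this
  exact this.symm

theorem gram_isInvertible [FiniteDimensional ℝ F] (hh : IsPseudoRiemannian h) {x₀ : N} {y : F}
    (hy : y ∈ (extChartAt J x₀).target) : (gram h x₀ y).IsInvertible :=
  isInvertible_of_nondegenerate fun _ hu => hh.gram_nondegenerate hy hu

theorem gram_leviCivita [FiniteDimensional ℝ F] (hh : IsPseudoRiemannian h) {x₀ : N} {y : F}
    (hy : y ∈ (extChartAt J x₀).target) (u v : F) :
    gram h x₀ y (leviCivita h x₀ y u v) = koszul (fderiv ℝ (gram h x₀) y) u v := by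
  obtain ⟨e, he⟩ := hh.gram_isInvertible hy
  rw [leviCivita, ← he, ContinuousLinearMap.inverse_equiv]
  exact e.apply_symm_apply _

theorem isConnection_leviCivita [FiniteDimensional ℝ F] (hh : IsPseudoRiemannian h) :
    IsConnection J (leviCivita h) := by
  intro x₀ x₁ x h₀ h₁ u v
  have hy₀ := (extChartAt J x₀).map_source h₀
  have hy₁ := (extChartAt J x₁).map_source h₁
  have e := transition_apply x₁ h₀
  set τ := transition J x₀ x₁
  set y := extChartAt J x₀ x
  refine sub_eq_zero.1 (hh.gram_nondegenerate hy₁ fun w' => ?_)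
  -- The derivative of the reverse transition map is a right inverse of `Dτ`, so every test vector
  -- has the form required by `koszul_pullback`.
  obtain ⟨w, rfl⟩ : ∃ w, w' = fderiv ℝ τ y w := by
    refine ⟨fderiv ℝ (transition J x₁ x₀) (extChartAt J x₁ x) w', ?_⟩
    have := fderiv_transition_comp h₁ h₀ h₁
    rw [fderiv_transition_self h₁] at this
    exact (DFunLike.congr_fun this w').symm
  have hk := koszul_pullback (g₀ := gram h x₀) (g₁ := gram h x₁) (τ := τ) (y := y)
    (by
      filter_upwards [eventually_mem_source_of_mem h₀ h₁] with z hz u v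
      have := gram_transition h ((extChartAt J x₀).map_target hz.1) hz.2 u v
      rwa [(extChartAt J x₀).right_inv hz.1] at this)
    ((hh.contDiffAt_gram hy₀).differentiableAt (by norm_num))
    (by rw [e]; exact (hh.contDiffAt_gram hy₁).differentiableAt (by norm_num))
    ((contDiffAt_transition h₀ h₁).of_le two_le_infty) (hh.gram_symm _ _) u v w
  rw [← hh.gram_leviCivita hy₀, e, ← hh.gram_leviCivita hy₁, gram_transition h h₀ h₁] at hk
  rw [map_sub, map_add, sub_apply, add_apply, ← hk]
  exact sub_self _

end IsPseudoRiemannian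

/-- `covDerivAlong` uses the chart centred at `c t`, which varies with `t`, so a second derivative
needs a description in one fixed chart. The second derivative of the transition map that appears in
`W'` is absorbed by the transformation law of the coefficients. -/
theorem toChartEnd_covDerivAlong {C : ConnCoeff F N} (hC : IsConnection J C) {c : ℝ → N}
    {W : ∀ t, TangentSpace J (c t)} {t : ℝ} {x₀ : N} (hx : c t ∈ (extChartAt J x₀).source)
    (hc : ContinuousAt c t) (hd : DifferentiableAt ℝ (fun r => extChartAt J x₀ (c r)) t)
    (hW : DifferentiableAt ℝ (fun r => toChartEnd J x₀ (c r) (W r)) t) :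
    toChartEnd J x₀ (c t) (covDerivAlong C c W t)
      = deriv (fun r => toChartEnd J x₀ (c r) (W r)) t
        + C x₀ (extChartAt J x₀ (c t)) (deriv (fun r => extChartAt J x₀ (c r)) t)
          (toChartEnd J x₀ (c t) (W t)) := by
  have hself := mem_extChartAt_source (I := J) (c t)
  have hτ := contDiffAt_transition hx hself
  have hev : ∀ᶠ r in 𝓝 t, c r ∈ (extChartAt J x₀).source ∧ c r ∈ (extChartAt J (c t)).source :=
    (hc.eventually ((isOpen_extChartAt_source x₀).mem_nhds hx)).and
      (hc.eventually ((isOpen_extChartAt_source (c t)).mem_nhds hself))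
  set τ := transition J x₀ (c t) with hτdef
  set y := extChartAt J x₀ (c t) with hy
  have hτ1 : DifferentiableAt ℝ τ y := hτ.differentiableAt (by norm_num)
  have hτ2 : DifferentiableAt ℝ (fderiv ℝ τ) y :=
    (hτ.fderiv_right (m := 1) one_add_one_le_infty).differentiableAt (by norm_num)
  have d1 : deriv (fun r => extChartAt J (c t) (c r)) t
      = fderiv ℝ τ y (deriv (fun r => extChartAt J x₀ (c r)) t) := by
    have e : (fun r => extChartAt J (c t) (c r)) =ᶠ[𝓝 t] τ ∘ fun r => extChartAt J x₀ (c r) := by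
      filter_upwards [hev] with r hr
      exact (transition_apply (c t) hr.1).symm
    rw [e.deriv_eq, fderiv_comp_deriv t hτ1 hd]
  have d2 : deriv (fun r => toChartEnd J (c t) (c r) (W r)) t
      = fderiv ℝ τ y (deriv (fun r => toChartEnd J x₀ (c r) (W r)) t)
        + fderiv ℝ (fderiv ℝ τ) y (deriv (fun r => extChartAt J x₀ (c r)) t)
          (toChartEnd J x₀ (c t) (W t)) := by
    have e : (fun r => toChartEnd J (c t) (c r) (W r)) =ᶠ[𝓝 t]
        fun r => fderiv ℝ τ (extChartAt J x₀ (c r)) (toChartEnd J x₀ (c r) (W r)) := by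
      filter_upwards [hev] with r hr
      rw [← fderiv_transition_comp_toChartEnd hr.1 hr.2]
      rfl
    have h2 : HasDerivAt (fun r => fderiv ℝ τ (extChartAt J x₀ (c r)))
        (fderiv ℝ (fderiv ℝ τ) y (deriv (fun r => extChartAt J x₀ (c r)) t)) t :=
      hτ2.hasFDerivAt.comp_hasDerivAt t hd.hasDerivAt
    rw [e.deriv_eq, (h2.clm_apply hW.hasDerivAt).deriv, add_comm]
  have hval : (covDerivAlong C c W t : F) = fderiv ℝ τ y
      (deriv (fun r => toChartEnd J x₀ (c r) (W r)) t
        + C x₀ y (deriv (fun r => extChartAt J x₀ (c r)) t) (toChartEnd J x₀ (c t) (W t))) := by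
    have h3 : toChartEnd J (c t) (c t) (W t) = fderiv ℝ τ y (toChartEnd J x₀ (c t) (W t)) := by
      rw [← fderiv_transition_comp_toChartEnd hx hself]
      rfl
    have h4 : (covDerivAlong C c W t : F) = deriv (fun r => toChartEnd J (c t) (c r) (W r)) t
        + C (c t) (extChartAt J (c t) (c t)) (deriv (fun r => extChartAt J (c t) (c r)) t)
          (toChartEnd J (c t) (c t) (W t)) := inverse_toChart_self (c t) _
    rw [h4, d1, d2, h3, map_add, ← hC x₀ (c t) (c t) hx hself]
    abel
  have h5 := congrArg (toChartEnd J x₀ (c t)) hval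
  refine h5.trans ?_
  rw [toChartEnd_eq hx, hy, hτdef]
  have := fderiv_transition_comp hx hself hx
  rw [fderiv_transition_self hx] at this
  exact DFunLike.congr_fun this _

end Connections

/-! ### The Levi-Civita connection of a metric on an open subset of a vector space -/

section LocalMetric

variable {F : Type*} [NormedAddCommGroup F] [NormedSpace ℝ F]

/-- `koszul D` as a bilinear map. -/
def koszulBilin (D : F →L[ℝ] F →L[ℝ] F →L[ℝ] ℝ) : F →L[ℝ] F →L[ℝ] F →L[ℝ] ℝ :=
  (1 / 2 : ℝ) • (D + D.flip - (ContinuousLinearMap.flipₗᵢ ℝ F F ℝ :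
    (F →L[ℝ] F →L[ℝ] ℝ) →L[ℝ] (F →L[ℝ] F →L[ℝ] ℝ)).comp D.flip)

/-- The Christoffel symbols of `g` as a field of bilinear maps. -/
def christoffel (g : F → F →L[ℝ] F →L[ℝ] ℝ) (y : F) : F →L[ℝ] F →L[ℝ] F :=
  (ContinuousLinearMap.compL ℝ F (F →L[ℝ] ℝ) F (g y).inverse).comp (koszulBilin (fderiv ℝ g y))

/-- The curvature of the connection with coefficients `Γ`. -/
def curv (Γ : F → F →L[ℝ] F →L[ℝ] F) (y u v w : F) : F :=
  fderiv ℝ Γ y u v w - fderiv ℝ Γ y v u w + Γ y u (Γ y v w) - Γ y v (Γ y u w)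

/-- A smooth symmetric nondegenerate form on an open set. -/
structure IsLocalMetric (g : F → F →L[ℝ] F →L[ℝ] ℝ) (Ω : Set F) : Prop where
  isOpen : IsOpen Ω
  smooth : ContDiffOn ℝ ∞ g Ω
  symm : ∀ y u v, g y u v = g y v u
  nondegenerate : ∀ y ∈ Ω, ∀ u, (∀ v, g y u v = 0) → u = 0

namespace IsLocalMetric

variable {g : F → F →L[ℝ] F →L[ℝ] ℝ} {Ω : Set F} {y : F}

theorem contDiffAt (hg : IsLocalMetric g Ω) (hy : y ∈ Ω) : ContDiffAt ℝ ∞ g y :=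
  hg.smooth.contDiffAt (hg.isOpen.mem_nhds hy)

theorem differentiableAt (hg : IsLocalMetric g Ω) (hy : y ∈ Ω) : DifferentiableAt ℝ g y :=
  (hg.contDiffAt hy).differentiableAt (by norm_num)

theorem fderiv_symm (hg : IsLocalMetric g Ω) (hy : y ∈ Ω) (w u v : F) :
    fderiv ℝ g y w u v = fderiv ℝ g y w v u := by
  have h := hg.differentiableAt hy
  have h1 := fderiv_bilin_apply h (differentiableAt_const u) (differentiableAt_const v) w
  have h2 := fderiv_bilin_apply h (differentiableAt_const v) (differentiableAt_const u) w
  simp only [hg.symm _ v u] at h2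
  rw [h1] at h2
  simpa using h2

theorem ext (hg : IsLocalMetric g Ω) (hy : y ∈ Ω) {u v : F} (h : ∀ w, g y u w = g y v w) :
    u = v :=
  sub_eq_zero.1 (hg.nondegenerate y hy _ fun w => by
    rw [map_sub, sub_apply, h, sub_self])

variable [FiniteDimensional ℝ F]

theorem apply_christoffel (hg : IsLocalMetric g Ω) (hy : y ∈ Ω) (u v w : F) :
    g y (christoffel g y u v) w = koszul (fderiv ℝ g y) u v w := by
  obtain ⟨e, he⟩ := isInvertible_of_nondegenerate (hg.nondegenerate y hy)
  have : g y (christoffel g y u v) = koszul (fderiv ℝ g y) u v := by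
    change g y ((g y).inverse (koszul (fderiv ℝ g y) u v)) = _
    rw [← he, ContinuousLinearMap.inverse_equiv]
    exact e.apply_symm_apply _
  rw [this]

theorem christoffel_symm (hg : IsLocalMetric g Ω) (hy : y ∈ Ω) (u v : F) :
    christoffel g y u v = christoffel g y v u := by
  refine hg.ext hy fun w => ?_
  simp only [hg.apply_christoffel hy, koszul, smul_apply, sub_apply, add_apply,
    ContinuousLinearMap.flip_apply, hg.fderiv_symm hy w u v]
  ring

/-- Metric compatibility: in the sum of the two Koszul expressions the derivatives in the directions
`u` and `v` cancel. -/
theorem fderiv_eq (hg : IsLocalMetric g Ω) (hy : y ∈ Ω) (w u v : F) :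
    fderiv ℝ g y w u v = g y (christoffel g y w u) v + g y u (christoffel g y w v) := by
  rw [hg.symm y u]
  simp only [hg.apply_christoffel hy, koszul, smul_apply, sub_apply, add_apply, smul_eq_mul,
    ContinuousLinearMap.flip_apply]
  rw [hg.fderiv_symm hy w v u, hg.fderiv_symm hy u w v, hg.fderiv_symm hy v w u]
  ring

theorem contDiffAt_christoffel (hg : IsLocalMetric g Ω) (hy : y ∈ Ω) :
    ContDiffAt ℝ ∞ (christoffel g) y := by
  have h := hg.contDiffAt hy
  have hD : ContDiffAt ℝ ∞ (fderiv ℝ g) y := h.fderiv_right (by simp)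
  obtain ⟨e, he⟩ := isInvertible_of_nondegenerate (hg.nondegenerate y hy)
  have hinv : ContDiffAt ℝ ∞ (fun z => (g z).inverse) y := by
    have h1 := contDiffAt_map_inverse (n := ∞) e
    rw [he] at h1
    exact ContDiffAt.comp (G := (F →L[ℝ] ℝ) →L[ℝ] F) y h1 h
  have hk : ContDiffAt ℝ ∞ (fun z => koszulBilin (fderiv ℝ g z)) y := by
    have h1 : ContDiffAt ℝ ∞ (fun z => (fderiv ℝ g z).flip) y :=
      (ContinuousLinearMap.flipₗᵢ ℝ F F (F →L[ℝ] ℝ)).contDiff.contDiffAt.comp y hD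
    exact ((hD.add h1).sub (contDiffAt_const.clm_comp h1)).const_smul (1 / 2 : ℝ)
  exact ContDiffAt.clm_comp ((ContinuousLinearMap.compL ℝ F (F →L[ℝ] ℝ) F).contDiff.contDiffAt.comp y hinv) hk

theorem differentiableAt_christoffel (hg : IsLocalMetric g Ω) (hy : y ∈ Ω) :
    DifferentiableAt ℝ (christoffel g) y :=
  (hg.contDiffAt_christoffel hy).differentiableAt (by norm_num)

theorem fderiv_christoffel_symm (hg : IsLocalMetric g Ω) (hy : y ∈ Ω) (w u v : F) :
    fderiv ℝ (christoffel g) y w u v = fderiv ℝ (christoffel g) y w v u := by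
  have h := hg.differentiableAt_christoffel hy
  have e : (fun z => christoffel g z u v) =ᶠ[𝓝 y] fun z => christoffel g z v u := by
    filter_upwards [hg.isOpen.mem_nhds hy] with z hz using hg.christoffel_symm hz u v
  have key : ∀ u v, fderiv ℝ (fun z => christoffel g z u v) y w
      = fderiv ℝ (christoffel g) y w u v := fun u v => by
    have h1 := (h.hasFDerivAt.clm_apply (hasFDerivAt_const u y)).clm_apply (hasFDerivAt_const v y)
    rw [h1.fderiv]
    simp
  rw [← key, ← key, e.fderiv_eq]

/-- Metric compatibility is differentiated once more and antisymmetrized in `u` and `v`. The left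
side vanishes by symmetry of second derivatives, and what remains on the right is the curvature
acting on both slots. -/
theorem curv_skew (hg : IsLocalMetric g Ω) (hy : y ∈ Ω) (u v w z : F) :
    g y (curv (christoffel g) y u v w) z + g y w (curv (christoffel g) y u v z) = 0 := by
  have hΓ := hg.differentiableAt_christoffel hy
  have hD : DifferentiableAt ℝ (fderiv ℝ g) y :=
    ((hg.contDiffAt hy).fderiv_right (m := 1) one_add_one_le_infty).differentiableAt (by norm_num)
  have hs : ∀ u v, fderiv ℝ (fderiv ℝ g) y u v = fderiv ℝ (fderiv ℝ g) y v u :=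
    ((hg.contDiffAt hy).of_le two_le_infty).isSymmSndFDerivAt (by simp)
  have key : ∀ u v, fderiv ℝ (fderiv ℝ g) y u v w z =
      fderiv ℝ g y u (christoffel g y v w) z + g y (fderiv ℝ (christoffel g) y u v w) z
      + (fderiv ℝ g y u w (christoffel g y v z) + g y w (fderiv ℝ (christoffel g) y u v z)) := by
    intro u v
    have e : (fun x => fderiv ℝ g x v w z) =ᶠ[𝓝 y] fun x => g x (christoffel g x v w) z
        + g x w (christoffel g x v z) := by
      filter_upwards [hg.isOpen.mem_nhds hy] with x hx using hg.fderiv_eq hx v w z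
    have hΓw : ∀ w, HasFDerivAt (fun x => christoffel g x v w)
        (((fderiv ℝ (christoffel g) y).flip v).flip w) y := fun w =>
      ((hΓ.hasFDerivAt.clm_apply (hasFDerivAt_const v y)).clm_apply
        (hasFDerivAt_const w y)).congr_fderiv (by ext; simp)
    have h1 : HasFDerivAt (fun x => fderiv ℝ g x v w z)
        ((((fderiv ℝ (fderiv ℝ g) y).flip v).flip w).flip z) y :=
      (((hD.hasFDerivAt.clm_apply (hasFDerivAt_const v y)).clm_apply
        (hasFDerivAt_const w y)).clm_apply (hasFDerivAt_const z y)).congr_fderiv (by ext; simp)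
    have hgd := (hg.differentiableAt hy).hasFDerivAt
    obtain ⟨L₁, hL₁, hL₁'⟩ := hasFDerivAt_bilin_apply hgd (hΓw w) (hasFDerivAt_const z y)
    obtain ⟨L₂, hL₂, hL₂'⟩ := hasFDerivAt_bilin_apply hgd (hasFDerivAt_const w y) (hΓw z)
    have := DFunLike.congr_fun (h1.unique ((hL₁.add hL₂).congr_of_eventuallyEq e)) u
    simpa [hL₁', hL₂'] using this
  have h1 := key u v
  have h2 := key v u
  rw [hs u v, h2] at h1
  simp only [hg.fderiv_eq hy] at h1
  simp only [curv, map_add, map_sub, add_apply, sub_apply]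
  linarith

/-- For symmetric coefficients all terms of the cyclic sum cancel in pairs. -/
theorem curv_bianchi (hg : IsLocalMetric g Ω) (hy : y ∈ Ω) (u v w : F) :
    curv (christoffel g) y u v w + curv (christoffel g) y v w u + curv (christoffel g) y w u v
      = 0 := by
  simp only [curv]
  rw [hg.fderiv_christoffel_symm hy u v w, hg.fderiv_christoffel_symm hy v u w,
    hg.fderiv_christoffel_symm hy w v u, hg.christoffel_symm hy v w, hg.christoffel_symm hy u w,
    hg.christoffel_symm hy v u]
  abel

/-- The classical octahedron argument: the Bianchi identity for four triples taken from `u, v, w,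
z`, combined with skewness in the first and in the second pair of arguments. -/
theorem curv_pair_symm (hg : IsLocalMetric g Ω) (hy : y ∈ Ω) (u v w z : F) :
    g y (curv (christoffel g) y u v w) z = g y (curv (christoffel g) y w z u) v := by
  have hswap : ∀ a b c d, g y (curv (christoffel g) y a b c) d
      = - g y (curv (christoffel g) y b a c) d := fun a b c d => by
    rw [← neg_apply, ← map_neg]
    congr 2
    simp only [curv]
    abel
  have hskew : ∀ a b c d, g y (curv (christoffel g) y a b c) d
      = - g y (curv (christoffel g) y a b d) c := fun a b c d => by
    have := hg.curv_skew hy a b c d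
    rw [hg.symm y c] at this
    linarith
  have hB : ∀ a b c d, g y (curv (christoffel g) y a b c) d
      + g y (curv (christoffel g) y b c a) d + g y (curv (christoffel g) y c a b) d = 0 := by
    intro a b c d
    rw [← add_apply, ← add_apply, ← map_add, ← map_add, hg.curv_bianchi hy, map_zero]
    rfl
  linarith [hB u v w z, hB v w z u, hB w z u v, hB z u v w, hskew u v w z, hskew v w u z,
    hskew w u v z, hskew v w z u, hskew w z v u, hskew z v w u, hskew w z u v, hskew z u w v,
    hskew u w z v, hskew z u v w, hskew u v z w, hskew v z u w, hswap u w v z, hswap w u v z,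
    hswap v z u w, hswap z v u w, hswap u w z v, hswap v z w u]

end IsLocalMetric

end LocalMetric

/-! ### The Sasaki metric over an open subset of a vector space -/

section LocalSasaki

variable {E : Type*} [NormedAddCommGroup E] [NormedSpace ℝ E]

/-- The vertical part of a vector, for the connection `Γ`. -/
def localVer (Γ : E → E →L[ℝ] E →L[ℝ] E) (x : E × E) : E × E →L[ℝ] E :=
  ContinuousLinearMap.snd ℝ E E + ((Γ x.1).flip x.2).comp (ContinuousLinearMap.fst ℝ E E)

/-- The Sasaki metric of `g`. -/
def localSasaki (g : E → E →L[ℝ] E →L[ℝ] ℝ) (x : E × E) : E × E →L[ℝ] E × E →L[ℝ] ℝ :=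
  (g x.1).bilinearComp (ContinuousLinearMap.fst ℝ E E) (ContinuousLinearMap.fst ℝ E E)
    + (g x.1).bilinearComp (localVer (christoffel g) x) (localVer (christoffel g) x)

/-- The geodesic spray of `g`. -/
def localSpray (g : E → E →L[ℝ] E →L[ℝ] ℝ) (x : E × E) : E × E :=
  (x.2, - christoffel g x.1 x.2 x.2)

theorem localVer_apply (Γ : E → E →L[ℝ] E →L[ℝ] E) (x A : E × E) :
    localVer Γ x A = A.2 + Γ x.1 A.1 x.2 := rfl

theorem localSasaki_apply (g : E → E →L[ℝ] E →L[ℝ] ℝ) (x A B : E × E) :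
    localSasaki g x A B = g x.1 A.1 B.1
      + g x.1 (localVer (christoffel g) x A) (localVer (christoffel g) x B) := rfl

variable [FiniteDimensional ℝ E] {g : E → E →L[ℝ] E →L[ℝ] ℝ} {Ω : Set E} {x : E × E}

namespace IsLocalMetric

theorem contDiffAt_localVer (hg : IsLocalMetric g Ω) (hx : x.1 ∈ Ω) (A : E × E) :
    ContDiffAt ℝ ∞ (fun x => localVer (christoffel g) x A) x := by
  have h1 : ContDiffAt ℝ ∞ (fun x : E × E => christoffel g x.1) x :=
    (hg.contDiffAt_christoffel hx).comp x contDiffAt_fst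
  exact contDiffAt_const.add ((h1.clm_apply contDiffAt_const).clm_apply contDiffAt_snd)

theorem contDiffAt_localSpray (hg : IsLocalMetric g Ω) (hx : x.1 ∈ Ω) :
    ContDiffAt ℝ ∞ (localSpray g) x := by
  have h1 : ContDiffAt ℝ ∞ (fun x : E × E => christoffel g x.1) x :=
    (hg.contDiffAt_christoffel hx).comp x contDiffAt_fst
  exact contDiffAt_snd.prodMk ((h1.clm_apply contDiffAt_snd).clm_apply contDiffAt_snd).neg

theorem localSasaki (hg : IsLocalMetric g Ω) :
    IsLocalMetric (localSasaki g) (Ω ×ˢ (univ : Set E)) where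
  isOpen := hg.isOpen.prod isOpen_univ
  smooth := by
    refine contDiffOn_clm_apply.2 fun A => contDiffOn_clm_apply.2 fun B => fun x hx =>
      ContDiffAt.contDiffWithinAt ?_
    have h1 : ContDiffAt ℝ ∞ (fun x : E × E => g x.1) x := (hg.contDiffAt hx.1).comp x contDiffAt_fst
    exact ((h1.clm_apply contDiffAt_const).clm_apply contDiffAt_const).add
      ((h1.clm_apply (hg.contDiffAt_localVer hx.1 A)).clm_apply (hg.contDiffAt_localVer hx.1 B))
  symm x A B := by
    simp only [localSasaki_apply]
    rw [hg.symm _ A.1, hg.symm _ (localVer _ x A)]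
  nondegenerate x hx A hA := by
    -- Test vectors `(0, v)` see only the vertical part of `A`; once that vanishes, `(v, 0)` sees
    -- only the base component.
    have h2 : localVer (christoffel g) x A = 0 := hg.nondegenerate x.1 hx.1 _ fun v => by
      have := hA (0, v)
      simpa [localSasaki_apply, localVer_apply (christoffel g) x (0, v)] using this
    have h1 : A.1 = 0 := hg.nondegenerate x.1 hx.1 _ fun v => by
      simpa [localSasaki_apply, h2] using hA (v, 0)
    rw [localVer_apply, h1, map_zero] at h2
    exact Prod.ext h1 (by simpa using h2)

theorem hasFDerivAt_localVer (hg : IsLocalMetric g Ω) (hx : x.1 ∈ Ω) (A : E × E) :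
    ∃ L : E × E →L[ℝ] E, HasFDerivAt (fun x => localVer (christoffel g) x A) L x ∧
      ∀ C, L C = fderiv ℝ (christoffel g) x.1 C.1 A.1 x.2 + christoffel g x.1 A.1 C.2 := by
  have h1 : HasFDerivAt (fun x : E × E => christoffel g x.1) _ x :=
    (hg.differentiableAt_christoffel hx).hasFDerivAt.comp x hasFDerivAt_fst
  exact ⟨_, ((h1.clm_apply (hasFDerivAt_const A.1 x)).clm_apply hasFDerivAt_snd).const_add A.2,
    fun C => by simp [add_comm]⟩

theorem fderiv_localSasaki (hg : IsLocalMetric g Ω) (hx : x.1 ∈ Ω) (C A B : E × E) :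
    fderiv ℝ (Sasaki.localSasaki g) x C A B = fderiv ℝ g x.1 C.1 A.1 B.1
      + fderiv ℝ g x.1 C.1 (localVer (christoffel g) x A) (localVer (christoffel g) x B)
      + g x.1 (fderiv ℝ (christoffel g) x.1 C.1 A.1 x.2 + christoffel g x.1 A.1 C.2)
        (localVer (christoffel g) x B)
      + g x.1 (localVer (christoffel g) x A)
        (fderiv ℝ (christoffel g) x.1 C.1 B.1 x.2 + christoffel g x.1 B.1 C.2) := by
  have hS := hg.localSasaki.differentiableAt (y := x) ⟨hx, mem_univ _⟩
  have h1 : HasFDerivAt (fun x : E × E => g x.1) _ x :=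
    (hg.differentiableAt hx).hasFDerivAt.comp x hasFDerivAt_fst
  obtain ⟨LA, hLA, hLA'⟩ := hg.hasFDerivAt_localVer hx A
  obtain ⟨LB, hLB, hLB'⟩ := hg.hasFDerivAt_localVer hx B
  obtain ⟨L₀, h₀, h₀'⟩ := hasFDerivAt_bilin_apply hS.hasFDerivAt (hasFDerivAt_const A x)
    (hasFDerivAt_const B x)
  obtain ⟨L₁, h₁, h₁'⟩ := hasFDerivAt_bilin_apply h1 (hasFDerivAt_const A.1 x)
    (hasFDerivAt_const B.1 x)
  obtain ⟨L₂, h₂, h₂'⟩ := hasFDerivAt_bilin_apply h1 hLA hLB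
  have := DFunLike.congr_fun (h₀.unique (h₁.add h₂)) C
  simp only [h₀', add_apply, h₁', h₂', hLA', hLB'] at this
  simpa [add_assoc] using this

theorem fderiv_localSpray (hg : IsLocalMetric g Ω) (hx : x.1 ∈ Ω) (A : E × E) :
    fderiv ℝ (localSpray g) x A = (A.2, -(fderiv ℝ (christoffel g) x.1 A.1 x.2 x.2
      + christoffel g x.1 A.2 x.2 + christoffel g x.1 x.2 A.2)) := by
  have h1 : HasFDerivAt (fun x : E × E => christoffel g x.1) _ x :=
    (hg.differentiableAt_christoffel hx).hasFDerivAt.comp x hasFDerivAt_fst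
  have h2 : HasFDerivAt (localSpray g) _ x :=
    hasFDerivAt_snd.prodMk ((h1.clm_apply hasFDerivAt_snd).clm_apply hasFDerivAt_snd).neg
  rw [h2.fderiv]
  refine Prod.ext rfl ?_
  simp
  abel

/-- The covariant derivative of the geodesic spray with respect to the Sasaki metric. -/
theorem nabla_localSpray (hg : IsLocalMetric g Ω) (hx : x.1 ∈ Ω) (A : E × E) :
    fderiv ℝ (localSpray g) x A + christoffel (Sasaki.localSasaki g) x A (localSpray g x) =
      (localVer (christoffel g) x A
        + (1 / 2 : ℝ) • curv (christoffel g) x.1 x.2 (localVer (christoffel g) x A) x.2,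
      - christoffel g x.1 (localVer (christoffel g) x A
        + (1 / 2 : ℝ) • curv (christoffel g) x.1 x.2 (localVer (christoffel g) x A) x.2) x.2
        + (1 / 2 : ℝ) • curv (christoffel g) x.1 x.2 A.1 x.2) := by
  have hS := hg.localSasaki
  have hx' : x ∈ Ω ×ˢ (univ : Set E) := ⟨hx, mem_univ _⟩
  -- The spray is horizontal, which removes most terms of the Koszul expression below.
  have hker : localVer (christoffel g) x (localSpray g x) = 0 := by
    simp [localVer_apply, localSpray]
  refine hS.ext hx' fun B => ?_
  rw [map_add, add_apply, hS.apply_christoffel hx']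
  simp only [koszul, smul_apply, sub_apply, add_apply, smul_eq_mul,
    ContinuousLinearMap.flip_apply, hg.fderiv_localSasaki hx, hker, hg.fderiv_localSpray hx,
    map_zero, zero_apply]
  -- In the component along `B.1` the Koszul formula produces `R(p, B.1)p` paired with the vertical
  -- part of `A`; pair symmetry moves the curvature back to `A`.
  have hpair : g x.1 (curv (christoffel g) x.1 x.2 (localVer (christoffel g) x A) x.2) B.1
      = g x.1 (curv (christoffel g) x.1 x.2 B.1 x.2) (localVer (christoffel g) x A) :=
    hg.curv_pair_symm hx _ _ _ _
  rw [hg.symm _ _ (localVer (christoffel g) x A)] at hpair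
  -- The vertical parts `a`, `b` replace `A.2`, `B.2` as independent variables. With `Γ`, its
  -- derivative and `g` as atoms, the claim becomes a linear consequence of the expanded `hpair`,
  -- once the symmetric arguments of `Γ` and `g` are put in a common order.
  generalize hκA : localVer (christoffel g) x A = a at *
  generalize hκB : localVer (christoffel g) x B = b at *
  have hA2 : A.2 = a - christoffel g x.1 A.1 x.2 := by rw [← hκA, localVer_apply]; abel
  have hB2 : B.2 = b - christoffel g x.1 B.1 x.2 := by rw [← hκB, localVer_apply]; abel
  have hs := hg.christoffel_symm hx
  have hgs := hg.symm x.1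
  simp only [localSpray, localSasaki_apply, hκB, localVer_apply _ x (_, _), hA2, hB2,
    hg.fderiv_eq hx]
  rw [curv, curv] at hpair
  rw [curv, curv]
  generalize x.2 = q at *
  generalize A.1 = p at *
  generalize B.1 = r at *
  generalize christoffel g x.1 = γ at *
  generalize g x.1 = h at *
  simp only [map_add, map_sub, map_neg, map_smul, add_apply, sub_apply, neg_apply, smul_apply,
    smul_eq_mul] at hpair ⊢
  rw [hs q a, hs q r, hs q p, hs q b, hs r p, hs q (γ p q), hs q (γ r q), hs q (γ a q), hgs q (γ p r)]
  rw [hs q (γ r q), hs q (γ a q)] at hpair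
  linarith

end IsLocalMetric

end LocalSasaki

/-! ### Vector fields and integral curves in charts -/

section VectorFields

variable {F : Type*} [NormedAddCommGroup F] [NormedSpace ℝ F]
  {K : Type*} [TopologicalSpace K] {J : ModelWithCorners ℝ F K}
  {N : Type*} [TopologicalSpace N] [ChartedSpace K N]

/-- A vector field in the chart at `x₀`. -/
def chartField (v : ∀ x : N, TangentSpace J x) (x₀ : N) (y : F) : F :=
  toChartEnd J x₀ ((extChartAt J x₀).symm y) (v ((extChartAt J x₀).symm y))

theorem chartField_extChartAt (v : ∀ x : N, TangentSpace J x) {x₀ x : N}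
    (hx : x ∈ (extChartAt J x₀).source) :
    chartField v x₀ (extChartAt J x₀ x) = toChartEnd J x₀ x (v x) := by
  unfold chartField
  rw [(extChartAt J x₀).left_inv hx]

theorem velocity_eq_of_hasMFDerivAt {c : ℝ → N} {t : ℝ} {w : TangentSpace J (c t)}
    (h : HasMFDerivAt 𝓘(ℝ, ℝ) J c t ((1 : ℝ →L[ℝ] ℝ).smulRight w)) : velocity J c t = w := by
  have := h.mfderiv
  unfold velocity
  rw [this]
  exact one_smul ℝ w

section

variable [IsManifold J 1 N]

/-- This connects smoothness of sections, formulated by trivializations of the tangent bundle, with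
the chart differentials used everywhere else. -/
theorem trivializationAt_snd {x₀ x : N} (hx : x ∈ (extChartAt J x₀).source)
    (w : TangentSpace J x) :
    (trivializationAt F (TangentSpace J) x₀ ⟨x, w⟩).2 = toChartEnd J x₀ x w := by
  rw [extChartAt_source] at hx
  have h := TangentBundle.continuousLinearMapAt_trivializationAt (I := J) (𝕜 := ℝ) hx
  have h2 := Bundle.Trivialization.continuousLinearMapAt_apply_of_mem (R := ℝ)
    (trivializationAt F (TangentSpace J) x₀) (b := x) (by simpa using hx) w
  rw [← h2, h]
  rfl

theorem contMDiffAt_section_iff_chartField [J.Boundaryless] (v : ∀ x : N, TangentSpace J x)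
    (x₀ : N) : ContMDiffAt J J.tangent ∞ (fun x => (⟨x, v x⟩ : TangentBundle J N)) x₀ ↔
      ContDiffAt ℝ ∞ (chartField v x₀) (extChartAt J x₀ x₀) := by
  have h := Bundle.contMDiffAt_section (n := ∞) (IB := J) (F := F) (E := TangentSpace J)
    (s := v) x₀
  refine h.trans ?_
  have e : (fun x => (trivializationAt F (TangentSpace J) x₀ ⟨x, v x⟩).2) =ᶠ[𝓝 x₀]
      fun x => toChartEnd J x₀ x (v x) := by
    filter_upwards [extChartAt_source_mem_nhds (I := J) x₀] with x hx
    exact trivializationAt_snd hx _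
  rw [e.contMDiffAt_iff, contMDiffAt_iff]
  have hsimp : extChartAt 𝓘(ℝ, F) (toChartEnd J x₀ x₀ (v x₀))
      ∘ (fun x => toChartEnd J x₀ x (v x)) ∘ (extChartAt J x₀).symm = chartField v x₀ := by
    simp only [extChartAt_model_space_eq_id]
    rfl
  rw [hsimp, J.range_eq_univ, contDiffWithinAt_univ, and_iff_right_iff_imp]
  intro hc
  have e2 : (fun x => toChartEnd J x₀ x (v x)) =ᶠ[𝓝 x₀] chartField v x₀ ∘ extChartAt J x₀ := by
    filter_upwards [extChartAt_source_mem_nhds (I := J) x₀] with x hx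
    exact (chartField_extChartAt v hx).symm
  exact (hc.continuousAt.comp (continuousAt_extChartAt x₀)).congr e2.symm

theorem contMDiffAt_tangentBundle_iff {c : ℝ → N} {W : ∀ t, TangentSpace J (c t)} {t : ℝ} :
    ContMDiffAt 𝓘(ℝ, ℝ) J.tangent ∞ (fun r => (⟨c r, W r⟩ : TangentBundle J N)) t ↔
      ContMDiffAt 𝓘(ℝ, ℝ) J ∞ c t ∧
        ContDiffAt ℝ ∞ (fun r => toChartEnd J (c t) (c r) (W r)) t := by
  have h := Bundle.contMDiffAt_totalSpace (n := ∞) (IM := 𝓘(ℝ, ℝ)) (IB := J) (F := F)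
    (E := TangentSpace J) (f := fun r => (⟨c r, W r⟩ : TangentBundle J N)) (x₀ := t)
  refine h.trans (and_congr_right fun hc => ?_)
  have e : (fun r => (trivializationAt F (TangentSpace J) (c t) ⟨c r, W r⟩).2) =ᶠ[𝓝 t]
      fun r => toChartEnd J (c t) (c r) (W r) := by
    filter_upwards [hc.continuousAt.eventually (extChartAt_source_mem_nhds (I := J) (c t))] with r hr
    exact trivializationAt_snd hr _
  exact e.contMDiffAt_iff.trans contMDiffAt_iff_contDiffAt

/-- Smooth vector fields, in charts. -/
def IsSmoothVectorField (v : ∀ x : N, TangentSpace J x) : Prop :=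
  ∀ x₀ : N, ContDiffOn ℝ ∞ (chartField v x₀) (extChartAt J x₀).target

theorem IsSmoothVectorField.contMDiff [J.Boundaryless] {v : ∀ x : N, TangentSpace J x}
    (hv : IsSmoothVectorField v) :
    ContMDiff J J.tangent ∞ (fun x => (⟨x, v x⟩ : TangentBundle J N)) := fun x₀ =>
  (contMDiffAt_section_iff_chartField v x₀).2
    ((hv x₀).contDiffAt ((isOpen_extChartAt_target x₀).mem_nhds (mem_extChartAt_target x₀)))

end

variable [J.Boundaryless] [IsManifold J ∞ N]

theorem contMDiffAt_curve_iff {c : ℝ → N} {t : ℝ} {x₀ : N}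
    (hx : c t ∈ (extChartAt J x₀).source) (hc : ContinuousAt c t) :
    ContMDiffAt 𝓘(ℝ, ℝ) J ∞ c t ↔ ContDiffAt ℝ ∞ (fun r => extChartAt J x₀ (c r)) t := by
  rw [contMDiffAt_iff_target_of_mem_source (y := x₀) (by simpa using hx)]
  rw [and_iff_right hc, contMDiffAt_iff_contDiffAt]
  rfl

theorem hasFDerivAt_smulRight_one_iff {f : ℝ → F} {w : F} {t : ℝ} :
    HasFDerivAt f ((1 : ℝ →L[ℝ] ℝ).smulRight w) t ↔ HasDerivAt f w t := by
  rw [hasDerivAt_iff_hasFDerivAt]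
  refine iff_of_eq (congrArg₂ _ ?_ rfl)
  ext
  simp

/-- The manifold derivative is defined in the preferred chart at `c t`; composition with transition
maps carries the condition to any chart around that point. -/
theorem hasMFDerivAt_curve_iff {c : ℝ → N} {t : ℝ} {x₀ : N}
    (hx : c t ∈ (extChartAt J x₀).source) (w : TangentSpace J (c t)) :
    HasMFDerivAt 𝓘(ℝ, ℝ) J c t ((1 : ℝ →L[ℝ] ℝ).smulRight w) ↔ ContinuousAt c t ∧
      HasDerivAt (fun r => extChartAt J x₀ (c r)) (toChartEnd J x₀ (c t) w) t := by
  have hself := mem_extChartAt_source (I := J) (c t)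
  have h0 : HasMFDerivAt 𝓘(ℝ, ℝ) J c t ((1 : ℝ →L[ℝ] ℝ).smulRight w) ↔ ContinuousAt c t ∧
      HasDerivAt (fun r => extChartAt J (c t) (c r)) (w : F) t := by
    have key : HasMFDerivAt 𝓘(ℝ, ℝ) J c t ((1 : ℝ →L[ℝ] ℝ).smulRight w) ↔ ContinuousAt c t ∧
        HasFDerivWithinAt (fun r => extChartAt J (c t) (c r))
          ((1 : ℝ →L[ℝ] ℝ).smulRight (w : F)) (range 𝓘(ℝ, ℝ)) t := Iff.rfl
    rw [key, modelWithCornersSelf_coe, range_id, hasFDerivWithinAt_univ]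
    exact and_congr_right fun _ => hasFDerivAt_smulRight_one_iff
  rw [h0]
  refine and_congr_right fun hc => ?_
  have hev : ∀ᶠ r in 𝓝 t, c r ∈ (extChartAt J x₀).source ∧ c r ∈ (extChartAt J (c t)).source :=
    (hc.eventually ((isOpen_extChartAt_source x₀).mem_nhds hx)).and
      (hc.eventually ((isOpen_extChartAt_source (c t)).mem_nhds hself))
  constructor
  · intro h
    have e : (fun r => extChartAt J x₀ (c r)) =ᶠ[𝓝 t]
        transition J (c t) x₀ ∘ fun r => extChartAt J (c t) (c r) := by
      filter_upwards [hev] with r hr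
      exact (transition_apply x₀ hr.2).symm
    have h2 := ((contDiffAt_transition hself hx).differentiableAt (by norm_num)).hasFDerivAt.comp_hasDerivAt t h
    rw [toChartEnd_eq hx]
    exact h2.congr_of_eventuallyEq e
  · intro h
    have e : (fun r => extChartAt J (c t) (c r)) =ᶠ[𝓝 t]
        transition J x₀ (c t) ∘ fun r => extChartAt J x₀ (c r) := by
      filter_upwards [hev] with r hr
      exact (transition_apply (c t) hr.1).symm
    have h2 := ((contDiffAt_transition hx hself).differentiableAt (by norm_num)).hasFDerivAt.comp_hasDerivAt t h
    have h3 := DFunLike.congr_fun (fderiv_transition_comp_toChartEnd hx hself) w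
    rw [toChartEnd_self] at h3
    exact (h2.congr_of_eventuallyEq e).congr_deriv h3

theorem toChartEnd_velocity {c : ℝ → N} {t : ℝ} {x₀ : N} (hx : c t ∈ (extChartAt J x₀).source)
    (hc : MDifferentiableAt 𝓘(ℝ, ℝ) J c t) :
    HasDerivAt (fun r => extChartAt J x₀ (c r)) (toChartEnd J x₀ (c t) (velocity J c t)) t := by
  refine ((hasMFDerivAt_curve_iff hx _).1 (hc.hasMFDerivAt.congr_mfderiv ?_)).2
  refine ContinuousLinearMap.ext_ring ?_
  exact (one_smul ℝ (velocity J c t : F)).symm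

end VectorFields

/-! ### Maximal flows -/

section Flow

variable {F : Type*} [NormedAddCommGroup F] [NormedSpace ℝ F]
  {K : Type*} [TopologicalSpace K] {J : ModelWithCorners ℝ F K}
  {N : Type*} [TopologicalSpace N] [ChartedSpace K N]

/-- `Φ` is the maximal flow of `v`, and `dom z` is the domain of `s ↦ Φ s z`. -/
structure IsMaximalFlow (v : ∀ x : N, TangentSpace J x) (dom : N → Set ℝ) (Φ : ℝ → N → N) :
    Prop where
  exists_of_mem : ∀ {z s}, s ∈ dom z → ∃ (γ : ℝ → N) (a b : ℝ), (0 : ℝ) ∈ Ioo a b ∧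
    IsMIntegralCurveOn γ v (Ioo a b) ∧ γ 0 = z ∧ s ∈ Ioo a b
  mem_and_eq : ∀ {z} {γ : ℝ → N} {a b : ℝ}, (0 : ℝ) ∈ Ioo a b → IsMIntegralCurveOn γ v (Ioo a b) →
    γ 0 = z → ∀ s ∈ Ioo a b, s ∈ dom z ∧ Φ s z = γ s

namespace IsMaximalFlow

variable {v : ∀ x : N, TangentSpace J x} {dom : N → Set ℝ} {Φ : ℝ → N → N}

theorem isOpen_dom (hΦ : IsMaximalFlow v dom Φ) (z : N) : IsOpen (dom z) := by
  refine isOpen_iff_mem_nhds.2 fun s hs => ?_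
  obtain ⟨γ, a, b, h0, hγ, hz, hs⟩ := hΦ.exists_of_mem hs
  exact Filter.mem_of_superset (Ioo_mem_nhds hs.1 hs.2) fun r hr => (hΦ.mem_and_eq h0 hγ hz r hr).1

theorem Icc_subset_dom (hΦ : IsMaximalFlow v dom Φ) {z : N} {s : ℝ} (hs : s ∈ dom z) :
    uIcc 0 s ⊆ dom z := by
  obtain ⟨γ, a, b, h0, hγ, hz, hs⟩ := hΦ.exists_of_mem hs
  exact fun r hr => (hΦ.mem_and_eq h0 hγ hz r (ordConnected_Ioo.uIcc_subset h0 hs hr)).1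

theorem ordConnected_dom (hΦ : IsMaximalFlow v dom Φ) (z : N) : (dom z).OrdConnected := by
  refine ordConnected_of_uIcc_subset_left (x := 0) fun s hs => hΦ.Icc_subset_dom hs

theorem hasMFDerivAt (hΦ : IsMaximalFlow v dom Φ) {z : N} {s : ℝ} (hs : s ∈ dom z) :
    HasMFDerivAt 𝓘(ℝ, ℝ) J (fun r => Φ r z) s ((1 : ℝ →L[ℝ] ℝ).smulRight (v (Φ s z))) := by
  obtain ⟨γ, a, b, h0, hγ, hz, hs⟩ := hΦ.exists_of_mem hs
  have e : (fun r => Φ r z) =ᶠ[𝓝 s] γ := by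
    filter_upwards [Ioo_mem_nhds hs.1 hs.2] with r hr using (hΦ.mem_and_eq h0 hγ hz r hr).2
  have h := (hγ s hs).hasMFDerivAt (Ioo_mem_nhds hs.1 hs.2)
  have e2 : Φ s z = γ s := e.self_of_nhds
  rw [← e2] at h
  exact h.congr_of_eventuallyEq e

theorem continuousAt (hΦ : IsMaximalFlow v dom Φ) {z : N} {s : ℝ} (hs : s ∈ dom z) :
    ContinuousAt (fun r => Φ r z) s := (hΦ.hasMFDerivAt hs).continuousAt

variable [J.Boundaryless] [IsManifold J ∞ N] [CompleteSpace F]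

theorem zero_mem_dom (hΦ : IsMaximalFlow v dom Φ) (hv : IsSmoothVectorField v) (z : N) :
    0 ∈ dom z ∧ Φ 0 z = z := by
  have : IsManifold J 1 N := IsManifold.of_le (n := ∞) (by norm_num)
  obtain ⟨γ, h0, hγ⟩ := exists_isMIntegralCurveAt_of_contMDiffAt_boundaryless (I := J) (x₀ := z) 0
    ((hv.contMDiff z).of_le (by norm_num))
  obtain ⟨ε, hε, hγ⟩ := isMIntegralCurveAt_iff'.1 hγ
  rw [Real.ball_eq_Ioo] at hγ
  have h0' : (0 : ℝ) ∈ Ioo (0 - ε) (0 + ε) := ⟨by linarith, by linarith⟩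
  have := hΦ.mem_and_eq h0' hγ h0 0 h0'
  exact ⟨this.1, this.2.trans h0⟩

/-- The integral curve from `z` and the time-shifted one from `Φ s z` meet at time `s`. They glue to
a single integral curve by uniqueness, which requires the Hausdorff property, and maximality
identifies it with the flow. -/
theorem add_mem_dom [T2Space N] (hΦ : IsMaximalFlow v dom Φ) (hv : IsSmoothVectorField v) {z : N}
    {s t : ℝ} (hs : s ∈ dom z) (ht : t ∈ dom (Φ s z)) :
    s + t ∈ dom z ∧ Φ (s + t) z = Φ t (Φ s z) := by
  have : IsManifold J 1 N := IsManifold.of_le (n := ∞) (by norm_num)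
  have hv1 : ContMDiff J J.tangent 1 (fun x => (⟨x, v x⟩ : TangentBundle J N)) :=
    hv.contMDiff.of_le (by norm_num)
  obtain ⟨γ, a, b, h0, hγ, hz, hs⟩ := hΦ.exists_of_mem hs
  obtain ⟨η, a', b', h0', hη, hz', ht⟩ := hΦ.exists_of_mem ht
  have hη2 : IsMIntegralCurveOn (η ∘ (· - s)) v (Ioo (a' + s) (b' + s)) := by
    refine (isMIntegralCurveOn_comp_sub.2 hη).mono fun r hr => ?_
    exact ⟨by linarith [hr.1], by linarith [hr.2]⟩
  have hs' : s ∈ Ioo (a' + s) (b' + s) := ⟨by linarith [h0'.1], by linarith [h0'.2]⟩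
  have hagree : γ s = (η ∘ (· - s)) s := by
    simp only [Function.comp, sub_self, hz', (hΦ.mem_and_eq h0 hγ hz s hs).2]
  have hp := isMIntegralCurveOn_piecewise hv1 hγ hη2 ⟨hs, hs'⟩ hagree
  have heq := eqOn_piecewise_of_isMIntegralCurveOn_Ioo hv1 hγ hη2 ⟨hs, hs'⟩ hagree
  rw [Ioo_union_Ioo' (by linarith [hs.2, h0'.1]) (by linarith [hs.1, h0'.2])] at hp
  have hst : s + t ∈ Ioo (a' + s) (b' + s) := ⟨by linarith [ht.1], by linarith [ht.2]⟩
  have h := hΦ.mem_and_eq (z := z)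
    ⟨(min_le_left _ _).trans_lt h0.1, h0.2.trans_le (le_max_left _ _)⟩ hp
    (by rw [piecewise_eq_of_mem _ _ _ h0, hz]) (s + t)
    ⟨(min_le_right _ _).trans_lt hst.1, hst.2.trans_le (le_max_right _ _)⟩
  refine ⟨h.1, h.2.trans ?_⟩
  rw [heq hst, (hΦ.mem_and_eq h0' hη hz' t ht).2]
  simp

/-- Near every point, the flow is differentiable for a uniform time, and its derivative solves the
linearized equation in a chart. -/
theorem exists_flowBox (hΦ : IsMaximalFlow v dom Φ) (hv : IsSmoothVectorField v) (z : N) :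
    ∃ ε > 0, ∃ U ∈ 𝓝 z, ∃ A : F → ℝ → F →L[ℝ] F, ∀ w ∈ U, w ∈ (extChartAt J z).source ∧
      A (extChartAt J z w) 0 = ContinuousLinearMap.id ℝ F ∧ ∀ t ∈ Ioo (-ε) ε,
        t ∈ dom w ∧ Φ t w ∈ (extChartAt J z).source ∧ MDifferentiableAt J J (Φ t) w ∧
        HasDerivAt (A (extChartAt J z w)) ((fderiv ℝ (chartField v z)
          (extChartAt J z (Φ t w))).comp (A (extChartAt J z w) t)) t ∧
        ∀ V : TangentSpace J w, toChartEnd J z (Φ t w) (mfderiv J J (Φ t) w V)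
          = A (extChartAt J z w) t (toChartEnd J z w V) := by
  have : IsManifold J 1 N := IsManifold.of_le (n := ∞) (by norm_num)
  obtain ⟨ε, hε, U, hU, hzU, ψ, A, h⟩ := exists_flow_hasFDerivAt (isOpen_extChartAt_target z)
    ((hv z).of_le two_le_infty) (mem_extChartAt_target z)
  set W : Set N := (extChartAt J z).source ∩ extChartAt J z ⁻¹' U with hW
  have hWo : IsOpen W := (continuousOn_extChartAt z).isOpen_inter_preimage
    (isOpen_extChartAt_source z) hU
  have h0 : (0 : ℝ) ∈ Ioo (-ε) ε := ⟨by linarith, hε⟩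
  have hflow : ∀ w ∈ W, ∀ t ∈ Ioo (-ε) ε, t ∈ dom w ∧
      Φ t w = (extChartAt J z).symm (ψ (extChartAt J z w) t) := by
    intro w hw t ht
    obtain ⟨h1, -, h3⟩ := h _ hw.2
    -- The solution found in the chart is carried back to `N`; maximality then forces it to be the
    -- flow.
    refine hΦ.mem_and_eq (γ := fun t => (extChartAt J z).symm (ψ (extChartAt J z w) t)) h0
      (fun r hr => HasMFDerivAt.hasMFDerivWithinAt ?_) ?_ t ht
    · obtain ⟨hr1, hr2, -, -⟩ := h3 r hr
      have hsrc := (extChartAt J z).map_target hr1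
      refine (hasMFDerivAt_curve_iff hsrc _).2
        ⟨(continuousAt_extChartAt_symm'' hr1).comp hr2.continuousAt, ?_⟩
      have e : (fun r => extChartAt J z ((extChartAt J z).symm (ψ (extChartAt J z w) r)))
          =ᶠ[𝓝 r] ψ (extChartAt J z w) := by
        filter_upwards [Ioo_mem_nhds hr.1 hr.2] with r' hr'
        exact (extChartAt J z).right_inv (h3 r' hr').1
      exact hr2.congr_of_eventuallyEq e
    · simp only [h1, (extChartAt J z).left_inv hw.1]
  refine ⟨ε, hε, W, hWo.mem_nhds ⟨mem_extChartAt_source z, hzU⟩, A, fun w hw =>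
    ⟨hw.1, (h _ hw.2).2.1, fun t ht => ?_⟩⟩
  obtain ⟨ht1, ht2, ht3, ht4⟩ := (h _ hw.2).2.2 t ht
  obtain ⟨hdom, hval⟩ := hflow w hw t ht
  have hval' : extChartAt J z (Φ t w) = ψ (extChartAt J z w) t := by
    rw [hval, (extChartAt J z).right_inv ht1]
  have hsrc : Φ t w ∈ (extChartAt J z).source := by
    rw [hval]; exact (extChartAt J z).map_target ht1
  have hφ : MDifferentiableAt J 𝓘(ℝ, F) (extChartAt J z) w :=
    mdifferentiableAt_extChartAt (by simpa using hw.1)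
  have hφ' : MDifferentiableAt J 𝓘(ℝ, F) (extChartAt J z) (Φ t w) :=
    mdifferentiableAt_extChartAt (by simpa using hsrc)
  have hψ : HasMFDerivAt J 𝓘(ℝ, F) (fun w => ψ (extChartAt J z w) t) w
      ((A (extChartAt J z w) t).comp (mfderiv J 𝓘(ℝ, F) (extChartAt J z) w)) :=
    HasMFDerivAt.comp w (g := fun y => ψ y t) (hasMFDerivAt_iff_hasFDerivAt.2 ht4) hφ.hasMFDerivAt
  have hdiff : MDifferentiableAt J J (Φ t) w := by
    have hsymm : MDifferentiableAt 𝓘(ℝ, F) J (extChartAt J z).symm (ψ (extChartAt J z w) t) := by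
      have := mdifferentiableWithinAt_extChartAt_symm (I := J) ht1
      rwa [J.range_eq_univ, mdifferentiableWithinAt_univ] at this
    have h1 : MDifferentiableAt J J
        (fun w => (extChartAt J z).symm (ψ (extChartAt J z w) t)) w :=
      hsymm.comp w hψ.mdifferentiableAt
    refine h1.congr_of_eventuallyEq ?_
    filter_upwards [hWo.mem_nhds hw] with w' hw' using (hflow w' hw' t ht).2
  refine ⟨hdom, hsrc, hdiff, by rwa [hval'], fun V => ?_⟩
  have hcomp : HasMFDerivAt J 𝓘(ℝ, F) (extChartAt J z ∘ Φ t) w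
      ((mfderiv J 𝓘(ℝ, F) (extChartAt J z) (Φ t w)).comp (mfderiv J J (Φ t) w)) :=
    HasMFDerivAt.comp w hφ'.hasMFDerivAt hdiff.hasMFDerivAt
  have e : extChartAt J z ∘ Φ t =ᶠ[𝓝 w] fun w => ψ (extChartAt J z w) t := by
    filter_upwards [hWo.mem_nhds hw] with w' hw'
    rw [Function.comp, (hflow w' hw' t ht).2,
      (extChartAt J z).right_inv ((h _ hw'.2).2.2 t ht).1]
  have hu := hasMFDerivAt_unique (hcomp.congr_of_eventuallyEq e.symm) hψ
  exact DFunLike.congr_fun hu V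

/-! ### Differentiability of the flow at all times of its domain -/

variable [T2Space N]

/-- An open-closed argument on the connected set `dom z`. A flow box around `Φ s z` propagates the
property from any nearby good time to all times near `s`, since the flow for time `s + t` factors as
`Φ t ∘ Φ s`. -/
theorem eventually_mem_dom_and_mdifferentiableAt (hΦ : IsMaximalFlow v dom Φ)
    (hv : IsSmoothVectorField v) {z : N} {s : ℝ} (hs : s ∈ dom z) :
    (∀ᶠ z' in 𝓝 z, s ∈ dom z') ∧ MDifferentiableAt J J (Φ s) z := by
  set u : Set ℝ := {s ∈ dom z | (∀ᶠ z' in 𝓝 z, s ∈ dom z') ∧ MDifferentiableAt J J (Φ s) z}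
    with hu_def
  have step : ∀ s ∈ u, ∀ ε > (0 : ℝ), ∀ U : Set N, U ∈ 𝓝 (Φ s z) →
      (∀ w ∈ U, ∀ t ∈ Ioo (-ε) ε, t ∈ dom w ∧ MDifferentiableAt J J (Φ t) w) →
      ∀ t ∈ Ioo (-ε) ε, s + t ∈ u := by
    intro s hs ε hε U hU h t ht
    have hev : ∀ᶠ z' in 𝓝 z, s ∈ dom z' ∧ Φ s z' ∈ U :=
      hs.2.1.and (hs.2.2.continuousAt.eventually hU)
    have hev2 : ∀ᶠ z' in 𝓝 z, s + t ∈ dom z' ∧ Φ (s + t) z' = Φ t (Φ s z') :=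
      hev.mono fun z' hz' => hΦ.add_mem_dom hv hz'.1 (h _ hz'.2 t ht).1
    refine ⟨hev2.self_of_nhds.1, hev2.mono fun _ h => h.1, ?_⟩
    have h1 : MDifferentiableAt J J (Φ t ∘ Φ s) z :=
      (h _ (mem_of_mem_nhds hU) t ht).2.comp z hs.2.2
    exact h1.congr_of_eventuallyEq (hev2.mono fun _ h => h.2)
  have hsub : dom z ⊆ u := by
    refine (hΦ.ordConnected_dom z).isPreconnected.subset_of_closure_inter_subset ?_ ?_ ?_
    · refine isOpen_iff_mem_nhds.2 fun s hs => ?_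
      obtain ⟨ε, hε, U, hU, A, h⟩ := hΦ.exists_flowBox hv (Φ s z)
      filter_upwards [Ioo_mem_nhds (show s - ε < s by linarith) (show s < s + ε by linarith)]
        with r hr
      have := step s hs ε hε U hU (fun w hw t ht => ⟨((h w hw).2.2 t ht).1, ((h w hw).2.2 t ht).2.2.1⟩)
        (r - s) ⟨by linarith [hr.1], by linarith [hr.2]⟩
      rwa [add_sub_cancel] at this
    · obtain ⟨h1, h2⟩ := hΦ.zero_mem_dom hv z
      refine ⟨0, h1, h1, Filter.Eventually.of_forall fun z' => (hΦ.zero_mem_dom hv z').1, ?_⟩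
      have : Φ 0 = id := funext fun z' => (hΦ.zero_mem_dom hv z').2
      rw [this]
      exact mdifferentiableAt_id
    -- Closedness: the box is centred at the limit point `Φ s z`, and a good time `r` close to `s`
    -- has `Φ r z` in that box with `|s - r| < ε`.
    · rintro s ⟨hs, hsd⟩
      obtain ⟨ε, hε, U, hU, A, h⟩ := hΦ.exists_flowBox hv (Φ s z)
      have hev : ∀ᶠ r in 𝓝 s, U ∈ 𝓝 (Φ r z) ∧ r ∈ Ioo (s - ε) (s + ε) :=
        ((hΦ.continuousAt hsd).eventually (eventually_mem_nhds_iff.2 hU)).and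
          (Ioo_mem_nhds (by linarith) (by linarith))
      obtain ⟨r, hr, hru⟩ := mem_closure_iff_nhds.1 hs _ hev
      have := step r hru ε hε U hr.1
        (fun w hw t ht => ⟨((h w hw).2.2 t ht).1, ((h w hw).2.2 t ht).2.2.1⟩)
        (s - r) ⟨by linarith [hr.2.2], by linarith [hr.2.1]⟩
      rwa [add_sub_cancel] at this
  exact (hsub hs).2

/-- The derivative of the flow solves the linearized equation along the flow line. -/
theorem eventually_hasDerivAt_mfderiv (hΦ : IsMaximalFlow v dom Φ) (hv : IsSmoothVectorField v)
    {z : N} {s : ℝ} (hs : s ∈ dom z) (V : TangentSpace J z) :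
    ∀ᶠ r in 𝓝 s, Φ r z ∈ (extChartAt J (Φ s z)).source ∧
      HasDerivAt (fun r => extChartAt J (Φ s z) (Φ r z))
        (chartField v (Φ s z) (extChartAt J (Φ s z) (Φ r z))) r ∧
      HasDerivAt (fun r => toChartEnd J (Φ s z) (Φ r z) (mfderiv J J (Φ r) z V))
        (fderiv ℝ (chartField v (Φ s z)) (extChartAt J (Φ s z) (Φ r z))
          (toChartEnd J (Φ s z) (Φ r z) (mfderiv J J (Φ r) z V))) r := by
  obtain ⟨ε, hε, U, hU, A, h⟩ := hΦ.exists_flowBox hv (Φ s z)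
  obtain ⟨-, -, hw⟩ := h _ (mem_of_mem_nhds hU)
  set w := Φ s z with hwdef
  obtain ⟨hdoms, hdiffs⟩ := hΦ.eventually_mem_dom_and_mdifferentiableAt hv hs
  have key : ∀ r ∈ Ioo (s - ε) (s + ε), r ∈ dom z ∧ Φ r z = Φ (r - s) w ∧
      toChartEnd J w (Φ r z) (mfderiv J J (Φ r) z V)
        = A (extChartAt J w w) (r - s) (toChartEnd J w w (mfderiv J J (Φ s) z V)) := by
    intro r hr
    have ht : r - s ∈ Ioo (-ε) ε := ⟨by linarith [hr.1], by linarith [hr.2]⟩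
    obtain ⟨h1, h2, h3, h4, h5⟩ := hw (r - s) ht
    have hadd := hΦ.add_mem_dom hv hs h1
    rw [add_sub_cancel] at hadd
    refine ⟨hadd.1, hadd.2, ?_⟩
    -- The factorization is needed for all nearby `z'`, not just at `z`, because it is
    -- differentiated in the initial point.
    have hev : ∀ᶠ z' in 𝓝 z, Φ r z' = (Φ (r - s) ∘ Φ s) z' := by
      filter_upwards [hdoms, hdiffs.continuousAt.eventually hU] with z' hz' hzU
      have := (hΦ.add_mem_dom hv hz' ((h _ hzU).2.2 (r - s) ht).1).2
      rwa [add_sub_cancel] at this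
    have hc : HasMFDerivAt J J (Φ r) z ((mfderiv J J (Φ (r - s)) w).comp (mfderiv J J (Φ s) z)) :=
      (HasMFDerivAt.comp z h3.hasMFDerivAt hdiffs.hasMFDerivAt).congr_of_eventuallyEq hev
    rw [← h5, hc.mfderiv, hadd.2]
    rfl
  filter_upwards [Ioo_mem_nhds (show s - ε < s by linarith) (show s < s + ε by linarith)] with r hr
  have ht : r - s ∈ Ioo (-ε) ε := ⟨by linarith [hr.1], by linarith [hr.2]⟩
  obtain ⟨k1, k2, k3⟩ := key r hr
  obtain ⟨h1, h2, h3, h4, h5⟩ := hw (r - s) ht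
  rw [← k2] at h2
  refine ⟨h2, ?_, ?_⟩
  · have := ((hasMFDerivAt_curve_iff h2 _).1 (hΦ.hasMFDerivAt k1)).2
    rwa [← chartField_extChartAt v h2] at this
  · have e : (fun r => toChartEnd J w (Φ r z) (mfderiv J J (Φ r) z V)) =ᶠ[𝓝 r] fun r =>
        A (extChartAt J w w) (r - s) (toChartEnd J w w (mfderiv J J (Φ s) z V)) := by
      filter_upwards [Ioo_mem_nhds hr.1 hr.2] with r' hr' using (key r' hr').2.2
    have hd : HasDerivAt (fun r => A (extChartAt J w w) (r - s)) _ r :=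
      HasDerivAt.comp_sub_const r s h4
    have := (hd.clm_apply (hasDerivAt_const r (toChartEnd J w w (mfderiv J J (Φ s) z V))))
    refine (this.congr_of_eventuallyEq e).congr_deriv ?_
    rw [k3, k2, map_zero, add_zero]
    rfl

end IsMaximalFlow

end Flow

/-! ### The tangent bundle in its natural charts -/

section TangentCharts

variable {E : Type*} [NormedAddCommGroup E] [NormedSpace ℝ E] [FiniteDimensional ℝ E]
  {M : Type*} [TopologicalSpace M] [ChartedSpace E M] [IsManifold 𝓘(ℝ, E) ∞ M]

instance isManifold_TM : IsManifold (modelTM E) ∞ (TM E M) :=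
  -- The tangent bundle loses one order of smoothness, which costs nothing since `∞ + 1 = ∞`.
  have : IsManifold 𝓘(ℝ, E) (∞ + 1) M := ‹IsManifold 𝓘(ℝ, E) ∞ M›
  have := TangentBundle.contMDiffVectorBundle (n := ∞) (I := 𝓘(ℝ, E)) (M := M)
  Bundle.TotalSpace.isManifold E (TangentSpace 𝓘(ℝ, E))

instance boundaryless_modelTM : (modelTM E).Boundaryless :=
  inferInstanceAs ((𝓘(ℝ, E)).prod 𝓘(ℝ, E)).Boundaryless

/-- Vectors over different points are separated through the projection, and vectors over the same
point in the fibre of a trivialization. -/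
instance t2Space_TM [T2Space M] : T2Space (TM E M) := by
  refine ⟨fun z w hzw => ?_⟩
  have hcont : Continuous (Bundle.TotalSpace.proj : TM E M → M) :=
    FiberBundle.continuous_proj E (TangentSpace 𝓘(ℝ, E))
  by_cases h : z.1 = w.1
  · let e := trivializationAt E (TangentSpace 𝓘(ℝ, E) : M → Type _) z.1
    have hz : z ∈ e.source := e.mem_source.2 (FiberBundle.mem_baseSet_trivializationAt' z.1)
    have hw : w ∈ e.source := e.mem_source.2 (by
      rw [← h]; exact FiberBundle.mem_baseSet_trivializationAt' z.1)
    have hne : (e z).2 ≠ (e w).2 := fun h2 => hzw (e.injOn hz hw (Prod.ext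
      ((e.coe_fst hz).trans (h.trans (e.coe_fst hw).symm)) h2))
    obtain ⟨U, V, hU, hV, hzU, hwV, hUV⟩ := t2_separation hne
    have ho : ∀ {U : Set E}, IsOpen U → IsOpen (e.source ∩ e ⁻¹' (Prod.snd ⁻¹' U)) := fun hU =>
      e.continuousOn_toFun.isOpen_inter_preimage e.open_source (hU.preimage continuous_snd)
    exact ⟨_, _, ho hU, ho hV, ⟨hz, hzU⟩, ⟨hw, hwV⟩, disjoint_left.2 fun a ha hb =>
      disjoint_left.1 hUV ha.2 hb.2⟩
  · obtain ⟨U, V, hU, hV, hzU, hwV, hUV⟩ := t2_separation h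
    exact ⟨_, _, hU.preimage hcont, hV.preimage hcont, hzU, hwV, hUV.preimage _⟩

theorem mem_source_TM {z₀ z : TM E M} :
    z ∈ (extChartAt (modelTM E) z₀).source ↔ z.1 ∈ (extChartAt 𝓘(ℝ, E) z₀.1).source := by
  rw [extChartAt_source, extChartAt_source]
  exact TangentBundle.mem_chart_source_iff z z₀

theorem extChartAt_TM {z₀ z : TM E M} (hz : z.1 ∈ (extChartAt 𝓘(ℝ, E) z₀.1).source) :
    extChartAt (modelTM E) z₀ z
      = (extChartAt 𝓘(ℝ, E) z₀.1 z.1, toChartEnd 𝓘(ℝ, E) z₀.1 z.1 z.2) := by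
  rw [extChartAt_source] at hz
  unfold toChartEnd toChart
  rw [← TangentBundle.continuousLinearMapAt_trivializationAt hz,
    TangentBundle.continuousLinearMapAt_trivializationAt_eq_core hz]
  rfl

theorem extChartAt_TM_symm {z₀ : TM E M} {y : E × E}
    (hy : y.1 ∈ (extChartAt 𝓘(ℝ, E) z₀.1).target) :
    y ∈ (extChartAt (modelTM E) z₀).target ∧ (extChartAt (modelTM E) z₀).symm y
      = TM.mk ((extChartAt 𝓘(ℝ, E) z₀.1).symm y.1) (ofChartEnd 𝓘(ℝ, E) z₀.1 y.1 y.2) := by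
  set x := (extChartAt 𝓘(ℝ, E) z₀.1).symm y.1 with hx
  have hxs : x ∈ (extChartAt 𝓘(ℝ, E) z₀.1).source := (extChartAt 𝓘(ℝ, E) z₀.1).map_target hy
  set z : TM E M := TM.mk x (ofChartEnd 𝓘(ℝ, E) z₀.1 y.1 y.2) with hz
  have hzs : z ∈ (extChartAt (modelTM E) z₀).source := mem_source_TM.2 hxs
  have hxy : extChartAt 𝓘(ℝ, E) z₀.1 x = y.1 := (extChartAt 𝓘(ℝ, E) z₀.1).right_inv hy
  have hval : extChartAt (modelTM E) z₀ z = y := by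
    rw [extChartAt_TM hxs]
    refine Prod.ext hxy ?_
    have := toChartEnd_ofChartEnd hxs y.2
    rw [hxy] at this
    exact this
  refine ⟨?_, ?_⟩
  · rw [← hval]; exact (extChartAt (modelTM E) z₀).map_source hzs
  · conv_lhs => rw [← hval]
    exact (extChartAt (modelTM E) z₀).left_inv hzs

theorem target_TM (z₀ : TM E M) :
    (extChartAt (modelTM E) z₀).target = (extChartAt 𝓘(ℝ, E) z₀.1).target ×ˢ (univ : Set E) := by
  refine Subset.antisymm (fun y hy => ⟨?_, mem_univ _⟩) fun y hy => (extChartAt_TM_symm hy.1).1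
  have hs := mem_source_TM.1 ((extChartAt (modelTM E) z₀).map_target hy)
  have h := extChartAt_TM hs
  rw [(extChartAt (modelTM E) z₀).right_inv hy] at h
  rw [h]
  exact (extChartAt 𝓘(ℝ, E) z₀.1).map_source hs

theorem extChartAt_TM_self (z : TM E M) :
    extChartAt (modelTM E) z z = (extChartAt 𝓘(ℝ, E) z.1 z.1, z.2) := by
  rw [extChartAt_TM (mem_extChartAt_source z.1), toChartEnd_self]
  rfl

/-- A tangent vector of `TM` as an element of `E × E`. -/
theorem toChartEnd_TM {z₀ z : TM E M} (hz : z.1 ∈ (extChartAt 𝓘(ℝ, E) z₀.1).source)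
    (A : E × E) :
    toChartEnd (modelTM E) z₀ z A = (toChartEnd 𝓘(ℝ, E) z₀.1 z.1 A.1,
      fderiv ℝ (fderiv ℝ (transition 𝓘(ℝ, E) z.1 z₀.1)) (extChartAt 𝓘(ℝ, E) z.1 z.1) A.1 z.2
        + toChartEnd 𝓘(ℝ, E) z₀.1 z.1 A.2) := by
  have hself := mem_extChartAt_source (I := 𝓘(ℝ, E)) z.1
  have hτ := contDiffAt_transition (J := 𝓘(ℝ, E)) hself hz
  rw [toChartEnd_eq (mem_source_TM.2 hz), toChartEnd_eq hz, extChartAt_TM_self]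
  set τ := transition 𝓘(ℝ, E) z.1 z₀.1
  set y := extChartAt 𝓘(ℝ, E) z.1 z.1 with hy
  let p : E := z.2
  change fderiv ℝ _ ((y, p) : E × E) A = (fderiv ℝ τ y A.1, fderiv ℝ (fderiv ℝ τ) y A.1 p + _)
  have hτ1 : DifferentiableAt ℝ τ y := hτ.differentiableAt (by norm_num)
  have hτ2 : DifferentiableAt ℝ (fderiv ℝ τ) y :=
    (hτ.fderiv_right (m := 1) one_add_one_le_infty).differentiableAt (by norm_num)
  -- Natural charts change by `(w, q) ↦ (τ w, Dτ_w q)`; differentiating this map produces the `D²τ`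
  -- term.
  have e : transition (modelTM E) z z₀ =ᶠ[𝓝 (y, p)]
      fun w => (τ w.1, fderiv ℝ τ w.1 w.2) := by
    have hev : ∀ᶠ w : E × E in 𝓝 (y, p), w.1 ∈ (extChartAt 𝓘(ℝ, E) z.1).target ∧
        (extChartAt 𝓘(ℝ, E) z.1).symm w.1 ∈ (extChartAt 𝓘(ℝ, E) z₀.1).source :=
      (continuousAt_fst (p := (y, p))).eventually (eventually_mem_source_of_mem hself hz)
    filter_upwards [hev] with w hw
    rw [transition, (extChartAt_TM_symm hw.1).2, extChartAt_TM hw.2]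
    refine Prod.ext rfl ?_
    have h1 := fderiv_transition_comp_toChartEnd
      ((extChartAt 𝓘(ℝ, E) z.1).map_target hw.1) hw.2
    have h2 := toChartEnd_ofChartEnd ((extChartAt 𝓘(ℝ, E) z.1).map_target hw.1) w.2
    rw [(extChartAt 𝓘(ℝ, E) z.1).right_inv hw.1] at h1 h2
    have h3 := DFunLike.congr_fun h1 (ofChartEnd 𝓘(ℝ, E) z.1 w.1 w.2)
    rw [ContinuousLinearMap.comp_apply, h2] at h3
    exact h3.symm
  have hd : HasFDerivAt (fun w : E × E => (τ w.1, fderiv ℝ τ w.1 w.2)) _ (y, p) :=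
    (HasFDerivAt.comp (f := Prod.fst) (y, p) hτ1.hasFDerivAt hasFDerivAt_fst).prodMk
      ((HasFDerivAt.comp (f := Prod.fst) (y, p) hτ2.hasFDerivAt hasFDerivAt_fst).clm_apply hasFDerivAt_snd)
  rw [e.fderiv_eq, hd.fderiv]
  refine Prod.ext rfl ?_
  simp [add_comm]

end TangentCharts

/-! ### The Sasaki metric in charts -/

section GeneralMetric

variable {F : Type*} [NormedAddCommGroup F] [NormedSpace ℝ F]
  {K : Type*} [TopologicalSpace K] {J : ModelWithCorners ℝ F K}
  {N : Type*} [TopologicalSpace N] [ChartedSpace K N]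

theorem IsPseudoRiemannian.isLocalMetric_gram [J.Boundaryless] [IsManifold J ∞ N]
    {h : BilinField J N} (hh : IsPseudoRiemannian h)
    (x₀ : N) : IsLocalMetric (gram h x₀) (extChartAt J x₀).target :=
  ⟨isOpen_extChartAt_target x₀, hh.smooth x₀, hh.gram_symm x₀,
    fun _ hy _ hu => hh.gram_nondegenerate hy hu⟩

theorem leviCivita_eq_christoffel (h : BilinField J N) (x₀ : N) (y u v : F) :
    leviCivita h x₀ y u v = christoffel (gram h x₀) y u v := rfl

theorem christoffel_congr {g₁ g₂ : F → F →L[ℝ] F →L[ℝ] ℝ} {y : F} (h : g₁ =ᶠ[𝓝 y] g₂) :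
    christoffel g₁ y = christoffel g₂ y := by
  rw [christoffel, christoffel, h.fderiv_eq, h.self_of_nhds]

end GeneralMetric

section SasakiCharts

variable {E : Type*} [NormedAddCommGroup E] [NormedSpace ℝ E] [FiniteDimensional ℝ E]
  {M : Type*} [TopologicalSpace M] [ChartedSpace E M] [IsManifold 𝓘(ℝ, E) ∞ M]
  {g : BilinField 𝓘(ℝ, E) M}

theorem fst_toChartEnd_TM {z₀ z : TM E M} (hz : z.1 ∈ (extChartAt 𝓘(ℝ, E) z₀.1).source)
    (A : TangentSpace (modelTM E) z) :
    (toChartEnd (modelTM E) z₀ z A).1 = toChartEnd 𝓘(ℝ, E) z₀.1 z.1 (horPart z A) := by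
  have := toChartEnd_TM hz A
  rw [this]
  rfl

/-- The `D²τ` term in the chart change of `TM` is exactly the inhomogeneous term in the
transformation law of the Christoffel symbols. The vertical part is therefore independent of the
chart, and so is the form of the Sasaki metric. -/
theorem localVer_toChartEnd (hg : IsPseudoRiemannian g) {z₀ z : TM E M}
    (hz : z.1 ∈ (extChartAt 𝓘(ℝ, E) z₀.1).source) (A : TangentSpace (modelTM E) z) :
    localVer (christoffel (gram g z₀.1)) (extChartAt (modelTM E) z₀ z)
        (toChartEnd (modelTM E) z₀ z A)
      = toChartEnd 𝓘(ℝ, E) z₀.1 z.1 (verPart g z A) := by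
  have h1 := hg.isConnection_leviCivita z.1 z₀.1 z.1 (mem_extChartAt_source z.1) hz
    (horPart z A) z.2
  have h2 : (verPart g z A : E) = (A : E × E).2
      + leviCivita g z.1 (extChartAt 𝓘(ℝ, E) z.1 z.1) (horPart z A) z.2 := rfl
  have h3 : toChartEnd (modelTM E) z₀ z A = (toChartEnd 𝓘(ℝ, E) z₀.1 z.1 (horPart z A),
      fderiv ℝ (fderiv ℝ (transition 𝓘(ℝ, E) z.1 z₀.1)) (extChartAt 𝓘(ℝ, E) z.1 z.1)
        (horPart z A) z.2 + toChartEnd 𝓘(ℝ, E) z₀.1 z.1 (A : E × E).2) := toChartEnd_TM hz A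
  rw [localVer_apply, extChartAt_TM hz, h3]
  erw [h2]
  rw [map_add]
  rw [toChartEnd_eq hz]
  rw [← h1, leviCivita_eq_christoffel]
  have key : ∀ a b c : E, a + b + c = b + (c + a) := fun a b c => by abel
  exact key _ _ _

theorem gram_sasaki (hg : IsPseudoRiemannian g) (z₀ : TM E M) {y : E × E}
    (hy : y.1 ∈ (extChartAt 𝓘(ℝ, E) z₀.1).target) :
    gram (sasaki g) z₀ y = localSasaki (gram g z₀.1) y := by
  have hy' := (extChartAt_TM_symm hy).1
  have hz := mem_source_TM.1 ((extChartAt (modelTM E) z₀).map_target hy')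
  set z := (extChartAt (modelTM E) z₀).symm y with hzdef
  have hzy : extChartAt (modelTM E) z₀ z = y := (extChartAt (modelTM E) z₀).right_inv hy'
  have hzs := mem_source_TM.2 hz
  have h1 : extChartAt 𝓘(ℝ, E) z₀.1 z.1 = y.1 := by rw [← hzy, extChartAt_TM hz]
  have hsurj : ∀ A : E × E, ∃ A' : E × E, A = toChartEnd (modelTM E) z₀ z A' :=
    fun A => ⟨_, (toChartEnd_ofChartEnd hzs A).symm⟩
  refine ContinuousLinearMap.ext fun A => ContinuousLinearMap.ext fun B => ?_
  obtain ⟨A, rfl⟩ := hsurj A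
  obtain ⟨B, rfl⟩ := hsurj B
  have hh : ∀ A : E × E, (toChartEnd (modelTM E) z₀ z A).1
      = toChartEnd 𝓘(ℝ, E) z₀.1 z.1 (horPart z A) := fst_toChartEnd_TM hz
  have hv : ∀ A : E × E, localVer (christoffel (gram g z₀.1)) y (toChartEnd (modelTM E) z₀ z A)
      = toChartEnd 𝓘(ℝ, E) z₀.1 z.1 (verPart g z A) := by
    rw [← hzy]
    exact localVer_toChartEnd hg hz
  have h2 := gram_extChartAt (sasaki g) hzs A B
  have h3 := gram_extChartAt g hz (horPart z A) (horPart z B)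
  have h4 := gram_extChartAt g hz (verPart g z A) (verPart g z B)
  rw [hzy] at h2
  rw [h1] at h3 h4
  rw [h2, localSasaki_apply, hv, hv, hh, hh, h3, h4]
  rfl

theorem IsPseudoRiemannian.isLocalMetric_localSasaki (hg : IsPseudoRiemannian g) (z₀ : TM E M) :
    IsLocalMetric (localSasaki (gram g z₀.1)) (extChartAt (modelTM E) z₀).target := by
  rw [target_TM]
  exact (hg.isLocalMetric_gram z₀.1).localSasaki

theorem mem_target_TM {z₀ : TM E M} {y : E × E} :
    y ∈ (extChartAt (modelTM E) z₀).target ↔ y.1 ∈ (extChartAt 𝓘(ℝ, E) z₀.1).target := by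
  rw [target_TM]
  simp

/-- The timelike direction of `g` occurs in both the horizontal and the vertical summand, so the
Sasaki metric is not Lorentzian; nondegeneracy is all that its Levi-Civita connection needs. -/
theorem IsPseudoRiemannian.sasaki (hg : IsPseudoRiemannian g) :
    IsPseudoRiemannian (sasaki g) where
  smooth z₀ := (hg.isLocalMetric_localSasaki z₀).smooth.congr fun _ hy =>
    gram_sasaki hg z₀ (mem_target_TM.1 hy)
  symm z A B := by
    rw [sasaki_apply, sasaki_apply, hg.symm _ (horPart z A), hg.symm _ (verPart g z A)]
  nondegenerate z A hA := by
    have h1 : horPart z A = 0 := hg.nondegenerate z.1 _ fun v => by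
      have := hA (Hor g z v)
      rwa [sasaki_apply, horPart_Hor, verPart_Hor, map_zero, add_zero] at this
    have h2 : verPart g z A = 0 := hg.nondegenerate z.1 _ fun v => by
      have := hA (Ver z v)
      rwa [sasaki_apply, horPart_Ver, verPart_Ver, map_zero, zero_add] at this
    rw [← Hor_add_Ver g z A, h1, h2]
    refine Prod.ext (add_zero _) ?_
    change -(christoffelAt g z 0) + (0 : E) = 0
    rw [map_zero, neg_zero, add_zero]

theorem christoffel_gram_sasaki (hg : IsPseudoRiemannian g) (z₀ : TM E M) {y : E × E}
    (hy : y ∈ (extChartAt (modelTM E) z₀).target) :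
    christoffel (gram (Sasaki.sasaki g) z₀) y = christoffel (localSasaki (gram g z₀.1)) y := by
  refine christoffel_congr ?_
  filter_upwards [(isOpen_extChartAt_target z₀).mem_nhds hy] with y' hy'
  exact gram_sasaki hg z₀ (mem_target_TM.1 hy')

/-- The horizontal lift in a chart. -/
theorem toChartEnd_Hor (hg : IsPseudoRiemannian g) {z₀ z : TM E M}
    (hz : z.1 ∈ (extChartAt 𝓘(ℝ, E) z₀.1).source) (v : TangentSpace 𝓘(ℝ, E) z.1) :
    toChartEnd (modelTM E) z₀ z (Hor g z v) = (toChartEnd 𝓘(ℝ, E) z₀.1 z.1 v,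
      - christoffel (gram g z₀.1) (extChartAt 𝓘(ℝ, E) z₀.1 z.1) (toChartEnd 𝓘(ℝ, E) z₀.1 z.1 v)
        (toChartEnd 𝓘(ℝ, E) z₀.1 z.1 z.2)) := by
  have h1 := fst_toChartEnd_TM hz (Hor g z v)
  have h2 := localVer_toChartEnd hg hz (Hor g z v)
  rw [horPart_Hor] at h1
  rw [verPart_Hor, localVer_apply, h1, extChartAt_TM hz] at h2
  erw [map_zero] at h2
  exact Prod.ext h1 (eq_neg_of_add_eq_zero_left h2)

theorem toChartEnd_Ver (hg : IsPseudoRiemannian g) {z₀ z : TM E M}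
    (hz : z.1 ∈ (extChartAt 𝓘(ℝ, E) z₀.1).source) (v : TangentSpace 𝓘(ℝ, E) z.1) :
    toChartEnd (modelTM E) z₀ z (Ver z v) = (0, toChartEnd 𝓘(ℝ, E) z₀.1 z.1 v) := by
  have h1 := fst_toChartEnd_TM hz (Ver z v)
  have h2 := localVer_toChartEnd hg hz (Ver z v)
  rw [horPart_Ver] at h1
  erw [map_zero] at h1
  rw [verPart_Ver, localVer_apply, h1, map_zero, zero_apply, add_zero] at h2
  exact Prod.ext h1 h2

variable (g) in
/-- The geodesic spray. -/
def spray (z : TM E M) : TangentSpace (modelTM E) z := Hor g z z.2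

theorem chartField_spray (hg : IsPseudoRiemannian g) (z₀ : TM E M) {y : E × E}
    (hy : y ∈ (extChartAt (modelTM E) z₀).target) :
    chartField (spray g) z₀ y = localSpray (gram g z₀.1) y := by
  have hz := mem_source_TM.1 ((extChartAt (modelTM E) z₀).map_target hy)
  unfold chartField
  set z := (extChartAt (modelTM E) z₀).symm y with hzdef
  have hzy : extChartAt (modelTM E) z₀ z = y := (extChartAt (modelTM E) z₀).right_inv hy
  rw [spray, toChartEnd_Hor hg hz, ← hzy, extChartAt_TM hz]
  rfl

theorem isSmoothVectorField_spray (hg : IsPseudoRiemannian g) :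
    IsSmoothVectorField (spray g) := fun z₀ =>
  ContDiffOn.congr (fun _ hy => ((hg.isLocalMetric_gram z₀.1).contDiffAt_localSpray
    (mem_target_TM.1 hy)).contDiffWithinAt) fun _ hy => chartField_spray hg z₀ hy

end SasakiCharts

/-! ### Geodesics are the integral curves of the spray -/

section Geodesics

section General

variable {F : Type*} [NormedAddCommGroup F] [NormedSpace ℝ F]
  {K : Type*} [TopologicalSpace K] {J : ModelWithCorners ℝ F K}
  {N : Type*} [TopologicalSpace N] [ChartedSpace K N]

theorem hasMFDerivAt_velocity {c : ℝ → N} {t : ℝ} (h : MDifferentiableAt 𝓘(ℝ, ℝ) J c t) :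
    HasMFDerivAt 𝓘(ℝ, ℝ) J c t ((1 : ℝ →L[ℝ] ℝ).smulRight (velocity J c t)) := by
  refine h.hasMFDerivAt.congr_mfderiv (ContinuousLinearMap.ext_ring ?_)
  exact (one_smul ℝ (velocity J c t : F)).symm

theorem contMDiffAt_velocity [J.Boundaryless] [IsManifold J ∞ N] {c : ℝ → N} {t : ℝ}
    (h : ContMDiffAt 𝓘(ℝ, ℝ) J ∞ c t) :
    ContMDiffAt 𝓘(ℝ, ℝ) J.tangent ∞
      (fun r => (⟨c r, velocity J c r⟩ : TangentBundle J N)) t := by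
  have : IsManifold J 1 N := IsManifold.of_le (n := ∞) (by norm_num)
  refine contMDiffAt_tangentBundle_iff.2 ⟨h, ?_⟩
  have hx := mem_extChartAt_source (I := J) (c t)
  have h1 := (contMDiffAt_curve_iff hx h.continuousAt).1 h
  have hev : ∀ᶠ r in 𝓝 t, ContMDiffAt 𝓘(ℝ, ℝ) J 1 c r :=
    (contMDiffAt_iff_contMDiffAt_nhds (by simp)).1 (h.of_le (by norm_num))
  have e : (fun r => toChartEnd J (c t) (c r) (velocity J c r)) =ᶠ[𝓝 t]
      deriv fun r => extChartAt J (c t) (c r) := by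
    filter_upwards [hev, h.continuousAt.eventually (extChartAt_source_mem_nhds (I := J) (c t))]
      with r hr hr2
    exact (toChartEnd_velocity hr2 (hr.mdifferentiableAt one_ne_zero)).deriv.symm
  have h2 : ContDiffAt ℝ ∞ (deriv fun r => extChartAt J (c t) (c r)) t :=
    ((h1.fderiv_right (m := ∞) (by simp)).clm_apply contDiffAt_const)
  exact h2.congr_of_eventuallyEq e

theorem contMDiffAt_of_isMIntegralCurveOn [J.Boundaryless] [IsManifold J ∞ N] [CompleteSpace F]
    {v : ∀ x : N, TangentSpace J x} (hv : IsSmoothVectorField v) {c : ℝ → N} {S : Set ℝ}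
    (hS : IsOpen S) (hc : ∀ t ∈ S, HasMFDerivAt 𝓘(ℝ, ℝ) J c t ((1 : ℝ →L[ℝ] ℝ).smulRight (v (c t))))
    {t : ℝ} (ht : t ∈ S) : ContMDiffAt 𝓘(ℝ, ℝ) J ∞ c t := by
  have hct := (hc t ht).continuousAt
  have hx := mem_extChartAt_source (I := J) (c t)
  refine (contMDiffAt_curve_iff hx hct).2 ?_
  refine contDiffAt_of_eventually_hasDerivAt (isOpen_extChartAt_target (c t)) (hv (c t))
    (mem_extChartAt_target (c t)) ?_
  filter_upwards [hS.mem_nhds ht, hct.eventually (extChartAt_source_mem_nhds (I := J) (c t))]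
    with r hr hr2
  have := ((hasMFDerivAt_curve_iff hr2 _).1 (hc r hr)).2
  rwa [← chartField_extChartAt v hr2] at this

end General

variable {E : Type*} [NormedAddCommGroup E] [NormedSpace ℝ E] [FiniteDimensional ℝ E]
  {M : Type*} [TopologicalSpace M] [ChartedSpace E M] [IsManifold 𝓘(ℝ, E) ∞ M]
  {g : BilinField 𝓘(ℝ, E) M}

theorem verPart_Hor_add_Ver (z : TM E M) (v w : TangentSpace 𝓘(ℝ, E) z.1) :
    verPart g z (Hor g z v + Ver z w) = w := by
  refine (map_add (verPart g z) _ _).trans ?_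
  rw [verPart_Hor, verPart_Ver, zero_add]

/-- The velocity of `(γ, γ')` is `Hor(γ') + Ver(Dγ'/dt)`, and the geodesic equation removes the
second summand. -/
theorem isMIntegralCurveOn_tangentLift {γ : ℝ → M} {a b : ℝ}
    (hγ : IsGeodesicOn (baseD g) γ (Ioo a b)) :
    IsMIntegralCurveOn (tangentLift γ) (spray g) (Ioo a b) := by
  intro t ht
  have hs : ContMDiffAt 𝓘(ℝ, ℝ) 𝓘(ℝ, E) ∞ γ t := hγ.1.contMDiffAt (Ioo_mem_nhds ht.1 ht.2)
  have hd : MDifferentiableAt 𝓘(ℝ, ℝ) (modelTM E) (tangentLift γ) t :=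
    (contMDiffAt_velocity hs).mdifferentiableAt (by norm_num)
  have h1 := velocity_TM g γ (velocity 𝓘(ℝ, E) γ) t hd
  have h2 := hasMFDerivAt_velocity hd
  have h3 : velocity (modelTM E) (tangentLift γ) t = spray g (tangentLift γ t) := by
    refine h1.trans ?_
    rw [hγ.2 t ht]
    exact add_zero _
  rw [h3] at h2
  exact h2.hasMFDerivWithinAt

/-- The base component of the spray at `(x, p)` is `p`, so the fibre component of an integral curve
is the velocity of its projection. The vertical part of the spray is zero, which is the geodesic
equation. -/
theorem isGeodesicOn_of_isMIntegralCurveOn (hg : IsPseudoRiemannian g) {c : ℝ → TM E M} {a b : ℝ}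
    (hc : IsMIntegralCurveOn c (spray g) (Ioo a b)) :
    IsGeodesicOn (baseD g) (fun t => (c t).1) (Ioo a b) ∧
      EqOn (tangentLift fun t => (c t).1) c (Ioo a b) := by
  have hc' : ∀ t ∈ Ioo a b, HasMFDerivAt 𝓘(ℝ, ℝ) (modelTM E) c t
      ((1 : ℝ →L[ℝ] ℝ).smulRight (spray g (c t))) := fun t ht =>
    (hc t ht).hasMFDerivAt (Ioo_mem_nhds ht.1 ht.2)
  have hsm : ∀ t ∈ Ioo a b, ContMDiffAt 𝓘(ℝ, ℝ) 𝓘(ℝ, E) ∞ (fun t => (c t).1) t := fun t ht =>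
    (contMDiffAt_tangentBundle_iff (c := fun t => (c t).1) (W := fun t => (c t).2)).1
      (contMDiffAt_of_isMIntegralCurveOn (isSmoothVectorField_spray hg) isOpen_Ioo hc' ht) |>.1
  have hvel : ∀ t ∈ Ioo a b, velocity 𝓘(ℝ, E) (fun t => (c t).1) t = (c t).2 := by
    intro t ht
    refine velocity_eq_of_hasMFDerivAt ?_
    have hx := mem_extChartAt_source (I := 𝓘(ℝ, E)) (c t).1
    refine (hasMFDerivAt_curve_iff hx _).2 ⟨(hsm t ht).continuousAt, ?_⟩
    have h1 := ((hasMFDerivAt_curve_iff (mem_extChartAt_source (c t)) _).1 (hc' t ht)).2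
    have h2 : HasDerivAt (fun r => (extChartAt (modelTM E) (c t) (c r)).1)
        (toChartEnd (modelTM E) (c t) (c t) (spray g (c t))).1 t := h1.fst
    rw [fst_toChartEnd_TM hx] at h2
    refine h2.congr_of_eventuallyEq ?_
    filter_upwards [(hsm t ht).continuousAt.eventually (extChartAt_source_mem_nhds (I := 𝓘(ℝ, E)) (c t).1)] with r hr
    rw [extChartAt_TM hr]
  have heq : EqOn (tangentLift fun t => (c t).1) c (Ioo a b) := fun t ht => by
    rw [tangentLift, hvel t ht]
  refine ⟨⟨fun t ht => (hsm t ht).contMDiffWithinAt, fun t ht => ?_⟩, heq⟩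
  have e : (tangentLift fun t => (c t).1) =ᶠ[𝓝 t] c := by
    filter_upwards [Ioo_mem_nhds ht.1 ht.2] with r hr using heq hr
  have h1 : HasMFDerivAt 𝓘(ℝ, ℝ) (modelTM E) (tangentLift fun t => (c t).1) t
      ((1 : ℝ →L[ℝ] ℝ).smulRight (spray g (tangentLift (fun t => (c t).1) t))) := by
    have := hc' t ht
    rw [← heq ht] at this
    exact this.congr_of_eventuallyEq e
  have h2 := velocity_TM g (fun t => (c t).1) (velocity 𝓘(ℝ, E) fun t => (c t).1) t
    h1.mdifferentiableAt
  have h3 := (velocity_eq_of_hasMFDerivAt h1).symm.trans h2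
  exact ((verPart_Hor_add_Ver _ _ _).symm.trans (congrArg (verPart g _) h3.symm)).trans
    (verPart_Hor g _ _)

/-- The geodesic flow is the maximal flow of the spray. -/
theorem isMaximalFlow_geodesicFlow [T2Space M] (hg : IsPseudoRiemannian g) :
    IsMaximalFlow (spray g) (geodesicDomain g) (geodesicFlow g) where
  exists_of_mem := by
    rintro z s ⟨γ, a, b, ⟨h0, hγ, hz⟩, hs⟩
    exact ⟨tangentLift γ, a, b, h0, isMIntegralCurveOn_tangentLift hγ, hz, hs⟩
  mem_and_eq := by
    intro z c a b h0 hc hz s hs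
    obtain ⟨hγ, heq⟩ := isGeodesicOn_of_isMIntegralCurveOn hg hc
    have hmem : s ∈ geodesicDomain g z := ⟨_, a, b, ⟨h0, hγ, (heq h0).trans hz⟩, hs⟩
    refine ⟨hmem, ?_⟩
    rw [geodesicFlow, dif_pos hmem]
    obtain ⟨a', b', ⟨h0', hγ', hz'⟩, hs'⟩ := hmem.choose_spec
    have : IsManifold (modelTM E) 1 (TM E M) := IsManifold.of_le (n := ∞) (by norm_num)
    -- `geodesicFlow` chooses some geodesic reaching time `s`; uniqueness on the intersection of the
    -- two intervals makes the choice irrelevant.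
    have hu := isMIntegralCurveOn_Ioo_eqOn_of_contMDiff_boundaryless (t₀ := 0)
      (a := max a a') (b := min b b') (I := modelTM E) (v := spray g)
      (γ := tangentLift hmem.choose) (γ' := c)
      ⟨max_lt h0.1 h0'.1, lt_min h0.2 h0'.2⟩
      ((isSmoothVectorField_spray hg).contMDiff.of_le (by norm_num))
      ((isMIntegralCurveOn_tangentLift hγ').mono (Ioo_subset_Ioo (le_max_right _ _) (min_le_right _ _)))
      (hc.mono (Ioo_subset_Ioo (le_max_left _ _) (min_le_left _ _)))
      (hz'.trans hz.symm)
    exact hu ⟨max_lt hs.1 hs'.1, lt_min hs.2 hs'.2⟩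

end Geodesics

/-! ### Jacobi fields from the linearized flow -/

section Jacobi

variable {F : Type*} [NormedAddCommGroup F] [NormedSpace ℝ F]

theorem hasDerivAt_comp_clm_apply {X Y : Type*} [NormedAddCommGroup X] [NormedSpace ℝ X]
    [NormedAddCommGroup Y] [NormedSpace ℝ Y] {L : F → X →L[ℝ] Y} {y : ℝ → F} {w : ℝ → X} {t : ℝ}
    {y' : F} {w' : X} (hL : DifferentiableAt ℝ L (y t)) (hy : HasDerivAt y y' t)
    (hw : HasDerivAt w w' t) :
    HasDerivAt (fun r => L (y r) (w r)) (fderiv ℝ L (y t) y' (w t) + L (y t) w') t :=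
  (hL.hasFDerivAt.comp_hasDerivAt t hy).clm_apply hw

theorem hasDerivAt_fderiv_apply_of_linearized {G : F → F} {y w : ℝ → F} {t : ℝ}
    (hG : ContDiffAt ℝ ∞ G (y t)) (hy : HasDerivAt y (G (y t)) t)
    (hw : HasDerivAt w (fderiv ℝ G (y t) (w t)) t) :
    HasDerivAt (fun r => fderiv ℝ G (y r) (w r))
      (fderiv ℝ (fderiv ℝ G) (y t) (G (y t)) (w t) + fderiv ℝ G (y t) (fderiv ℝ G (y t) (w t)))
      t :=
  hasDerivAt_comp_clm_apply ((hG.fderiv_right (m := 1) one_add_one_le_infty).differentiableAt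
    one_ne_zero) hy hw

/-- If the integral curves of `G` are geodesics, a solution of the linearized equation is a Jacobi
field. -/
theorem exists_hasDerivAt_jacobi {G : F → F} {Γ : F → F →L[ℝ] F →L[ℝ] F} {y w : ℝ → F} {t : ℝ}
    (hG : ContDiffAt ℝ ∞ G (y t)) (hΓ : DifferentiableAt ℝ Γ (y t))
    (hsymm : ∀ᶠ x in 𝓝 (y t), ∀ u v, Γ x u v = Γ x v u)
    (hgeo : ∀ᶠ x in 𝓝 (y t), fderiv ℝ G x (G x) + Γ x (G x) (G x) = 0)
    (hy : HasDerivAt y (G (y t)) t) (hw : HasDerivAt w (fderiv ℝ G (y t) (w t)) t) :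
    ∃ a', HasDerivAt (fun r => fderiv ℝ G (y r) (w r) + Γ (y r) (G (y r)) (w r)) a' t ∧
      a' + Γ (y t) (G (y t)) (fderiv ℝ G (y t) (w t) + Γ (y t) (G (y t)) (w t))
        = curv Γ (y t) (G (y t)) (w t) (G (y t)) := by
  have hGd : HasFDerivAt G (fderiv ℝ G (y t)) (y t) :=
    (hG.differentiableAt (by norm_num)).hasFDerivAt
  have hG2 : HasFDerivAt (fderiv ℝ G) (fderiv ℝ (fderiv ℝ G) (y t)) (y t) :=
    ((hG.fderiv_right (m := 1) one_add_one_le_infty).differentiableAt one_ne_zero).hasFDerivAt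
  have hGs : fderiv ℝ (fderiv ℝ G) (y t) (G (y t)) (w t)
      = fderiv ℝ (fderiv ℝ G) (y t) (w t) (G (y t)) :=
    (hG.of_le two_le_infty).isSymmSndFDerivAt (by simp) _ _
  have hGy : HasDerivAt (fun r => G (y r)) (fderiv ℝ G (y t) (G (y t))) t :=
    hGd.comp_hasDerivAt t hy
  have h1 := hasDerivAt_fderiv_apply_of_linearized hG hy hw
  have h2 := ((hΓ.hasFDerivAt.comp_hasDerivAt t hy).clm_apply hGy).clm_apply hw
  refine ⟨_, h1.add h2, ?_⟩
  -- `∇_G G = 0` holds on an open set and is differentiated in the direction `w`. Up to the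
  -- symmetries of `Γ` and `D²G`, the result is the Jacobi equation.
  have h3 : HasFDerivAt (fun x => fderiv ℝ G x (G x) + Γ x (G x) (G x)) _ (y t) :=
    (hG2.clm_apply hGd).add ((hΓ.hasFDerivAt.clm_apply hGd).clm_apply hGd)
  have h4 := DFunLike.congr_fun (h3.unique ((hasFDerivAt_const (0 : F) (y t)).congr_of_eventuallyEq
    hgeo)) (w t)
  have hΓs : ∀ a u v, fderiv ℝ Γ (y t) a u v = fderiv ℝ Γ (y t) a v u := by
    intro a u v
    have key : ∀ u v, HasFDerivAt (fun x => Γ x u v) (((fderiv ℝ Γ (y t)).flip u).flip v) (y t) :=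
      fun u v => ((hΓ.hasFDerivAt.clm_apply (hasFDerivAt_const u _)).clm_apply
        (hasFDerivAt_const v _)).congr_fderiv (by ext; simp)
    exact DFunLike.congr_fun ((key u v).unique ((key v u).congr_of_eventuallyEq
      (hsymm.mono fun x hx => hx u v))) a
  have hs := hsymm.self_of_nhds
  have hgeo' := hgeo.self_of_nhds
  have h5 : Γ (y t) (G (y t)) (G (y t)) = - fderiv ℝ G (y t) (G (y t)) :=
    eq_neg_of_add_eq_zero_right hgeo'
  simp only [add_apply, ContinuousLinearMap.comp_apply, ContinuousLinearMap.flip_apply,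
    zero_apply] at h4
  simp only [curv, h5, map_neg, map_add, add_apply, Function.comp]
  rw [hs (w t), hΓs (G (y t)) (w t), hs (w t) (fderiv ℝ G (y t) (G (y t))), hGs]
  rw [hs (fderiv ℝ G (y t) (w t))] at h4
  rw [← sub_eq_zero, ← h4]
  abel

/-! ### Curvature and covariant derivatives in a fixed chart -/

variable {K : Type*} [TopologicalSpace K] {J : ModelWithCorners ℝ F K}
  {N : Type*} [TopologicalSpace N] [ChartedSpace K N]

theorem fderiv_bilin_const_apply {Γ : F → F →L[ℝ] F →L[ℝ] F} {y : F} (hΓ : DifferentiableAt ℝ Γ y)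
    (u v a : F) : fderiv ℝ (fun x => Γ x u v) y a = fderiv ℝ Γ y a u v := by
  rw [((hΓ.hasFDerivAt.clm_apply (hasFDerivAt_const u y)).clm_apply (hasFDerivAt_const v y)).fderiv]
  simp

theorem curvatureChart_eq_curv {C : ConnCoeff F N} {Γ : F → F →L[ℝ] F →L[ℝ] F} {x₀ : N} {y : F}
    (hΓ : DifferentiableAt ℝ Γ y) (hC : ∀ᶠ x in 𝓝 y, ∀ u v, C x₀ x u v = Γ x u v) (u v w : F) :
    curvatureChart C x₀ y u v w = curv Γ y u v w := by
  have h : ∀ u v, (fun x => C x₀ x u v) =ᶠ[𝓝 y] fun x => Γ x u v := fun u v =>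
    hC.mono fun x hx => hx u v
  rw [curvatureChart, (h v w).fderiv_eq, (h u w).fderiv_eq, fderiv_bilin_const_apply hΓ,
    fderiv_bilin_const_apply hΓ]
  simp only [hC.self_of_nhds, curv]

variable [J.Boundaryless] [IsManifold J ∞ N]

theorem curvature_eq_curv {C : ConnCoeff F N} {Γ : F → F →L[ℝ] F →L[ℝ] F} {x : N}
    (hΓ : DifferentiableAt ℝ Γ (extChartAt J x x))
    (hC : ∀ᶠ y in 𝓝 (extChartAt J x x), ∀ u v, C x y u v = Γ y u v) (u v w : TangentSpace J x) :
    (curvature C x u v w : F) = curv Γ (extChartAt J x x) u v w := by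
  have hid : ∀ u : TangentSpace J x, (toChart J x x u : F) = u := fun u =>
    DFunLike.congr_fun (toChartEnd_self (J := J) x) u
  unfold curvature
  refine (inverse_toChart_self x _).trans ?_
  rw [hid, hid, hid]
  exact curvatureChart_eq_curv hΓ hC u v w

/-- `D` is given by `Γ` in the chart at `x₀`, for the field `W` along `c` at time `t`. -/
def IsLocallyGiven (D : AlongOp J N) (Γ : F → F →L[ℝ] F →L[ℝ] F) (c : ℝ → N)
    (W : ∀ t, TangentSpace J (c t)) (x₀ : N) (t : ℝ) : Prop :=
  toChartEnd J x₀ (c t) (D c W t) = deriv (fun r => toChartEnd J x₀ (c r) (W r)) t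
    + Γ (extChartAt J x₀ (c t)) (deriv (fun r => extChartAt J x₀ (c r)) t)
      (toChartEnd J x₀ (c t) (W t))

/-! ### Variation fields of a maximal flow -/

namespace IsMaximalFlow

variable [T2Space N] [CompleteSpace F]
variable {v : ∀ x : N, TangentSpace J x} {dom : N → Set ℝ} {Φ : ℝ → N → N}

theorem contMDiffAt (hΦ : IsMaximalFlow v dom Φ) (hv : IsSmoothVectorField v) {z : N} {s : ℝ}
    (hs : s ∈ dom z) : ContMDiffAt 𝓘(ℝ, ℝ) J ∞ (fun r => Φ r z) s :=
  contMDiffAt_of_isMIntegralCurveOn hv (hΦ.isOpen_dom z) (fun _ ht => hΦ.hasMFDerivAt ht) hs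

theorem velocity_eq (hΦ : IsMaximalFlow v dom Φ) {z : N} {s : ℝ}
    (hs : s ∈ dom z) : velocity J (fun r => Φ r z) s = v (Φ s z) :=
  velocity_eq_of_hasMFDerivAt (hΦ.hasMFDerivAt hs)

theorem contDiffAt_chartField (hv : IsSmoothVectorField v) {x₀ x : N}
    (hx : x ∈ (extChartAt J x₀).source) :
    ContDiffAt ℝ ∞ (chartField v x₀) (extChartAt J x₀ x) :=
  (hv x₀).contDiffAt ((isOpen_extChartAt_target x₀).mem_nhds ((extChartAt J x₀).map_source hx))

/-- In a chart, position and variation together solve a smooth autonomous equation on `F × F`, so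
the bootstrap for solutions applies to the pair. -/
theorem contDiffAt_mfderiv (hΦ : IsMaximalFlow v dom Φ) (hv : IsSmoothVectorField v)
    {z : N} {s : ℝ} (hs : s ∈ dom z) (V : TangentSpace J z) :
    ContDiffAt ℝ ∞ (fun r => toChartEnd J (Φ s z) (Φ r z) (mfderiv J J (Φ r) z V)) s := by
  have hx := mem_extChartAt_source (I := J) (Φ s z)
  have hfd : ContDiffOn ℝ ∞ (fun x : F × F => (chartField v (Φ s z) x.1,
      fderiv ℝ (chartField v (Φ s z)) x.1 x.2)) ((extChartAt J (Φ s z)).target ×ˢ univ) := by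
    intro x hx
    have h := (hv (Φ s z)).contDiffAt ((isOpen_extChartAt_target _).mem_nhds hx.1)
    have h2 : ContDiffAt ℝ ∞ (fderiv ℝ (chartField v (Φ s z))) x.1 := h.fderiv_right (by simp)
    exact ((h.comp x contDiffAt_fst).prodMk
      ((h2.comp x contDiffAt_fst).clm_apply contDiffAt_snd)).contDiffWithinAt
  have := contDiffAt_of_eventually_hasDerivAt
    (c := fun r => (extChartAt J (Φ s z) (Φ r z),
      toChartEnd J (Φ s z) (Φ r z) (mfderiv J J (Φ r) z V))) (t := s)
    ((isOpen_extChartAt_target (Φ s z)).prod isOpen_univ) hfd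
    ⟨mem_extChartAt_target _, mem_univ _⟩
    ((hΦ.eventually_hasDerivAt_mfderiv hv hs V).mono fun r hr => hr.2.1.prodMk hr.2.2)
  exact this.snd

theorem contMDiffAt_mfderiv (hΦ : IsMaximalFlow v dom Φ) (hv : IsSmoothVectorField v)
    {z : N} {s : ℝ} (hs : s ∈ dom z) (V : TangentSpace J z) :
    letI : IsManifold J 1 N := IsManifold.of_le (n := ∞) (by norm_num)
    ContMDiffAt 𝓘(ℝ, ℝ) J.tangent ∞
      (fun r => (⟨Φ r z, mfderiv J J (Φ r) z V⟩ : TangentBundle J N)) s :=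
  letI : IsManifold J 1 N := IsManifold.of_le (n := ∞) (by norm_num)
  contMDiffAt_tangentBundle_iff.2 ⟨hΦ.contMDiffAt hv hs, hΦ.contDiffAt_mfderiv hv hs V⟩

/-- Along a flow line the velocity is the field itself, so its covariant derivative is `∇_G G` by
the chain rule. -/
theorem covDeriv_velocity_eq_zero (hΦ : IsMaximalFlow v dom Φ) (hv : IsSmoothVectorField v)
    {z : N} {s : ℝ} (hs : s ∈ dom z) {D : AlongOp J N} {Γ : F → F →L[ℝ] F →L[ℝ] F}
    (hgeo : fderiv ℝ (chartField v (Φ s z)) (extChartAt J (Φ s z) (Φ s z))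
        (chartField v (Φ s z) (extChartAt J (Φ s z) (Φ s z)))
      + Γ (extChartAt J (Φ s z) (Φ s z)) (chartField v (Φ s z) (extChartAt J (Φ s z) (Φ s z)))
        (chartField v (Φ s z) (extChartAt J (Φ s z) (Φ s z))) = 0)
    (hD : IsLocallyGiven D Γ (fun r => Φ r z) (velocity J fun r => Φ r z) (Φ s z) s) :
    D (fun r => Φ r z) (velocity J fun r => Φ r z) s = 0 := by
  have hx := mem_extChartAt_source (I := J) (Φ s z)
  have hy := (hΦ.eventually_hasDerivAt_mfderiv hv hs 0).self_of_nhds.2.1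
  have hval : ∀ᶠ r in 𝓝 s, toChartEnd J (Φ s z) (Φ r z) (velocity J (fun r => Φ r z) r)
      = chartField v (Φ s z) (extChartAt J (Φ s z) (Φ r z)) := by
    filter_upwards [(hΦ.isOpen_dom z).mem_nhds hs,
      (hΦ.continuousAt hs).eventually (extChartAt_source_mem_nhds (I := J) (Φ s z))] with r hr hr2
    rw [hΦ.velocity_eq hr, chartField_extChartAt v hr2]
  have hd : HasDerivAt (fun r => chartField v (Φ s z) (extChartAt J (Φ s z) (Φ r z))) _ s :=
    ((contDiffAt_chartField hv hx).differentiableAt (by norm_num)).hasFDerivAt.comp_hasDerivAt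
      (f := fun r => extChartAt J (Φ s z) (Φ r z)) s hy
  unfold IsLocallyGiven at hD
  rw [hval.self_of_nhds, Filter.EventuallyEq.deriv_eq hval, hd.deriv, hy.deriv, hgeo,
    toChartEnd_self] at hD
  exact hD

/-- The chart form of `D W` for a field `W` that is transported by the flow. -/
theorem toChartEnd_covDeriv (hΦ : IsMaximalFlow v dom Φ) (hv : IsSmoothVectorField v)
    {z : N} {s : ℝ} (hs : s ∈ dom z) (V : TangentSpace J z)
    {D : AlongOp J N} {Γ : F → F →L[ℝ] F →L[ℝ] F}
    (hD : ∀ᶠ r in 𝓝 s, IsLocallyGiven D Γ (fun r => Φ r z) (fun r => mfderiv J J (Φ r) z V)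
      (Φ s z) r) :
    ∀ᶠ r in 𝓝 s, toChartEnd J (Φ s z) (Φ r z)
        (D (fun r => Φ r z) (fun r => mfderiv J J (Φ r) z V) r)
      = fderiv ℝ (chartField v (Φ s z)) (extChartAt J (Φ s z) (Φ r z))
          (toChartEnd J (Φ s z) (Φ r z) (mfderiv J J (Φ r) z V))
        + Γ (extChartAt J (Φ s z) (Φ r z)) (chartField v (Φ s z) (extChartAt J (Φ s z) (Φ r z)))
          (toChartEnd J (Φ s z) (Φ r z) (mfderiv J J (Φ r) z V)) := by
  filter_upwards [hD, hΦ.eventually_hasDerivAt_mfderiv hv hs V] with r hr hr2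
  refine hr.trans ?_
  rw [hr2.2.1.deriv, hr2.2.2.deriv]

/-- This justifies applying the fixed-chart formula for `D` a second time, to the field `D W`. -/
theorem differentiableAt_covDeriv (hΦ : IsMaximalFlow v dom Φ) (hv : IsSmoothVectorField v)
    {z : N} {s : ℝ} (hs : s ∈ dom z) (V : TangentSpace J z)
    {D : AlongOp J N} {Γ : F → F →L[ℝ] F →L[ℝ] F}
    (hΓ : DifferentiableAt ℝ Γ (extChartAt J (Φ s z) (Φ s z)))
    (hD : ∀ᶠ r in 𝓝 s, IsLocallyGiven D Γ (fun r => Φ r z) (fun r => mfderiv J J (Φ r) z V)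
      (Φ s z) r) :
    DifferentiableAt ℝ (fun r => toChartEnd J (Φ s z) (Φ r z)
        (D (fun r => Φ r z) (fun r => mfderiv J J (Φ r) z V) r)) s := by
  have hx := mem_extChartAt_source (I := J) (Φ s z)
  have h1 := hΦ.toChartEnd_covDeriv hv hs V hD
  have h2 := (hΦ.eventually_hasDerivAt_mfderiv hv hs V).self_of_nhds.2
  have hG := contDiffAt_chartField hv hx
  have h3 := hasDerivAt_fderiv_apply_of_linearized
    (y := fun r => extChartAt J (Φ s z) (Φ r z)) hG h2.1 h2.2
  have h4 : DifferentiableAt ℝ (fun r => Γ (extChartAt J (Φ s z) (Φ r z))) s :=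
    (hΓ.hasFDerivAt.comp_hasDerivAt (f := fun r => extChartAt J (Φ s z) (Φ r z)) s
      h2.1).differentiableAt
  have h5 : DifferentiableAt ℝ (fun r => chartField v (Φ s z) (extChartAt J (Φ s z) (Φ r z))) s :=
    ((hG.differentiableAt (by norm_num)).hasFDerivAt.comp_hasDerivAt
      (f := fun r => extChartAt J (Φ s z) (Φ r z)) s h2.1).differentiableAt
  exact (h3.differentiableAt.add
    ((h4.clm_apply h5).clm_apply h2.2.differentiableAt)).congr_of_eventuallyEq h1

/-- If the flow lines of `v` are geodesics, the derivative of the flow gives Jacobi fields. -/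
theorem covDeriv_covDeriv_eq_curvature (hΦ : IsMaximalFlow v dom Φ) (hv : IsSmoothVectorField v)
    {z : N} {s : ℝ} (hs : s ∈ dom z) (V : TangentSpace J z)
    {D : AlongOp J N} {C : ConnCoeff F N} {Γ : F → F →L[ℝ] F →L[ℝ] F}
    (hΓ : DifferentiableAt ℝ Γ (extChartAt J (Φ s z) (Φ s z)))
    (hsymm : ∀ᶠ y in 𝓝 (extChartAt J (Φ s z) (Φ s z)), ∀ a b, Γ y a b = Γ y b a)
    (hgeo : ∀ᶠ y in 𝓝 (extChartAt J (Φ s z) (Φ s z)),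
      fderiv ℝ (chartField v (Φ s z)) y (chartField v (Φ s z) y)
        + Γ y (chartField v (Φ s z) y) (chartField v (Φ s z) y) = 0)
    (hC : ∀ᶠ y in 𝓝 (extChartAt J (Φ s z) (Φ s z)), ∀ a b, C (Φ s z) y a b = Γ y a b)
    (hD : ∀ᶠ r in 𝓝 s, IsLocallyGiven D Γ (fun r => Φ r z) (fun r => mfderiv J J (Φ r) z V)
      (Φ s z) r)
    (hDD : IsLocallyGiven D Γ (fun r => Φ r z)
      (D (fun r => Φ r z) fun r => mfderiv J J (Φ r) z V) (Φ s z) s) :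
    D (fun r => Φ r z) (D (fun r => Φ r z) fun r => mfderiv J J (Φ r) z V) s
      = curvature C (Φ s z) (velocity J (fun r => Φ r z) s) (mfderiv J J (Φ s) z V)
        (velocity J (fun r => Φ r z) s) := by
  have hx := mem_extChartAt_source (I := J) (Φ s z)
  have h1 := hΦ.toChartEnd_covDeriv hv hs V hD
  have h2 := (hΦ.eventually_hasDerivAt_mfderiv hv hs V).self_of_nhds.2
  have hG := contDiffAt_chartField hv hx
  obtain ⟨a', ha', hcurv⟩ := exists_hasDerivAt_jacobi
    (y := fun r => extChartAt J (Φ s z) (Φ r z)) hG hΓ hsymm hgeo h2.1 h2.2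
  have h3 := ha'.congr_of_eventuallyEq h1
  unfold IsLocallyGiven at hDD
  rw [h3.deriv, h1.self_of_nhds, h2.1.deriv, hcurv, chartField_extChartAt v hx, toChartEnd_self]
    at hDD
  rw [hΦ.velocity_eq hs]
  exact hDD.trans (curvature_eq_curv hΓ hC _ _ _).symm

end IsMaximalFlow

end Jacobi

/-! ### The energy -/

section LocalEnergy

variable {E : Type*} [NormedAddCommGroup E] [NormedSpace ℝ E]

/-- The function `(x, p) ↦ ½ g(p, p)`. -/
def localEnergy (g : E → E →L[ℝ] E →L[ℝ] ℝ) (x : E × E) : ℝ := (1 / 2 : ℝ) * g x.1 x.2 x.2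

variable [FiniteDimensional ℝ E] {g : E → E →L[ℝ] E →L[ℝ] ℝ} {Ω : Set E} {x : E × E}

namespace IsLocalMetric

theorem contDiffAt_localEnergy (hg : IsLocalMetric g Ω) (hx : x.1 ∈ Ω) :
    ContDiffAt ℝ ∞ (localEnergy g) x := by
  have h1 : ContDiffAt ℝ ∞ (fun x : E × E => g x.1) x := (hg.contDiffAt hx).comp x contDiffAt_fst
  exact contDiffAt_const.mul ((h1.clm_apply contDiffAt_snd).clm_apply contDiffAt_snd)

/-- By metric compatibility the derivative of `g` in the base direction contributes `g(Γ(A.1, p),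
p)`, which completes `A.2` to the vertical part of `A`. In particular `q` is constant in horizontal
directions. -/
theorem fderiv_localEnergy (hg : IsLocalMetric g Ω) (hx : x.1 ∈ Ω) (A : E × E) :
    fderiv ℝ (localEnergy g) x A = g x.1 (localVer (christoffel g) x A) x.2 := by
  have h1 : HasFDerivAt (fun x : E × E => g x.1) _ x :=
    (hg.differentiableAt hx).hasFDerivAt.comp x hasFDerivAt_fst
  have h2 : HasFDerivAt (localEnergy g) _ x :=
    ((h1.clm_apply hasFDerivAt_snd).clm_apply hasFDerivAt_snd).const_mul (1 / 2 : ℝ)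
  rw [h2.fderiv, localVer_apply]
  simp [hg.fderiv_eq hx, hg.symm x.1 x.2]
  ring

theorem localVer_localSpray (x : E × E) : localVer (christoffel g) x (localSpray g x) = 0 :=
  neg_add_cancel _

theorem fderiv_localEnergy_localSpray (hg : IsLocalMetric g Ω) (hx : x.1 ∈ Ω) :
    fderiv ℝ (localEnergy g) x (localSpray g x) = 0 := by
  rw [hg.fderiv_localEnergy hx, localVer_localSpray, map_zero, zero_apply]

theorem curv_self (Γ : E → E →L[ℝ] E →L[ℝ] E) (y u w : E) : curv Γ y u u w = 0 := by
  simp [curv]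

/-- The integral curves of the spray are geodesics of the Sasaki metric. -/
theorem nabla_localSpray_self (hg : IsLocalMetric g Ω) (hx : x.1 ∈ Ω) :
    fderiv ℝ (localSpray g) x (localSpray g x)
      + christoffel (Sasaki.localSasaki g) x (localSpray g x) (localSpray g x) = 0 := by
  have h0 : curv (christoffel g) x.1 x.2 0 x.2 = 0 := by simp [curv]
  rw [hg.nabla_localSpray hx, localVer_localSpray, h0]
  simp only [localSpray, curv_self, smul_zero, add_zero, map_zero, zero_apply, neg_zero]
  rfl

end IsLocalMetric

end LocalEnergy

/-! ### Projecting a connection to the level sets of a function -/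

section Projection

variable {F : Type*} [NormedAddCommGroup F] [NormedSpace ℝ F]

/-- `Γ` plus the Hessian of `q`, divided by `dq(V)`, in the direction `V`. -/
def projCoeff (Γ : F → F →L[ℝ] F →L[ℝ] F) (q : F → ℝ) (V : F → F) (y : F) : F →L[ℝ] F →L[ℝ] F :=
  Γ y + (ContinuousLinearMap.compL ℝ F ℝ F
      (ContinuousLinearMap.toSpanSingleton ℝ ((fderiv ℝ q y (V y))⁻¹ • V y))).comp
    (fderiv ℝ (fderiv ℝ q) y - (ContinuousLinearMap.compL ℝ F F ℝ (fderiv ℝ q y)).comp (Γ y))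

variable {Γ : F → F →L[ℝ] F →L[ℝ] F} {q : F → ℝ} {V : F → F} {y : F}

theorem projCoeff_apply (Γ : F → F →L[ℝ] F →L[ℝ] F) (q : F → ℝ) (V : F → F) (y a b : F) :
    projCoeff Γ q V y a b = Γ y a b
      + ((fderiv ℝ (fderiv ℝ q) y a b - fderiv ℝ q y (Γ y a b)) / fderiv ℝ q y (V y)) • V y := by
  simp [projCoeff, smul_smul, div_eq_mul_inv, ContinuousLinearMap.toSpanSingleton_apply, sub_mul,
    sub_smul]

theorem differentiableAt_projCoeff (hΓ : DifferentiableAt ℝ Γ y) (hq : ContDiffAt ℝ ∞ q y)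
    (hV : DifferentiableAt ℝ V y) (hqV : fderiv ℝ q y (V y) ≠ 0) :
    DifferentiableAt ℝ (projCoeff Γ q V) y := by
  have h1 : ContDiffAt ℝ ∞ (fderiv ℝ q) y := hq.fderiv_right (by simp)
  have h2 : ContDiffAt ℝ ∞ (fderiv ℝ (fderiv ℝ q)) y := h1.fderiv_right (by simp)
  have d1 : DifferentiableAt ℝ (fderiv ℝ q) y := h1.differentiableAt (by norm_num)
  have d2 : DifferentiableAt ℝ (fderiv ℝ (fderiv ℝ q)) y := h2.differentiableAt (by norm_num)
  have d3 : DifferentiableAt ℝ (fun y => (fderiv ℝ q y (V y))⁻¹ • V y) y :=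
    ((d1.clm_apply hV).inv hqV).smul hV
  have d4 : DifferentiableAt ℝ (fun y => ContinuousLinearMap.compL ℝ F ℝ F
      (ContinuousLinearMap.toSpanSingleton ℝ ((fderiv ℝ q y (V y))⁻¹ • V y))) y :=
    ((ContinuousLinearMap.compL ℝ F ℝ F).comp
      (ContinuousLinearMap.toSpanSingletonCLE (𝕜 := ℝ) (E := F) : F →L[ℝ] ℝ →L[ℝ] F)).differentiableAt.comp y d3
  have d5 : DifferentiableAt ℝ (fun y => ContinuousLinearMap.compL ℝ F F ℝ (fderiv ℝ q y)) y :=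
    (ContinuousLinearMap.compL ℝ F F ℝ).differentiableAt.comp y d1
  exact hΓ.add (d4.clm_comp (d2.sub (d5.clm_comp hΓ)))

/-- The correction is a multiple of the covariant Hessian, which is symmetric when `Γ` is; the
Jacobi argument needs a torsion-free connection. -/
theorem projCoeff_symm (hΓ : ∀ a b, Γ y a b = Γ y b a) (hq : ContDiffAt ℝ ∞ q y) (a b : F) :
    projCoeff Γ q V y a b = projCoeff Γ q V y b a := by
  have hs : fderiv ℝ (fderiv ℝ q) y a b = fderiv ℝ (fderiv ℝ q) y b a :=
    (hq.of_le two_le_infty).isSymmSndFDerivAt (by simp) _ _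
  rw [projCoeff_apply, projCoeff_apply, hΓ a b, hs]

/-- If `dq(G) = 0` and `w` solves the linearized equation of `G`, then `dq(w)` is constant. -/
theorem hasDerivAt_fderiv_linearized {G : F → F} {y w : ℝ → F} {t : ℝ}
    (hq : ContDiffAt ℝ ∞ q (y t)) (hG : DifferentiableAt ℝ G (y t))
    (h0 : ∀ᶠ x in 𝓝 (y t), fderiv ℝ q x (G x) = 0)
    (hy : HasDerivAt y (G (y t)) t) (hw : HasDerivAt w (fderiv ℝ G (y t) (w t)) t) :
    HasDerivAt (fun r => fderiv ℝ q (y r) (w r)) 0 t := by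
  have hs : fderiv ℝ (fderiv ℝ q) (y t) (G (y t)) (w t)
      = fderiv ℝ (fderiv ℝ q) (y t) (w t) (G (y t)) :=
    (hq.of_le two_le_infty).isSymmSndFDerivAt (by simp) _ _
  have d1 : DifferentiableAt ℝ (fderiv ℝ q) (y t) :=
    (hq.fderiv_right (m := 1) one_add_one_le_infty).differentiableAt one_ne_zero
  have h1 := (d1.hasFDerivAt.clm_apply hG.hasFDerivAt).unique
    ((hasFDerivAt_const (0 : ℝ) (y t)).congr_of_eventuallyEq h0)
  refine (hasDerivAt_comp_clm_apply d1 hy hw).congr_deriv ?_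
  have h2 := DFunLike.congr_fun h1 (w t)
  simp only [add_apply, ContinuousLinearMap.comp_apply, ContinuousLinearMap.flip_apply,
    zero_apply] at h2
  rw [hs, ← h2, add_comm]

/-- `Hess q(G, G) = G(Gq) - dq(∇_G G)`, and both terms vanish, so the correction does not affect the
geodesic equation of `G`. -/
theorem projCoeff_nabla_self {G : F → F} (hq : ContDiffAt ℝ ∞ q y) (hG : DifferentiableAt ℝ G y)
    (h0 : ∀ᶠ x in 𝓝 y, fderiv ℝ q x (G x) = 0)
    (hgeo : fderiv ℝ G y (G y) + Γ y (G y) (G y) = 0) :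
    fderiv ℝ G y (G y) + projCoeff Γ q V y (G y) (G y) = 0 := by
  have d1 : DifferentiableAt ℝ (fderiv ℝ q) y :=
    (hq.fderiv_right (m := 1) one_add_one_le_infty).differentiableAt one_ne_zero
  have h1 := (d1.hasFDerivAt.clm_apply hG.hasFDerivAt).unique
    ((hasFDerivAt_const (0 : ℝ) y).congr_of_eventuallyEq h0)
  have h2 := DFunLike.congr_fun h1 (G y)
  simp only [add_apply, ContinuousLinearMap.comp_apply, ContinuousLinearMap.flip_apply,
    zero_apply] at h2
  have h3 : fderiv ℝ (fderiv ℝ q) y (G y) (G y) - fderiv ℝ q y (Γ y (G y) (G y)) = 0 := by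
    rw [eq_neg_of_add_eq_zero_right hgeo, map_neg, sub_neg_eq_add, add_comm]
    exact h2
  rw [projCoeff_apply, h3, zero_div, zero_smul, add_zero, hgeo]

end Projection

section Trajectories

variable {E : Type*} [NormedAddCommGroup E] [NormedSpace ℝ E] [FiniteDimensional ℝ E]
  {M : Type*} [TopologicalSpace M] [ChartedSpace E M] [IsManifold 𝓘(ℝ, E) ∞ M]
  {g : BilinField 𝓘(ℝ, E) M}

/-! ### The energy on the tangent bundle -/

variable (g) in
/-- The function `(x, p) ↦ ½ g(p, p)`. -/
def energy (z : TM E M) : ℝ := (1 / 2 : ℝ) * g z.1 z.2 z.2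

theorem energyChart_eq (z₀ : TM E M) {y : E × E} (hy : y ∈ (extChartAt (modelTM E) z₀).target) :
    energyChart g z₀ y = localEnergy (gram g z₀.1) y := by
  have h := (extChartAt_TM_symm (mem_target_TM.1 hy)).2
  have e : energyChart g z₀ y = energy g ((extChartAt (modelTM E) z₀).symm y) := rfl
  rw [e, h, localEnergy, gram_apply]
  rfl

theorem energyChart_eventuallyEq (z₀ : TM E M) {y : E × E}
    (hy : y ∈ (extChartAt (modelTM E) z₀).target) :
    energyChart g z₀ =ᶠ[𝓝 y] localEnergy (gram g z₀.1) := by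
  filter_upwards [(isOpen_extChartAt_target z₀).mem_nhds hy] with y hy using energyChart_eq z₀ hy

theorem contDiffAt_energyChart (hg : IsPseudoRiemannian g) (z₀ : TM E M) {y : E × E}
    (hy : y ∈ (extChartAt (modelTM E) z₀).target) : ContDiffAt ℝ ∞ (energyChart g z₀) y :=
  ((hg.isLocalMetric_gram z₀.1).contDiffAt_localEnergy (mem_target_TM.1 hy)).congr_of_eventuallyEq
    (energyChart_eventuallyEq z₀ hy)

theorem sasaki_normalVec (z : TM E M) (A : TangentSpace (modelTM E) z) :
    sasaki g z A (normalVec z) = g z.1 (verPart g z A) z.2 := by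
  rw [sasaki_apply, normalVec, horPart_Ver, verPart_Ver, map_zero, zero_add]

theorem fderiv_energyChart_toChartEnd (hg : IsPseudoRiemannian g) {z₀ z : TM E M}
    (hz : z ∈ (extChartAt (modelTM E) z₀).source) (A : TangentSpace (modelTM E) z) :
    fderiv ℝ (energyChart g z₀) (extChartAt (modelTM E) z₀ z) (toChartEnd (modelTM E) z₀ z A)
      = sasaki g z A (normalVec z) := by
  have hz' := mem_source_TM.1 hz
  have hy := (extChartAt (modelTM E) z₀).map_source hz
  rw [(energyChart_eventuallyEq z₀ hy).fderiv_eq,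
    (hg.isLocalMetric_gram z₀.1).fderiv_localEnergy (mem_target_TM.1 hy),
    localVer_toChartEnd hg hz', sasaki_normalVec, extChartAt_TM hz']
  exact gram_extChartAt g hz' _ _

theorem fderiv_energyChart_spray (hg : IsPseudoRiemannian g) (z₀ : TM E M) {y : E × E}
    (hy : y ∈ (extChartAt (modelTM E) z₀).target) :
    fderiv ℝ (energyChart g z₀) y (chartField (spray g) z₀ y) = 0 := by
  rw [(energyChart_eventuallyEq z₀ hy).fderiv_eq, chartField_spray hg z₀ hy]
  exact (hg.isLocalMetric_gram z₀.1).fderiv_localEnergy_localSpray (mem_target_TM.1 hy)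

/-! ### The covariant derivative of the Sasaki metric along the flow -/

theorem isLocallyGiven_sasakiD (hg : IsPseudoRiemannian g) {z₀ : TM E M} {c : ℝ → TM E M}
    {W : ∀ t, TangentSpace (modelTM E) (c t)} {t : ℝ}
    (hx : c t ∈ (extChartAt (modelTM E) z₀).source)
    (hc : ContinuousAt c t) (hd : DifferentiableAt ℝ (fun r => extChartAt (modelTM E) z₀ (c r)) t)
    (hW : DifferentiableAt ℝ (fun r => toChartEnd (modelTM E) z₀ (c r) (W r)) t) :
    IsLocallyGiven (sasakiD g) (christoffel (localSasaki (gram g z₀.1))) c W z₀ t := by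
  refine (toChartEnd_covDerivAlong hg.sasaki.isConnection_leviCivita hx hc hd hW).trans ?_
  rw [leviCivita_eq_christoffel,
    christoffel_gram_sasaki hg z₀ ((extChartAt (modelTM E) z₀).map_source hx)]

theorem chartField_spray_eventuallyEq (hg : IsPseudoRiemannian g) (z₀ : TM E M) {y : E × E}
    (hy : y ∈ (extChartAt (modelTM E) z₀).target) :
    chartField (spray g) z₀ =ᶠ[𝓝 y] localSpray (gram g z₀.1) := by
  filter_upwards [(isOpen_extChartAt_target z₀).mem_nhds hy] with y hy
    using chartField_spray hg z₀ hy

theorem nabla_chartField_spray (hg : IsPseudoRiemannian g) (z₀ : TM E M) {y : E × E}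
    (hy : y ∈ (extChartAt (modelTM E) z₀).target) :
    fderiv ℝ (chartField (spray g) z₀) y (chartField (spray g) z₀ y)
      + christoffel (localSasaki (gram g z₀.1)) y (chartField (spray g) z₀ y)
        (chartField (spray g) z₀ y) = 0 := by
  rw [(chartField_spray_eventuallyEq hg z₀ hy).fderiv_eq, chartField_spray hg z₀ hy]
  exact (hg.isLocalMetric_gram z₀.1).nabla_localSpray_self (mem_target_TM.1 hy)

theorem curvature_leviCivita (hg : IsPseudoRiemannian g) (x : M)
    (u v w : TangentSpace 𝓘(ℝ, E) x) : (curvature (leviCivita g) x u v w : E)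
      = curv (christoffel (gram g x)) (extChartAt 𝓘(ℝ, E) x x) u v w :=
  curvature_eq_curv
    ((hg.isLocalMetric_gram x).differentiableAt_christoffel (mem_extChartAt_target x))
    (Filter.Eventually.of_forall fun y u v => leviCivita_eq_christoffel g x y u v) u v w

variable (g) in
/-- The covariant derivative of the spray in the direction `A`. -/
def nablaSpray (z : TM E M) (A : TangentSpace (modelTM E) z) : TangentSpace (modelTM E) z :=
  Hor g z (verPart g z A
      + (1 / 2 : ℝ) • curvature (leviCivita g) z.1 z.2 (verPart g z A) z.2)
    + (1 / 2 : ℝ) • Ver z (curvature (leviCivita g) z.1 z.2 (horPart z A) z.2)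

/-- `nablaSpray` is the covariant derivative of the spray for the Sasaki metric. -/
theorem nablaSpray_eq (hg : IsPseudoRiemannian g) (z : TM E M) (A : E × E) :
    (nablaSpray g z A : E × E)
      = fderiv ℝ (chartField (spray g) z) (extChartAt (modelTM E) z z) A
        + christoffel (localSasaki (gram g z.1)) (extChartAt (modelTM E) z z)
          (chartField (spray g) z (extChartAt (modelTM E) z z)) A := by
  have hy := mem_extChartAt_target (I := modelTM E) z
  have hL := hg.isLocalMetric_localSasaki z
  have hver : localVer (christoffel (gram g z.1)) (extChartAt (modelTM E) z z) A
      = verPart g z A := by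
    rw [extChartAt_TM_self]
    rfl
  let R : E → E := fun u => curvature (leviCivita g) z.1 z.2 u z.2
  have hR : ∀ u : E, R u
      = curv (christoffel (gram g z.1)) (extChartAt 𝓘(ℝ, E) z.1 z.1) z.2 u z.2 := fun u =>
    curvature_leviCivita hg z.1 z.2 u z.2
  let κ : E := verPart g z A
  have e : (nablaSpray g z A : E × E)
      = (κ + (1 / 2 : ℝ) • R κ + (1 / 2 : ℝ) • (0 : E),
        - christoffel (gram g z.1) (extChartAt 𝓘(ℝ, E) z.1 z.1)
          (κ + (1 / 2 : ℝ) • R κ) z.2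
          + (1 / 2 : ℝ) • R A.1) := rfl
  rw [e, hR, hR, smul_zero, add_zero, (chartField_spray_eventuallyEq hg z hy).fderiv_eq,
    chartField_spray hg z hy, hL.christoffel_symm hy _ A, hL.christoffel_symm hy A,
    hL.christoffel_symm hy _ A,
    (hg.isLocalMetric_gram z.1).nabla_localSpray (mem_target_TM.1 hy), hver, extChartAt_TM_self]

variable [T2Space M]

theorem eventually_isLocallyGiven_sasakiD (hg : IsPseudoRiemannian g) {z : TM E M} {s : ℝ}
    (hs : s ∈ geodesicDomain g z) (V : TangentSpace (modelTM E) z) :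
    ∀ᶠ r in 𝓝 s, IsLocallyGiven (sasakiD g)
      (christoffel (localSasaki (gram g (geodesicFlow g s z).1)))
      (fun r => geodesicFlow g r z) (dFlow g z V) (geodesicFlow g s z) r := by
  have hΦ := isMaximalFlow_geodesicFlow hg
  filter_upwards [(hΦ.isOpen_dom z).mem_nhds hs,
    hΦ.eventually_hasDerivAt_mfderiv (isSmoothVectorField_spray hg) hs V] with r hr hr2
  exact isLocallyGiven_sasakiD hg hr2.1 (hΦ.continuousAt hr) hr2.2.1.differentiableAt
    hr2.2.2.differentiableAt

/-- A field transported by the flow commutes with the generator, so `∇̄_X J = ∇̄_J X` by symmetry of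
the connection. The right side depends on `J` only pointwise. -/
theorem sasakiD_dFlow (hg : IsPseudoRiemannian g) {z : TM E M} {s : ℝ}
    (hs : s ∈ geodesicDomain g z) (V : TangentSpace (modelTM E) z) :
    sasakiD g (fun r => geodesicFlow g r z) (dFlow g z V) s
      = nablaSpray g (geodesicFlow g s z) (dFlow g z V s) := by
  have hΦ := isMaximalFlow_geodesicFlow hg
  have h1 := (hΦ.toChartEnd_covDeriv (isSmoothVectorField_spray hg) hs V
    (eventually_isLocallyGiven_sasakiD hg hs V)).self_of_nhds
  rw [toChartEnd_self] at h1
  exact h1.trans (nablaSpray_eq hg _ (dFlow g z V s)).symm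

end Trajectories

section SasakiJacobi

variable {E : Type*} [NormedAddCommGroup E] [NormedSpace ℝ E] [FiniteDimensional ℝ E]
  {M : Type*} [TopologicalSpace M] [ChartedSpace E M] [IsManifold 𝓘(ℝ, E) ∞ M]
  {g : BilinField 𝓘(ℝ, E) M} [T2Space M]

/-! ### Geodesics and Jacobi fields of the Sasaki metric -/

theorem differentiableAt_toChartEnd_velocity (hg : IsPseudoRiemannian g) {z : TM E M} {s : ℝ}
    (hs : s ∈ geodesicDomain g z) :
    DifferentiableAt ℝ (fun r => toChartEnd (modelTM E) (geodesicFlow g s z) (geodesicFlow g r z)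
      (velocity (modelTM E) (fun r => geodesicFlow g r z) r)) s := by
  have : IsManifold (modelTM E) 1 (TM E M) := IsManifold.of_le (n := ∞) (by norm_num)
  exact (contMDiffAt_tangentBundle_iff.1 (contMDiffAt_velocity
    ((isMaximalFlow_geodesicFlow hg).contMDiffAt (isSmoothVectorField_spray hg) hs))).2.differentiableAt
    (by norm_num)

theorem hasDerivAt_extChartAt_geodesicFlow (hg : IsPseudoRiemannian g) {z : TM E M} {s : ℝ}
    (hs : s ∈ geodesicDomain g z) :
    HasDerivAt (fun r => extChartAt (modelTM E) (geodesicFlow g s z) (geodesicFlow g r z))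
      (chartField (spray g) (geodesicFlow g s z)
        (extChartAt (modelTM E) (geodesicFlow g s z) (geodesicFlow g s z))) s :=
  ((isMaximalFlow_geodesicFlow hg).eventually_hasDerivAt_mfderiv (isSmoothVectorField_spray hg) hs
    0).self_of_nhds.2.1

theorem isGeodesicOn_sasakiD (hg : IsPseudoRiemannian g) (z : TM E M) :
    IsGeodesicOn (sasakiD g) (fun s => geodesicFlow g s z) (geodesicDomain g z) := by
  have hΦ := isMaximalFlow_geodesicFlow hg
  have hv := isSmoothVectorField_spray hg
  refine ⟨fun s hs => (hΦ.contMDiffAt hv hs).contMDiffWithinAt, fun s hs => ?_⟩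
  exact hΦ.covDeriv_velocity_eq_zero hv hs
    (nabla_chartField_spray hg _ (mem_extChartAt_target _))
    (isLocallyGiven_sasakiD hg (mem_extChartAt_source _) (hΦ.continuousAt hs)
      (hasDerivAt_extChartAt_geodesicFlow hg hs).differentiableAt
      (differentiableAt_toChartEnd_velocity hg hs))

theorem isJacobiFieldOn_sasakiD (hg : IsPseudoRiemannian g) (z : TM E M)
    (V : TangentSpace (modelTM E) z) [IsManifold (modelTM E) 1 (TM E M)] :
    IsJacobiFieldOn (sasakiD g) (curvature (leviCivita (sasaki g)))
      (fun s => geodesicFlow g s z) (dFlow g z V) (geodesicDomain g z) := by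
  have hΦ := isMaximalFlow_geodesicFlow hg
  have hv := isSmoothVectorField_spray hg
  refine ⟨fun s hs => (hΦ.contMDiffAt_mfderiv hv hs V).contMDiffWithinAt, fun s hs => ?_⟩
  set z₀ := geodesicFlow g s z with hz₀
  have hy := mem_extChartAt_target (I := modelTM E) z₀
  have hev := (isOpen_extChartAt_target z₀).mem_nhds hy
  have hL := hg.isLocalMetric_localSasaki z₀
  have hΓ := hL.differentiableAt_christoffel hy
  have hD := eventually_isLocallyGiven_sasakiD hg hs V
  exact hΦ.covDeriv_covDeriv_eq_curvature hv hs V hΓ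
    (Filter.mem_of_superset hev fun y hy a b => hL.christoffel_symm hy a b)
    (Filter.mem_of_superset hev fun y hy => nabla_chartField_spray hg z₀ hy)
    (Filter.mem_of_superset hev fun y hy a b => by
      change leviCivita (sasaki g) z₀ y a b = _
      rw [leviCivita_eq_christoffel, christoffel_gram_sasaki hg z₀ hy])
    hD
    (isLocallyGiven_sasakiD hg (mem_extChartAt_source _) (hΦ.continuousAt hs)
      (hasDerivAt_extChartAt_geodesicFlow hg hs).differentiableAt
      (hΦ.differentiableAt_covDeriv hv hs V hΓ hD))

/-! ### Initial values -/

theorem geodesicFlow_zero (hg : IsPseudoRiemannian g) : geodesicFlow g 0 = id :=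
  funext fun z => ((isMaximalFlow_geodesicFlow hg).zero_mem_dom (isSmoothVectorField_spray hg) z).2

theorem zero_mem_geodesicDomain (hg : IsPseudoRiemannian g) (z : TM E M) :
    0 ∈ geodesicDomain g z :=
  ((isMaximalFlow_geodesicFlow hg).zero_mem_dom (isSmoothVectorField_spray hg) z).1

/-- `geodesicFlow g 0 z = z` is not definitional, so the two vectors formally live in different
tangent spaces; the equation is stated in the total space for this reason. -/
theorem vecAt_dFlow_zero (hg : IsPseudoRiemannian g) (z : TM E M)
    (V : TangentSpace (modelTM E) z) :
    vecAt (geodesicFlow g 0 z) (dFlow g z V 0) = vecAt z V := by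
  unfold dFlow
  rw [geodesicFlow_zero hg, mfderiv_id]
  rfl

theorem vecAt_sasakiD_dFlow_zero (hg : IsPseudoRiemannian g) (z : TM E M)
    (V : TangentSpace (modelTM E) z) :
    vecAt (geodesicFlow g 0 z) (sasakiD g (fun s => geodesicFlow g s z) (dFlow g z V) 0)
      = vecAt z (nablaSpray g z V) := by
  rw [sasakiD_dFlow hg (zero_mem_geodesicDomain hg z) V]
  exact congrArg (fun A : TangentBundle (modelTM E) (TM E M) => vecAt A.1 (nablaSpray g A.1 A.2))
    (vecAt_dFlow_zero hg z V)

theorem curvature_zero_middle (hg : IsPseudoRiemannian g) (x : M)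
    (u w : TangentSpace 𝓘(ℝ, E) x) : curvature (leviCivita g) x u 0 w = 0 := by
  have h : ∀ (Γ : E → E →L[ℝ] E →L[ℝ] E) (y a b : E), curv Γ y a 0 b = 0 := fun Γ y a b => by
    simp [curv]
  exact (curvature_leviCivita hg x u 0 w).trans (h _ _ _ _)

theorem nablaSpray_Hor (hg : IsPseudoRiemannian g) (z : TM E M)
    (v : TangentSpace 𝓘(ℝ, E) z.1) :
    nablaSpray g z (Hor g z v)
      = (1 / 2 : ℝ) • Ver z (curvature (leviCivita g) z.1 z.2 v z.2) := by
  rw [nablaSpray, verPart_Hor, horPart_Hor, curvature_zero_middle hg, smul_zero, add_zero]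
  have : Hor g z 0 = 0 := by
    have h : ((0 : E), - christoffelAt g z 0) = (0 : E × E) := by rw [map_zero, neg_zero]; rfl
    exact h
  rw [this, zero_add]

theorem Hor_add (z : TM E M) (v w : TangentSpace 𝓘(ℝ, E) z.1) :
    Hor g z (v + w) = Hor g z v + Hor g z w := by
  have h : ∀ v w : E, ((v + w : E), - christoffelAt g z (v + w))
      = (v, - christoffelAt g z v) + (w, - christoffelAt g z w) := fun v w => by
    rw [map_add, neg_add]; rfl
  exact h v w

theorem Hor_smul (z : TM E M) (a : ℝ) (v : TangentSpace 𝓘(ℝ, E) z.1) :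
    Hor g z (a • v) = a • Hor g z v := by
  have h : ∀ v : E, ((a • v : E), - christoffelAt g z (a • v))
      = a • (v, - christoffelAt g z v) := fun v => by
    rw [map_smul, ← smul_neg]; rfl
  exact h v

theorem nablaSpray_Ver (hg : IsPseudoRiemannian g) (z : TM E M)
    (v : TangentSpace 𝓘(ℝ, E) z.1) :
    nablaSpray g z (Ver z v) = Hor g z v
      + (1 / 2 : ℝ) • Hor g z (curvature (leviCivita g) z.1 z.2 v z.2) := by
  rw [nablaSpray, verPart_Ver, horPart_Ver, curvature_zero_middle hg, Hor_add, Hor_smul]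
  have : (1 / 2 : ℝ) • Ver z 0 = 0 := smul_zero (A := E × E) (1 / 2 : ℝ)
  rw [this, add_zero]

end SasakiJacobi

section Induced

variable {E : Type*} [NormedAddCommGroup E] [NormedSpace ℝ E] [FiniteDimensional ℝ E]
  {M : Type*} [TopologicalSpace M] [ChartedSpace E M] [IsManifold 𝓘(ℝ, E) ∞ M]
  {g : BilinField 𝓘(ℝ, E) M}

/-! ### The induced connection in charts -/

/-- The vertical lift of a vector field. -/
def verField (e : ∀ x : M, TangentSpace 𝓘(ℝ, E) x) (z : TM E M) : TangentSpace (modelTM E) z :=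
  Ver z (e z.1)

theorem chartField_verField (hg : IsPseudoRiemannian g) (e : ∀ x : M, TangentSpace 𝓘(ℝ, E) x)
    (z₀ : TM E M) {y : E × E} (hy : y ∈ (extChartAt (modelTM E) z₀).target) :
    chartField (verField e) z₀ y = (0, chartField e z₀.1 y.1) := by
  have hz := mem_source_TM.1 ((extChartAt (modelTM E) z₀).map_target hy)
  have h := (extChartAt_TM_symm (mem_target_TM.1 hy)).2
  unfold chartField
  set z := (extChartAt (modelTM E) z₀).symm y with hzdef
  rw [verField, toChartEnd_Ver hg hz, h]

theorem differentiableAt_chartField_verField (hg : IsPseudoRiemannian g)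
    {e : ∀ x : M, TangentSpace 𝓘(ℝ, E) x} (he : IsSmoothField e) (z₀ : TM E M) :
    DifferentiableAt ℝ (chartField (verField e) z₀) (extChartAt (modelTM E) z₀ z₀) := by
  have : IsManifold 𝓘(ℝ, E) 1 M := IsManifold.of_le (n := ∞) (by norm_num)
  have h1 : ContDiffAt ℝ ∞ (chartField e z₀.1) (extChartAt 𝓘(ℝ, E) z₀.1 z₀.1) :=
    (contMDiffAt_section_iff_chartField e z₀.1).1 (he z₀.1)
  have h2 : DifferentiableAt ℝ (chartField e z₀.1) (extChartAt (modelTM E) z₀ z₀).1 := by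
    rw [extChartAt_TM_self]
    exact h1.differentiableAt (by norm_num)
  have h3 : DifferentiableAt ℝ (fun y : E × E => ((0 : E), chartField e z₀.1 y.1))
      (extChartAt (modelTM E) z₀ z₀) :=
    (differentiableAt_const 0).prodMk (h2.comp (f := Prod.fst) _ differentiableAt_fst)
  refine h3.congr_of_eventuallyEq ?_
  filter_upwards [(isOpen_extChartAt_target z₀).mem_nhds (mem_extChartAt_target z₀)] with y hy
    using chartField_verField hg e z₀ hy

theorem sasaki_verField_normalVec (z : TM E M) (v : TangentSpace 𝓘(ℝ, E) z.1) :
    sasaki g z (Ver z v) (normalVec z) = g z.1 v z.2 := sasaki_Ver_Ver g z v z.2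

theorem fderiv_energyChart_verField (hg : IsPseudoRiemannian g)
    (e : ∀ x : M, TangentSpace 𝓘(ℝ, E) x) {z₀ z : TM E M}
    (hz : z ∈ (extChartAt (modelTM E) z₀).source) :
    fderiv ℝ (energyChart g z₀) (extChartAt (modelTM E) z₀ z)
      (chartField (verField e) z₀ (extChartAt (modelTM E) z₀ z)) = g z.1 z.2 (e z.1) := by
  rw [chartField_extChartAt _ hz, fderiv_energyChart_toChartEnd hg hz, verField,
    sasaki_verField_normalVec, hg.symm]

variable (g) in
/-- The coefficients of the induced connection in the chart at `z₀`, as bilinear maps. -/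
def inducedChristoffel (e : ∀ x : M, TangentSpace 𝓘(ℝ, E) x) (z₀ : TM E M) :
    E × E → E × E →L[ℝ] E × E →L[ℝ] E × E :=
  projCoeff (christoffel (localSasaki (gram g z₀.1))) (energyChart g z₀)
    (chartField (verField e) z₀)

theorem inducedCoeff_eq (hg : IsPseudoRiemannian g) (e : ∀ x : M, TangentSpace 𝓘(ℝ, E) x)
    (z₀ : TM E M) {y : E × E} (hy : y ∈ (extChartAt (modelTM E) z₀).target) (a b : E × E) :
    inducedCoeff g e z₀ y a b = inducedChristoffel g e z₀ y a b := by
  have h1 : DifferentiableAt ℝ (fderiv ℝ (energyChart g z₀)) y :=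
    ((contDiffAt_energyChart hg z₀ hy).fderiv_right (m := 1)
      one_add_one_le_infty).differentiableAt one_ne_zero
  have h2 : fderiv ℝ (fun y' => fderiv ℝ (energyChart g z₀) y' b) y a
      = fderiv ℝ (fderiv ℝ (energyChart g z₀)) y a b := by
    rw [(h1.hasFDerivAt.clm_apply (hasFDerivAt_const b y)).fderiv]
    simp
  have h3 : leviCivita (sasaki g) z₀ y a b = christoffel (localSasaki (gram g z₀.1)) y a b := by
    rw [leviCivita_eq_christoffel, christoffel_gram_sasaki hg z₀ hy]
  rw [inducedChristoffel, projCoeff_apply, ← h2, ← h3]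
  rfl

/-- As `W` is tangent near `t`, differentiating `dq(W) = 0` gives `D²q(c', W) = -dq(W')`. So the
Hessian correction equals `-dq(∇̄ W) / dq(V)`, the coefficient of the projection. No transversality
is used: both sides contain the same quotient, with the same default value where `dq(V) = 0`. -/
theorem isLocallyGiven_inducedD (hg : IsPseudoRiemannian g)
    (e : ∀ x : M, TangentSpace 𝓘(ℝ, E) x) {z₀ : TM E M} {c : ℝ → TM E M}
    {W : ∀ t, TangentSpace (modelTM E) (c t)} {t : ℝ}
    (hx : c t ∈ (extChartAt (modelTM E) z₀).source)
    (hc : ContinuousAt c t) (hd : DifferentiableAt ℝ (fun r => extChartAt (modelTM E) z₀ (c r)) t)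
    (hW : DifferentiableAt ℝ (fun r => toChartEnd (modelTM E) z₀ (c r) (W r)) t)
    (hN : ∀ᶠ r in 𝓝 t, sasaki g (c r) (W r) (normalVec (c r)) = 0) :
    IsLocallyGiven (inducedD g e) (inducedChristoffel g e z₀) c W z₀ t := by
  have h1 := isLocallyGiven_sasakiD hg hx hc hd hW
  have hy := (extChartAt (modelTM E) z₀).map_source hx
  have hq : DifferentiableAt ℝ (fderiv ℝ (energyChart g z₀)) (extChartAt (modelTM E) z₀ (c t)) :=
    ((contDiffAt_energyChart hg z₀ hy).fderiv_right (m := 1)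
      one_add_one_le_infty).differentiableAt one_ne_zero
  have h2 := hasDerivAt_comp_clm_apply (y := fun r => extChartAt (modelTM E) z₀ (c r)) hq
    hd.hasDerivAt hW.hasDerivAt
  have h3 : (fun r => fderiv ℝ (energyChart g z₀) (extChartAt (modelTM E) z₀ (c r))
      (toChartEnd (modelTM E) z₀ (c r) (W r))) =ᶠ[𝓝 t] fun _ => (0 : ℝ) := by
    filter_upwards [hN, hc.eventually ((isOpen_extChartAt_source z₀).mem_nhds hx)] with r hr hr2
    rw [fderiv_energyChart_toChartEnd hg hr2, hr]
  have h4 := h2.unique ((hasDerivAt_const t (0 : ℝ)).congr_of_eventuallyEq h3)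
  unfold IsLocallyGiven at h1 ⊢
  have h5 : toChartEnd (modelTM E) z₀ (c t) (inducedD g e c W t)
      = toChartEnd (modelTM E) z₀ (c t) (sasakiD g c W t)
        - (sasaki g (c t) (sasakiD g c W t) (normalVec (c t))
          / sasaki g (c t) (verField e (c t)) (normalVec (c t)))
          • toChartEnd (modelTM E) z₀ (c t) (verField e (c t)) := by
    have hl : ∀ (L : E × E →L[ℝ] E × E) (a b : E × E) (k : ℝ), L (a - k • b) = L a - k • L b := by
      simp
    exact hl _ _ _ _
  rw [h5, ← fderiv_energyChart_toChartEnd hg hx, ← fderiv_energyChart_toChartEnd hg hx, h1,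
    inducedChristoffel, projCoeff_apply, chartField_extChartAt _ hx, map_add,
    eq_neg_of_add_eq_zero_left h4, ← add_assoc, sub_eq_add_neg, ← neg_smul, ← neg_div]
  congr 3
  ring

/-- The projected derivative is again tangent to the level sets of `q`, so the induced derivative
can be expressed by `inducedChristoffel` a second time. -/
theorem sasaki_inducedD_normalVec (e : ∀ x : M, TangentSpace 𝓘(ℝ, E) x) {c : ℝ → TM E M}
    (hg : IsPseudoRiemannian g) (W : ∀ t, TangentSpace (modelTM E) (c t)) {t : ℝ}
    (h : g (c t).1 (c t).2 (e (c t).1) ≠ 0) :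
    sasaki g (c t) (inducedD g e c W t) (normalVec (c t)) = 0 := by
  rw [hg.symm, ← sasaki_verField_normalVec] at h
  unfold inducedD
  rw [map_sub, map_smul, sub_apply, smul_apply, smul_eq_mul, div_mul_cancel₀ _ h, sub_self]

/-! ### Fields along the geodesic flow -/

variable [T2Space M]

theorem hasDerivAt_sasaki_dFlow_normalVec (hg : IsPseudoRiemannian g) {z : TM E M} {s : ℝ}
    (hs : s ∈ geodesicDomain g z) (V : TangentSpace (modelTM E) z) :
    HasDerivAt (fun r => sasaki g (geodesicFlow g r z) (dFlow g z V r)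
      (normalVec (geodesicFlow g r z))) 0 s := by
  have hev := (isMaximalFlow_geodesicFlow hg).eventually_hasDerivAt_mfderiv
    (isSmoothVectorField_spray hg) hs V
  have hy := mem_extChartAt_target (I := modelTM E) (geodesicFlow g s z)
  have h := hasDerivAt_fderiv_linearized
    (y := fun r => extChartAt (modelTM E) (geodesicFlow g s z) (geodesicFlow g r z))
    (contDiffAt_energyChart hg _ hy)
    ((IsMaximalFlow.contDiffAt_chartField (isSmoothVectorField_spray hg)
      (mem_extChartAt_source _)).differentiableAt (by norm_num))
    (Filter.mem_of_superset ((isOpen_extChartAt_target _).mem_nhds hy)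
      fun y hy => fderiv_energyChart_spray hg _ hy)
    hev.self_of_nhds.2.1 hev.self_of_nhds.2.2
  refine h.congr_of_eventuallyEq ?_
  filter_upwards [hev] with r hr
  exact (fderiv_energyChart_toChartEnd hg hr.1 _).symm

theorem eqOn_of_hasDerivAt_zero {f : ℝ → ℝ} {S : Set ℝ} (hS : IsOpen S) (hS' : S.OrdConnected)
    (hf : ∀ t ∈ S, HasDerivAt f 0 t) {a b : ℝ} (ha : a ∈ S) (hb : b ∈ S) : f a = f b :=
  hS.is_const_of_deriv_eq_zero hS'.isPreconnected
    (fun t ht => (hf t ht).differentiableAt.differentiableWithinAt)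
    (fun t ht => (hf t ht).deriv) ha hb

variable (g) in
/-- The component of a tangent vector of `TM` in the direction of `normalVec`. -/
def normalPart (A : TangentBundle (modelTM E) (TM E M)) : ℝ :=
  sasaki g A.1 A.2 (normalVec A.1)

theorem normalPart_vecAt (z : TM E M) (A : TangentSpace (modelTM E) z) :
    normalPart g (vecAt z A) = sasaki g z A (normalVec z) := rfl

theorem sasaki_dFlow_normalVec (hg : IsPseudoRiemannian g) {z : TM E M} {s : ℝ}
    (hs : s ∈ geodesicDomain g z) (V : TangentSpace (modelTM E) z) :
    sasaki g (geodesicFlow g s z) (dFlow g z V s) (normalVec (geodesicFlow g s z))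
      = sasaki g z V (normalVec z) := by
  have hΦ := isMaximalFlow_geodesicFlow hg
  have h0 := eqOn_of_hasDerivAt_zero (hΦ.isOpen_dom z) (hΦ.ordConnected_dom z)
    (fun t ht => hasDerivAt_sasaki_dFlow_normalVec hg ht V) hs (zero_mem_geodesicDomain hg z)
  have h := congrArg (normalPart g) (vecAt_dFlow_zero hg z V)
  rw [normalPart_vecAt, normalPart_vecAt] at h
  rw [h0, h]

/-- In a chart `g(p, e)` is `dq(Ver(e))`, built from data already known to be differentiable. -/
theorem continuousAt_geodesicFlow_apply (hg : IsPseudoRiemannian g) {z : TM E M} {s : ℝ}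
    (hs : s ∈ geodesicDomain g z) {e : ∀ x : M, TangentSpace 𝓘(ℝ, E) x} (he : IsSmoothField e) :
    ContinuousAt (fun r => g (geodesicFlow g r z).1 (geodesicFlow g r z).2
      (e (geodesicFlow g r z).1)) s := by
  have hy := mem_extChartAt_target (I := modelTM E) (geodesicFlow g s z)
  have h1 : DifferentiableAt ℝ (fderiv ℝ (energyChart g (geodesicFlow g s z)))
      (extChartAt (modelTM E) (geodesicFlow g s z) (geodesicFlow g s z)) :=
    ((contDiffAt_energyChart hg _ hy).fderiv_right (m := 1)
      one_add_one_le_infty).differentiableAt one_ne_zero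
  have h2 := (h1.clm_apply (differentiableAt_chartField_verField hg he _)).continuousAt
  have hc := (isMaximalFlow_geodesicFlow hg).continuousAt hs
  have h3 := h2.comp (f := fun r => extChartAt (modelTM E) (geodesicFlow g s z)
    (geodesicFlow g r z)) (x := s) (hasDerivAt_extChartAt_geodesicFlow hg hs).continuousAt
  refine h3.congr ?_
  filter_upwards [hc.eventually (extChartAt_source_mem_nhds (I := modelTM E) _)] with r hr
  exact fderiv_energyChart_verField hg e hr

theorem eventually_transverse (hg : IsPseudoRiemannian g) {z : TM E M} {s : ℝ}
    (hs : s ∈ geodesicDomain g z) {e : ∀ x : M, TangentSpace 𝓘(ℝ, E) x} (he : IsSmoothField e)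
    (h : g (geodesicFlow g s z).1 (geodesicFlow g s z).2 (e (geodesicFlow g s z).1) ≠ 0) :
    ∀ᶠ r in 𝓝 s, r ∈ geodesicDomain g z ∧
      g (geodesicFlow g r z).1 (geodesicFlow g r z).2 (e (geodesicFlow g r z).1) ≠ 0 :=
  (((isMaximalFlow_geodesicFlow hg).isOpen_dom z).eventually_mem hs).and
    ((continuousAt_geodesicFlow_apply hg hs he).eventually_ne h)

theorem sasaki_velocity_normalVec (hg : IsPseudoRiemannian g) {z : TM E M} {s : ℝ}
    (hs : s ∈ geodesicDomain g z) : sasaki g (geodesicFlow g s z)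
      (velocity (modelTM E) (fun r => geodesicFlow g r z) s) (normalVec (geodesicFlow g s z)) = 0 := by
  rw [(isMaximalFlow_geodesicFlow hg).velocity_eq hs, sasaki_normalVec, spray, verPart_Hor,
    map_zero]
  rfl

theorem inducedChristoffel_nabla_self (hg : IsPseudoRiemannian g)
    (e : ∀ x : M, TangentSpace 𝓘(ℝ, E) x) (z₀ : TM E M) {y : E × E}
    (hy : y ∈ (extChartAt (modelTM E) z₀).target) :
    fderiv ℝ (chartField (spray g) z₀) y (chartField (spray g) z₀ y)
      + inducedChristoffel g e z₀ y (chartField (spray g) z₀ y) (chartField (spray g) z₀ y) = 0 := by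
  have hev := (isOpen_extChartAt_target z₀).mem_nhds hy
  exact projCoeff_nabla_self (contDiffAt_energyChart hg z₀ hy)
    (((isSmoothVectorField_spray hg z₀).contDiffAt hev).differentiableAt (by norm_num))
    (Filter.mem_of_superset hev fun y hy => fderiv_energyChart_spray hg z₀ hy)
    (nabla_chartField_spray hg z₀ hy)

/-- The numerator of the correction is zero along the flow, so the equation holds at every time of
the domain, including times where `V` fails to be transverse. -/
theorem isGeodesicOn_inducedD (hg : IsPseudoRiemannian g) (z : TM E M)
    (e : ∀ x : M, TangentSpace 𝓘(ℝ, E) x) :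
    IsGeodesicOn (inducedD g e) (fun s => geodesicFlow g s z) (geodesicDomain g z) := by
  have hΦ := isMaximalFlow_geodesicFlow hg
  have hv := isSmoothVectorField_spray hg
  refine ⟨(isGeodesicOn_sasakiD hg z).1, fun s hs => ?_⟩
  exact hΦ.covDeriv_velocity_eq_zero hv hs
    (inducedChristoffel_nabla_self hg e _ (mem_extChartAt_target _))
    (isLocallyGiven_inducedD hg e (mem_extChartAt_source _) (hΦ.continuousAt hs)
      (hasDerivAt_extChartAt_geodesicFlow hg hs).differentiableAt
      (differentiableAt_toChartEnd_velocity hg hs)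
      (Filter.mem_of_superset ((hΦ.isOpen_dom z).mem_nhds hs) fun r hr =>
        sasaki_velocity_normalVec hg hr))

theorem isJacobiFieldOn_inducedD (hg : IsPseudoRiemannian g) (z : TM E M)
    {e : ∀ x : M, TangentSpace 𝓘(ℝ, E) x} (he : IsSmoothField e)
    {V : TangentSpace (modelTM E) z} (hV : sasaki g z V (normalVec z) = 0)
    [IsManifold (modelTM E) 1 (TM E M)] :
    IsJacobiFieldOn (inducedD g e) (curvature (inducedCoeff g e))
      (fun s => geodesicFlow g s z) (dFlow g z V) {s ∈ geodesicDomain g z |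
        g (geodesicFlow g s z).1 (geodesicFlow g s z).2 (e (geodesicFlow g s z).1) ≠ 0} := by
  have hΦ := isMaximalFlow_geodesicFlow hg
  have hv := isSmoothVectorField_spray hg
  refine ⟨(isJacobiFieldOn_sasakiD hg z V).1.mono fun s hs => hs.1, ?_⟩
  rintro s ⟨hs, hse⟩
  have hS := eventually_transverse hg hs he hse
  have hD : ∀ᶠ r in 𝓝 s, IsLocallyGiven (inducedD g e)
      (inducedChristoffel g e (geodesicFlow g s z)) (fun r => geodesicFlow g r z) (dFlow g z V)
      (geodesicFlow g s z) r := by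
    filter_upwards [(hΦ.isOpen_dom z).mem_nhds hs, hΦ.eventually_hasDerivAt_mfderiv hv hs V]
      with r hr hr2
    refine isLocallyGiven_inducedD hg e hr2.1 (hΦ.continuousAt hr) hr2.2.1.differentiableAt
      hr2.2.2.differentiableAt ?_
    filter_upwards [(hΦ.isOpen_dom z).mem_nhds hr] with r' hr'
    rw [sasaki_dFlow_normalVec hg hr', hV]
  have hN : ∀ᶠ r in 𝓝 s, sasaki g (geodesicFlow g r z) (inducedD g e (fun r => geodesicFlow g r z)
      (dFlow g z V) r) (normalVec (geodesicFlow g r z)) = 0 :=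
    hS.mono fun r hr => sasaki_inducedD_normalVec e hg (c := fun r => geodesicFlow g r z)
      (dFlow g z V) hr.2
  have hc := hΦ.continuousAt hs
  have hd := (hasDerivAt_extChartAt_geodesicFlow hg hs).differentiableAt
  set z₀ := geodesicFlow g s z with hz₀
  have hy := mem_extChartAt_target (I := modelTM E) z₀
  have hev := (isOpen_extChartAt_target z₀).mem_nhds hy
  -- Transversality enters here: the coefficients contain the inverse of `dq(V)`.
  have hΓ : DifferentiableAt ℝ (inducedChristoffel g e z₀) (extChartAt (modelTM E) z₀ z₀) :=
    differentiableAt_projCoeff ((hg.isLocalMetric_localSasaki z₀).differentiableAt_christoffel hy)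
      (contDiffAt_energyChart hg z₀ hy) (differentiableAt_chartField_verField hg he z₀)
      (by rw [fderiv_energyChart_verField hg e (mem_extChartAt_source z₀)]; exact hse)
  exact hΦ.covDeriv_covDeriv_eq_curvature hv hs V hΓ
    (Filter.mem_of_superset hev fun y hy a b => projCoeff_symm
      ((hg.isLocalMetric_localSasaki z₀).christoffel_symm hy) (contDiffAt_energyChart hg z₀ hy) a b)
    (Filter.mem_of_superset hev fun y hy => inducedChristoffel_nabla_self hg e z₀ hy)
    (Filter.mem_of_superset hev fun y hy a b => inducedCoeff_eq hg e z₀ hy a b)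
    hD
    (isLocallyGiven_inducedD hg e (mem_extChartAt_source _) hc hd
      (hΦ.differentiableAt_covDeriv hv hs V hΓ hD) hN)

theorem apply_curvature_self (hg : IsPseudoRiemannian g) (x : M)
    (u v w : TangentSpace 𝓘(ℝ, E) x) : g x (curvature (leviCivita g) x u v w) w = 0 := by
  have hL := hg.isLocalMetric_gram x
  have h := hL.curv_skew (mem_extChartAt_target x) u v w w
  have h2 := gram_extChartAt g (mem_extChartAt_source (I := 𝓘(ℝ, E)) x)
    (curvature (leviCivita g) x u v w) w
  rw [curvature_leviCivita hg] at h2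
  rw [hL.symm _ w] at h
  rw [toChartEnd_self] at h2
  have h3 : formAt g x (curv (christoffel (gram g x)) (extChartAt 𝓘(ℝ, E) x x) u v w) w = 0 := by
    rw [← h2]
    exact self_eq_neg.1 (eq_neg_of_add_eq_zero_left h)
  have h4 := h3
  rw [← curvature_leviCivita hg] at h4
  exact h4

/-- The vertical part of `∇̄_X J` is `½ R(p, a)p`, with `a` the horizontal part of `J`. It is
orthogonal to `p` by skewness of the curvature, so there is nothing to project. -/
theorem inducedD_dFlow (hg : IsPseudoRiemannian g) {z : TM E M} {s : ℝ}
    (hs : s ∈ geodesicDomain g z) (V : TangentSpace (modelTM E) z)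
    (e : ∀ x : M, TangentSpace 𝓘(ℝ, E) x) :
    inducedD g e (fun r => geodesicFlow g r z) (dFlow g z V) s
      = sasakiD g (fun r => geodesicFlow g r z) (dFlow g z V) s := by
  have h : sasaki g (geodesicFlow g s z) (sasakiD g (fun r => geodesicFlow g r z) (dFlow g z V) s)
      (normalVec (geodesicFlow g s z)) = 0 := by
    rw [sasakiD_dFlow hg hs, sasaki_normalVec]
    have : verPart g (geodesicFlow g s z) (nablaSpray g (geodesicFlow g s z) (dFlow g z V s))
        = (1 / 2 : ℝ) • curvature (leviCivita g) _ (geodesicFlow g s z).2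
          (horPart (geodesicFlow g s z) (dFlow g z V s)) (geodesicFlow g s z).2 := by
      refine (map_add (verPart g (geodesicFlow g s z)) _ _).trans ?_
      rw [verPart_Hor, zero_add, map_smul, verPart_Ver]
    rw [this, map_smul, smul_apply, apply_curvature_self hg, smul_zero]
  unfold inducedD
  rw [h, zero_div, zero_smul, sub_zero]

end Induced

section MassShell

/-! ### The mass shell is invariant -/

/-- Positivity is given only on the complement of one particular `u`, not of `T`. Subtracting a
multiple `k • T` moves `p` into that complement, where its square `k² h(T, T)` is nonpositive; so
both `p - k • T` and `k` vanish. -/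
theorem IsLorentzian.eq_zero_of_null {F : Type*} [NormedAddCommGroup F] [NormedSpace ℝ F]
    {K : Type*} [TopologicalSpace K] {J : ModelWithCorners ℝ F K}
    {N : Type*} [TopologicalSpace N] [ChartedSpace K N] {h : BilinField J N} (hh : IsLorentzian h)
    {x : N} {p T : TangentSpace J x} (hT : h x T T < 0) (hp : h x p p = 0) (hpT : h x p T = 0) :
    p = 0 := by
  obtain ⟨u, -, hpos⟩ := hh.signature x
  have ha : h x u T ≠ 0 := fun h0 => by
    have hT0 : T ≠ 0 := by
      rintro rfl
      rw [map_zero] at hT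
      exact lt_irrefl _ hT
    linarith [hpos T h0 hT0]
  set k := h x u p / h x u T with hk
  have hu : h x u (p - k • T) = 0 := by
    rw [map_sub, map_smul, smul_eq_mul, hk, div_mul_cancel₀ _ ha, sub_self]
  have hw : h x (p - k • T) (p - k • T) = k ^ 2 * h x T T := by
    simp only [map_sub, map_smul, sub_apply, smul_apply, smul_eq_mul, hp, hpT, hh.symm x T p]
    ring
  have hw0 : p - k • T = 0 := by
    by_contra hne
    have := hpos _ hu hne
    rw [hw] at this
    nlinarith [sq_nonneg k]
  have hk0 : k = 0 := by
    rw [hw0, map_zero] at hw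
    exact pow_eq_zero_iff (two_ne_zero) |>.1 ((mul_eq_zero.1 hw.symm).resolve_right hT.ne)
  rwa [hk0, zero_smul, sub_zero] at hw0

variable {E : Type*} [NormedAddCommGroup E] [NormedSpace ℝ E] [FiniteDimensional ℝ E]
  {M : Type*} [TopologicalSpace M] [ChartedSpace E M] [IsManifold 𝓘(ℝ, E) ∞ M]
  {g : BilinField 𝓘(ℝ, E) M}

theorem spray_eq_zero {z : TM E M} (hz : z.2 = 0) : spray g z = 0 := by
  have h : ((0 : E), - christoffelAt g z 0) = (0 : E × E) := by rw [map_zero, neg_zero]; rfl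
  rw [spray, hz]
  exact h

variable [T2Space M]

theorem geodesicFlow_of_zero (hg : IsPseudoRiemannian g) {z : TM E M} (hz : z.2 = 0) (s : ℝ) :
    s ∈ geodesicDomain g z ∧ geodesicFlow g s z = z := by
  refine (isMaximalFlow_geodesicFlow hg).mem_and_eq (γ := fun _ => z) (a := -(|s| + 1))
    (b := |s| + 1) ?_ (fun t _ => ?_) rfl s ?_
  · constructor <;> linarith [abs_nonneg s]
  · refine HasMFDerivAt.hasMFDerivWithinAt ?_
    rw [spray_eq_zero hz]
    refine (hasMFDerivAt_const z t).congr_mfderiv ?_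
    exact (ContinuousLinearMap.smulRight_zero (M₁ := ℝ) (M₂ := E × E) (1 : ℝ →L[ℝ] ℝ)).symm
  · constructor <;> linarith [neg_abs_le s, le_abs_self s]

/-- Zero vectors are fixed points, so an orbit that reached one could be followed back by time `-s`
without moving, and would have started there. -/
theorem geodesicFlow_snd_ne_zero (hg : IsPseudoRiemannian g) {z : TM E M} (hz : z.2 ≠ 0) {s : ℝ}
    (hs : s ∈ geodesicDomain g z) : (geodesicFlow g s z).2 ≠ 0 := by
  intro h0
  have h1 := geodesicFlow_of_zero hg h0 (-s)
  have h2 := ((isMaximalFlow_geodesicFlow hg).add_mem_dom (isSmoothVectorField_spray hg) hs h1.1).2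
  rw [add_neg_cancel, geodesicFlow_zero hg, h1.2, id] at h2
  rw [← h2] at h0
  exact hz h0

theorem geodesicFlow_energy (hg : IsPseudoRiemannian g) {z : TM E M} {s : ℝ}
    (hs : s ∈ geodesicDomain g z) : energy g (geodesicFlow g s z) = energy g z := by
  have hΦ := isMaximalFlow_geodesicFlow hg
  have h0 := eqOn_of_hasDerivAt_zero (f := fun r => energy g (geodesicFlow g r z))
    (hΦ.isOpen_dom z) (hΦ.ordConnected_dom z) (fun t ht => ?_) hs (zero_mem_geodesicDomain hg z)
  · simpa only [geodesicFlow_zero hg, id] using h0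
  · have hy := mem_extChartAt_target (I := modelTM E) (geodesicFlow g t z)
    have h1 := ((contDiffAt_energyChart hg _ hy).differentiableAt
      (by norm_num)).hasFDerivAt.comp_hasDerivAt
        (f := fun r => extChartAt (modelTM E) (geodesicFlow g t z) (geodesicFlow g r z)) t
        (hasDerivAt_extChartAt_geodesicFlow hg ht)
    rw [fderiv_energyChart_spray hg _ hy] at h1
    refine h1.congr_of_eventuallyEq ?_
    filter_upwards [(hΦ.continuousAt ht).eventually (extChartAt_source_mem_nhds (I := modelTM E) _)]
      with r hr
    exact congrArg (energy g) ((extChartAt (modelTM E) (geodesicFlow g t z)).left_inv hr).symm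

theorem geodesicFlow_mem_massShell (hg : IsLorentzian g) {T : ∀ x : M, TangentSpace 𝓘(ℝ, E) x}
    (hT : IsSmoothField T) (hT' : ∀ y, g y (T y) (T y) < 0) {z : TM E M} (hz : z ∈ massShell g T)
    {s : ℝ} (hs : s ∈ geodesicDomain g z) : geodesicFlow g s z ∈ massShell g T := by
  have hp := hg.isPseudoRiemannian
  have hΦ := isMaximalFlow_geodesicFlow hp
  have hnull : ∀ r ∈ geodesicDomain g z,
      g (geodesicFlow g r z).1 (geodesicFlow g r z).2 (geodesicFlow g r z).2 = 0 := fun r hr => by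
    have h := geodesicFlow_energy hp hr
    rw [energy, energy, hz.1] at h
    linarith
  have hz0 : z.2 ≠ 0 := fun h0 => by
    have := hz.2
    rw [h0, map_zero] at this
    exact lt_irrefl _ this
  refine ⟨hnull s hs, ?_⟩
  by_contra hneg
  have h0 := zero_mem_geodesicDomain hp z
  have hneg0 : g (geodesicFlow g 0 z).1 (geodesicFlow g 0 z).2 (T (geodesicFlow g 0 z).1) ≤ 0 := by
    rw [geodesicFlow_zero hp]
    exact hz.2.le
  -- If `g(p, T)` were not negative at time `s`, it would vanish at some time of the domain; there
  -- the momentum is null, orthogonal to `T`, and hence zero.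
  obtain ⟨r, hr, hr0⟩ := (hΦ.ordConnected_dom z).isPreconnected.intermediate_value h0 hs
    (f := fun r => g (geodesicFlow g r z).1 (geodesicFlow g r z).2 (T (geodesicFlow g r z).1))
    (fun t ht => (continuousAt_geodesicFlow_apply hp ht hT).continuousWithinAt)
    ⟨hneg0, not_lt.1 hneg⟩
  exact geodesicFlow_snd_ne_zero hp hz0 hr (hg.eq_zero_of_null (hT' _) (hnull r hr) hr0)

theorem sasaki_Hor_normalVec (z : TM E M) (v : TangentSpace 𝓘(ℝ, E) z.1) :
    sasaki g z (Hor g z v) (normalVec z) = 0 := sasaki_Hor_Ver g z v z.2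

end MassShell

end Sasaki

end

/-! ### Assembly of the statements in `TM` and in the mass shell -/

theorem proposition4p4 {E : Type*} [NormedAddCommGroup E] [NormedSpace ℝ E] [FiniteDimensional ℝ E]
    {M : Type*} [TopologicalSpace M] [T2Space M] [ChartedSpace E M] [IsManifold 𝓘(ℝ, E) ∞ M]
    (g : BilinField 𝓘(ℝ, E) M) (hg : IsLorentzian g)
    (x : M) (p : TangentSpace 𝓘(ℝ, E) x) :
    let z : TM E M := TM.mk x p
    let dom : Set ℝ := geodesicDomain g z
    let traj : ℝ → TM E M := fun s => geodesicFlow g s z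
    let R := curvature (leviCivita g) x
    let J_H := fun v : TangentSpace 𝓘(ℝ, E) x => dFlow g z (Hor g z v)
    let J_V := fun v : TangentSpace 𝓘(ℝ, E) x => dFlow g z (Ver z v)
    -- the flow is defined on an open interval around `0`, and `d exp_s` exists at `z`
    (IsOpen dom ∧ dom.OrdConnected ∧ 0 ∈ dom ∧
      ∀ s ∈ dom, MDifferentiableAt (modelTM E) (modelTM E) (geodesicFlow g s) z) ∧
    -- the statements in `TM`, with the Levi-Civita connection of the Sasaki metric
    IsGeodesicOn (sasakiD g) traj dom ∧
    (∀ v : TangentSpace 𝓘(ℝ, E) x,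
      IsJacobiFieldOn (sasakiD g) (curvature (leviCivita (sasaki g))) traj (J_H v) dom ∧
      vecAt (traj 0) (J_H v 0) = vecAt z (Hor g z v) ∧
      vecAt (traj 0) (sasakiD g traj (J_H v) 0) = vecAt z ((1 / 2 : ℝ) • Ver z (R p v p))) ∧
    (∀ v : TangentSpace 𝓘(ℝ, E) x,
      IsJacobiFieldOn (sasakiD g) (curvature (leviCivita (sasaki g))) traj (J_V v) dom ∧
      vecAt (traj 0) (J_V v 0) = vecAt z (Ver z v) ∧
      vecAt (traj 0) (sasakiD g traj (J_V v) 0)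
        = vecAt z (Hor g z v + (1 / 2 : ℝ) • Hor g z (R p v p))) ∧
    -- the statements in the mass shell `P`, with the induced connection
    (∀ T e : (y : M) → TangentSpace 𝓘(ℝ, E) y,
      IsSmoothField T → (∀ y, g y (T y) (T y) < 0) → IsSmoothField e → z ∈ massShell g T →
      let S : Set ℝ := {s ∈ dom | g (traj s).1 (traj s).2 (e (traj s).1) ≠ 0}
      (∀ s ∈ dom, traj s ∈ massShell g T) ∧
      IsGeodesicOn (inducedD g e) traj S ∧
      (∀ v : TangentSpace 𝓘(ℝ, E) x,
        (∀ s ∈ dom, sasaki g (traj s) (J_H v s) (normalVec (traj s)) = 0) ∧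
        IsJacobiFieldOn (inducedD g e) (curvature (inducedCoeff g e)) traj (J_H v) S ∧
        (g x p (e x) ≠ 0 →
          vecAt (traj 0) (inducedD g e traj (J_H v) 0)
            = vecAt z ((1 / 2 : ℝ) • Ver z (R p v p)))) ∧
      (∀ v : TangentSpace 𝓘(ℝ, E) x, g x p v = 0 →
        (∀ s ∈ dom, sasaki g (traj s) (J_V v s) (normalVec (traj s)) = 0) ∧
        IsJacobiFieldOn (inducedD g e) (curvature (inducedCoeff g e)) traj (J_V v) S ∧
        (g x p (e x) ≠ 0 →
          vecAt (traj 0) (inducedD g e traj (J_V v) 0)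
            = vecAt z (Hor g z v + (1 / 2 : ℝ) • Hor g z (R p v p))))) := by
  intro z dom traj R J_H J_V
  have hp := hg.isPseudoRiemannian
  have hΦ := isMaximalFlow_geodesicFlow hp
  have hv := isSmoothVectorField_spray hp
  have h0 : 0 ∈ dom := zero_mem_geodesicDomain hp z
  have hH : ∀ v : TangentSpace 𝓘(ℝ, E) x,
      vecAt (traj 0) (sasakiD g traj (J_H v) 0) = vecAt z ((1 / 2 : ℝ) • Ver z (R p v p)) :=
    fun v => (vecAt_sasakiD_dFlow_zero hp z (Hor g z v)).trans
      (congrArg (vecAt z) (nablaSpray_Hor hp z v))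
  have hV : ∀ v : TangentSpace 𝓘(ℝ, E) x, vecAt (traj 0) (sasakiD g traj (J_V v) 0)
      = vecAt z (Hor g z v + (1 / 2 : ℝ) • Hor g z (R p v p)) :=
    fun v => (vecAt_sasakiD_dFlow_zero hp z (Ver z v)).trans
      (congrArg (vecAt z) (nablaSpray_Ver hp z v))
  refine ⟨⟨hΦ.isOpen_dom z, hΦ.ordConnected_dom z, h0,
    fun s hs => (hΦ.eventually_mem_dom_and_mdifferentiableAt hv hs).2⟩,
    isGeodesicOn_sasakiD hp z,
    fun v => ⟨isJacobiFieldOn_sasakiD hp z _, vecAt_dFlow_zero hp z _, hH v⟩,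
    fun v => ⟨isJacobiFieldOn_sasakiD hp z _, vecAt_dFlow_zero hp z _, hV v⟩, ?_⟩
  intro T e hT hT' he hz S
  have hS : S ⊆ dom := fun s hs => hs.1
  have hgeo := isGeodesicOn_inducedD hp z e
  refine ⟨fun s hs => geodesicFlow_mem_massShell hg hT hT' hz hs,
    ⟨hgeo.1.mono hS, fun t ht => hgeo.2 t (hS ht)⟩, fun v => ?_, fun v hv0 => ?_⟩
  · have h1 : sasaki g z (Hor g z v) (normalVec z) = 0 := sasaki_Hor_normalVec z v
    refine ⟨fun s hs => (sasaki_dFlow_normalVec hp hs _).trans h1,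
      isJacobiFieldOn_inducedD hp z he h1, fun _ => ?_⟩
    exact (congrArg (vecAt (traj 0)) (inducedD_dFlow hp h0 _ e)).trans (hH v)
  · have h1 : sasaki g z (Ver z v) (normalVec z) = 0 :=
      (sasaki_verField_normalVec z v).trans ((hp.symm x v p).trans hv0)
    refine ⟨fun s hs => (sasaki_dFlow_normalVec hp hs _).trans h1,
      isJacobiFieldOn_inducedD hp z he h1, fun _ => ?_⟩
    exact (congrArg (vecAt (traj 0)) (inducedD_dFlow hp h0 _ e)).trans (hV v)
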